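/- Let $n\ge 2$ and let $\mathcal T_n$ be the infinite tree in which every vertex has valence $n+1$. Its boundary $\mathrm{Abs}(\mathcal T_n)$ is the set of one-sided infinite non-backtracking sequences of vertices, two sequences being identified if they eventually coincide up to a shift of the numbering. A *ball* is the set of boundary points represented by sequences lying in one of the two branches obtained by cutting an edge in the middle; the balls generate the topology of the boundary. Let $\mathrm{Hier}(\mathcal T_n)$ be the group of homeomorphisms of $\mathrm{Abs}(\mathcal T_n)$ that locally coincide with automorphisms of $\mathcal T_n$; it contains (the image of) $\mathrm{Aut}(\mathcal T_n)$. It is topologized so that $\mathrm{Aut}(\mathcal T_n)$ is open and the pointwise stabilizers in $\mathrm{Aut}(\mathcal T_n)$ of finite sets of vertices form a basis of neighbourhoods of $1$. For $0\le\iota\le n-2$ let $\mathrm{Clop}^\circ_\iota$ be the set of nonempty proper clopen subsets of $\mathrm{Abs}(\mathcal T_n)$ that are disjoint unions of $m$ balls with $m\equiv\iota \pmod{n-1}$. A (nonempty) *thorn* is a finite tree $R$ with valences at most $n+1$ which either has at least three points, its points of valence $1$ being called spikes and all other points vertices, or consists of one vertex and one spike joined by an edge. Isomorphisms of thorns send vertices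 to vertices and spikes to spikes. A thorn is *reduced* if no vertex of it is adjacent to $n$ or more spikes. An embedding $f$ of the tree $R$ in $\mathcal T_n$ determines the clopen set $\Omega(f)$, the union of the balls of the branches that contain $f(s)$ after cutting the edges $f(a)f(s)$, over all spikes $s$, where $a$ is the vertex adjacent to $s$. Let $T_1,\dots,T_N$ be pairwise non-isomorphic reduced thorns whose numbers of spikes are all congruent to the same $\iota$ modulo $n-1$, and let $\mathcal O_j$ be the set of all $\Omega(f)$, where $f$ ranges over the embeddings of $T_j$ in $\mathcal T_n$. Then: 1. $\mathrm{Clop}^\circ_\iota$ is countable, and $\mathcal O_1,\dots,\mathcal O_N$ are pairwise disjoint $\mathrm{Aut}(\mathcal T_n)$-orbits in it. With $\mathcal P=\mathrm{Clop}^\circ_\iota\setminus\bigcup_j\mathcal O_j$ one has the partition $\mathrm{Clop}^\circ_\iota=\mathcal P\sqcup\mathcal O_1\sqcup\dots\sqcup\mathcal O_N$, and all its pieces are infinite. 2. Denote the pieces of this partition by $\Pi_p$, and let $\mathbf G$ be the group of all permutations $\sigma$ of $\mathrm{Clop}^\circ_\iota$ such that, for every $p$, $\sigma\alpha\in\Pi_p$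 for all but finitely many $\alpha\in\Pi_p$. Let $\mathbf K\subset\mathbf G$ be the subgroup of permutations preserving every $\Pi_p$. The group $\mathrm{Hier}(\mathcal T_n)$ acts on $\mathrm{Clop}^\circ_\iota$ by $\Omega\mapsto g\Omega$, and this defines an injective homomorphism $\varphi:\mathrm{Hier}(\mathcal T_n)\to\mathbf G$ with $\varphi(\mathrm{Aut}(\mathcal T_n))\subset\mathbf K$. 3. Let $S=(s_{pq})$ be a positive semidefinite Hermitian matrix of size $N+1$, indexed by the pieces, with $s_{pp}=1$. Then there are unit vectors $e_p$ in a finite-dimensional complex Euclidean space $V$ with $\langle e_p,e_q\rangle=s_{pq}$. For any such $V$ and $e_p$ let $\mathbf G$ act by permutations $\rho$ of the factors in the infinite tensor product of Hilbert spaces $\mathcal H=\bigotimes_p\bigotimes_{\alpha\in\Pi_p}(V,e_p)$ with distinguished vectors $e_p$, and let $\mathcal E=\bigotimes_p e_p^{\otimes\infty}$, which is a unit vector. For $\sigma\in\mathbf G$ let $\theta_{pq}(\sigma)$ be the number of $\alpha\in\Pi_p$ with $\sigma\alpha\in\Pi_q$, and put $\Phi_S(\sigma)=\prod_{p,q}s_{pq}^{\theta_{pq}(\sigma)}$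 (the factors with $p=q$ being $1$). Topologize $\mathbf G$ so that $\mathbf K$ is open and the pointwise stabilizers in $\mathbf K$ of finite sets form a basis of neighbourhoods of $1$. Call a strongly continuous irreducible unitary representation of a topological group $K$-spherical with spherical vector $v\neq 0$ if its $K$-fixed vectors are exactly the multiples of $v$. Then: * the representation of $\mathbf G$ in the closed $\mathbf G$-cyclic span of $\mathcal E$ is $\mathbf K$-spherical with spherical vector $\mathcal E$ and spherical function $\langle\rho(\sigma)\mathcal E,\mathcal E\rangle=\Phi_S(\sigma)$; * for the restriction $\rho\circ\varphi$ to $\mathrm{Hier}(\mathcal T_n)$, the $\mathrm{Aut}(\mathcal T_n)$-fixed vectors in all of $\mathcal H$ are exactly the multiples of $\mathcal E$, and the representation of $\mathrm{Hier}(\mathcal T_n)$ in the closed $\mathrm{Hier}(\mathcal T_n)$-cyclic span of $\mathcal E$ is $\mathrm{Aut}(\mathcal T_n)$-spherical with spherical vector $\mathcal E$ and spherical function $g\mapsto\Phi_S(\varphi(g))$. -/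

import Mathlib

open scoped Topology ComplexOrder

noncomputable section

set_option linter.unusedSectionVars false

/-! ## The boundary of a tree and the group of spheromorphisms -/

namespace Sphero

/-- A way: a one-sided infinite sequence of vertices without backtracking. -/
def Way {X : Type*} (T : SimpleGraph X) : Type _ :=
  {a : ℕ → X // (∀ i, T.Adj (a i) (a (i + 1))) ∧ ∀ i, a (i + 2) ≠ a i}

/-- Two ways are equivalent if they eventually coincide up to a shift of the numbering. -/
def waySetoid {X : Type*} (T : SimpleGraph X) : Setoid (Way T) where
  r a b := ∃ i j : ℕ, ∀ m, a.1 (i + m) = b.1 (j + m)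
  iseqv :=
    { refl := fun _ => ⟨0, 0, fun _ => rfl⟩
      symm := fun ⟨i, j, h⟩ => ⟨j, i, fun m => (h m).symm⟩
      trans := by
        rintro a b c ⟨i, j, h⟩ ⟨k, l, h'⟩
        refine ⟨i + k, l + j, fun m => ?_⟩
        have h1 := h (k + m)
        have h2 := h' (j + m)
        rw [show i + k + m = i + (k + m) by omega, show l + j + m = l + (j + m) by omega,
          h1, ← h2, show j + (k + m) = k + (j + m) by omega] }

/-- The boundary `Abs(T)`. -/
def Boundary {X : Type*} (T : SimpleGraph X) : Type _ := Quotient (waySetoid T)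

/-- The boundary point defined by a way. -/
def Way.limit {X : Type*} {T : SimpleGraph X} (a : Way T) : Boundary T :=
  Quotient.mk (waySetoid T) a

/-- The vertices of the branch that contains `q` when the edge `pq` is cut in the middle. -/
def branch {X : Type*} (T : SimpleGraph X) (p q : X) : Set X :=
  {x | (T.deleteEdges {s(p, q)}).Reachable q x}

/-- The ball of all boundary points represented by ways lying in `branch T p q`. -/
def ball {X : Type*} (T : SimpleGraph X) (p q : X) : Set (Boundary T) :=
  {y | ∃ a : Way T, (∀ i, a.1 i ∈ branch T p q) ∧ a.limit = y}

def IsBall {X : Type*} (T : SimpleGraph X) (B : Set (Boundary T)) : Prop :=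
  ∃ p q, T.Adj p q ∧ B = ball T p q

/-- The topology of the boundary is generated by the balls (the complement of the ball of `pq` is
the ball of `qp`, so that the balls are clopen). -/
instance boundaryTopology {X : Type*} (T : SimpleGraph X) : TopologicalSpace (Boundary T) :=
  TopologicalSpace.generateFrom {B | IsBall T B}

def Way.map {X : Type*} {T : SimpleGraph X} (r : T ≃g T) (a : Way T) : Way T :=
  ⟨fun i => r (a.1 i), fun i => r.map_adj_iff.2 (a.2.1 i),
    fun i h => a.2.2 i (r.injective h)⟩

/-- The action of an automorphism of the tree on the boundary. -/
def autMap {X : Type*} {T : SimpleGraph X} (r : T ≃g T) : Boundary T → Boundary T :=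
  Quotient.map (sa := waySetoid T) (sb := waySetoid T) (Way.map r)
    (by rintro a b ⟨i, j, h⟩; exact ⟨i, j, fun m => congrArg r (h m)⟩)

theorem autMap_limit {X : Type*} {T : SimpleGraph X} (r : T ≃g T) (a : Way T) :
    autMap r a.limit = (a.map r).limit := rfl

theorem autMap_mul {X : Type*} {T : SimpleGraph X} (r s : T ≃g T) (y : Boundary T) :
    autMap (r * s) y = autMap r (autMap s y) := by
  induction y using Quotient.inductionOn with
  | h a => rfl

theorem autMap_one {X : Type*} {T : SimpleGraph X} (y : Boundary T) :
    autMap (1 : T ≃g T) y = y := by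
  induction y using Quotient.inductionOn with
  | h a => rfl

theorem map_mem_branch {X : Type*} {T : SimpleGraph X} (r : T ≃g T) {p q x : X}
    (hx : x ∈ branch T p q) : r x ∈ branch T (r p) (r q) := by
  refine SimpleGraph.Reachable.map
    (⟨r, ?_⟩ : T.deleteEdges {s(p, q)} →g T.deleteEdges {s(r p, r q)}) hx
  intro a b h
  rw [SimpleGraph.deleteEdges_adj] at h ⊢
  refine ⟨r.map_adj_iff.2 h.1, fun h' => h.2 ?_⟩
  have h'' : s(r a, r b) = s(r p, r q) := h'
  simpa [Sym2.eq_iff, r.injective.eq_iff] using h''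

theorem autMap_mem_ball {X : Type*} {T : SimpleGraph X} (r : T ≃g T) {p q : X} {y : Boundary T}
    (hy : y ∈ ball T p q) : autMap r y ∈ ball T (r p) (r q) := by
  obtain ⟨a, ha, rfl⟩ := hy
  exact ⟨a.map r, fun i => map_mem_branch r (ha i), rfl⟩

theorem continuous_autMap {X : Type*} {T : SimpleGraph X} (r : T ≃g T) :
    Continuous (autMap r) := by
  refine continuous_generateFrom_iff.2 ?_
  rintro B ⟨p, q, hpq, rfl⟩
  refine TopologicalSpace.isOpen_generateFrom_of_mem
    ⟨r⁻¹ p, r⁻¹ q, (r⁻¹ : T ≃g T).map_adj_iff.2 hpq, ?_⟩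
  ext y
  constructor
  · intro h
    have := autMap_mem_ball r⁻¹ h
    rwa [← autMap_mul, inv_mul_cancel, autMap_one] at this
  · intro h
    have h1 := autMap_mem_ball r h
    have h2 : ∀ x, r ((r⁻¹ : T ≃g T) x) = x := fun x => r.apply_symm_apply x
    rwa [h2, h2] at h1

/-- The homomorphism from the automorphisms of the tree to the homeomorphisms of the boundary. -/
def autHomeo {X : Type*} (T : SimpleGraph X) : (T ≃g T) →* (Boundary T ≃ₜ Boundary T) where
  toFun r :=
    { toFun := autMap r
      invFun := autMap r⁻¹
      left_inv := fun y => by rw [← autMap_mul, inv_mul_cancel, autMap_one]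
      right_inv := fun y => by rw [← autMap_mul, mul_inv_cancel, autMap_one]
      continuous_toFun := continuous_autMap r
      continuous_invFun := continuous_autMap r⁻¹ }
  map_one' := by ext y; exact autMap_one y
  map_mul' r s := by ext y; exact autMap_mul r s y

/-- The group `Hier(T)` of spheromorphisms: homeomorphisms of the boundary which coincide in some
neighbourhood of each point with an automorphism of the tree. -/
def Hier {X : Type*} (T : SimpleGraph X) : Subgroup (Boundary T ≃ₜ Boundary T) where
  carrier := {g | ∀ y, ∃ N ∈ 𝓝 y, ∃ r : T ≃g T, ∀ z ∈ N, g z = autHomeo T r z}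
  one_mem' := fun y => ⟨Set.univ, Filter.univ_mem, 1, fun z _ => by rw [map_one]⟩
  mul_mem' := by
    intro g h hg hh y
    obtain ⟨N, hN, r, hr⟩ := hh y
    obtain ⟨M, hM, s, hs⟩ := hg (h y)
    refine ⟨N ∩ h ⁻¹' M, Filter.inter_mem hN (h.continuous.continuousAt hM), s * r, ?_⟩
    rintro z ⟨hz1, hz2⟩
    rw [map_mul]
    change g (h z) = autHomeo T s (autHomeo T r z)
    rw [← hr z hz1, hs _ hz2]
  inv_mem' := by
    intro g hg y
    obtain ⟨N, hN, r, hr⟩ := hg (g⁻¹ y)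
    refine ⟨(g⁻¹ : Boundary T ≃ₜ Boundary T) ⁻¹' N,
      (g⁻¹ : Boundary T ≃ₜ Boundary T).continuous.continuousAt hN, r⁻¹, fun z hz => ?_⟩
    have h1 := hr _ hz
    have h2 : g ((g⁻¹ : Boundary T ≃ₜ Boundary T) z) = z := g.apply_symm_apply z
    rw [h2] at h1
    have h3 : autHomeo T r⁻¹ (autHomeo T r ((g⁻¹ : Boundary T ≃ₜ Boundary T) z)) =
        (g⁻¹ : Boundary T ≃ₜ Boundary T) z := by
      rw [map_inv]; exact (autHomeo T r).symm_apply_apply _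
    rw [← h3, ← h1]

/-- The inclusion of `Aut(T)` in `Hier(T)`. -/
def autToHier {X : Type*} (T : SimpleGraph X) : (T ≃g T) →* Hier T :=
  (autHomeo T).codRestrict (Hier T) fun r _ => ⟨Set.univ, Filter.univ_mem, r, fun _ _ => rfl⟩

/-- `Aut(T)` as a subgroup of `Hier(T)`. -/
def autSubgroup {X : Type*} (T : SimpleGraph X) : Subgroup (Hier T) := (autToHier T).range

/-- The topology of `Hier(T)`: the subgroup `Aut(T)` is open, and its subgroups fixing a finite set
of vertices are a basis of neighbourhoods of the unit. -/
@[reducible] def hierTopology {X : Type*} (T : SimpleGraph X) : TopologicalSpace (Hier T) :=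
  TopologicalSpace.generateFrom
    {U | ∃ (g : Hier T) (F : Finset X),
      U = {h | ∃ r : T ≃g T, (∀ v ∈ F, r v = v) ∧ h = g * autToHier T r}}

/-! ## Clopen sets and thorns -/

/-- The set of those proper nonempty clopen subsets of the boundary which are disjoint unions of
`m` balls with `m` congruent to `ι` modulo `n - 1`. -/
def ClopRes {X : Type*} (T : SimpleGraph X) (n ι : ℕ) : Set (Set (Boundary T)) :=
  {Ω | IsClopen Ω ∧ Ω.Nonempty ∧ Ω ≠ Set.univ ∧
    ∃ (m : ℕ) (B : Fin m → Set (Boundary T)), m ≡ ι [MOD n - 1] ∧ (∀ i, IsBall T (B i)) ∧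
      Pairwise (fun i j => Disjoint (B i) (B j)) ∧ Ω = ⋃ i, B i}

/-- A nonempty thorn. It is a finite tree with valences at most `n + 1`, whose cells are divided
into spikes and vertices. Either the tree has at least three cells and the spikes are its points of
valence one, or it consists of one vertex and one spike. -/
structure Thorn (n : ℕ) where
  Cell : Type
  finite : Finite Cell
  graph : SimpleGraph Cell
  isTree : graph.IsTree
  valence_le : ∀ x, (graph.neighborSet x).ncard ≤ n + 1
  spike : Set Cell
  spike_spec : (3 ≤ Nat.card Cell ∧ ∀ x, x ∈ spike ↔ (graph.neighborSet x).ncard = 1) ∨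
    (Nat.card Cell = 2 ∧ spike.ncard = 1)

/-- A thorn is reduced if no vertex carries `n` or more spikes. If there are at least two vertices,
the vertices with at least `n` spikes are exactly the perfect ones, namely the end vertices of the
skeleton with valence `n + 1`. If there is only one vertex, the condition excludes the thorns with
`n` spikes (a union of balls that is itself a ball) and with `n + 1` spikes (a perfect thorn). -/
def Thorn.IsReduced {n : ℕ} (R : Thorn n) : Prop :=
  ∀ a, a ∉ R.spike → {s | s ∈ R.spike ∧ R.graph.Adj a s}.ncard < n

def Thorn.Isomorphic {n : ℕ} (R R' : Thorn n) : Prop :=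
  ∃ f : R.graph ≃g R'.graph, ∀ x, f x ∈ R'.spike ↔ x ∈ R.spike

/-- The clopen set of an embedded thorn: the union of the balls cut off by its spikes. A spike `s`
attached to the vertex `a` sits at the middle of the edge from `f a` to `f s`. -/
def Thorn.clopen {X : Type*} {T : SimpleGraph X} {n : ℕ} (R : Thorn n) (f : R.graph ↪g T) :
    Set (Boundary T) :=
  {y | ∃ a s, a ∉ R.spike ∧ s ∈ R.spike ∧ R.graph.Adj a s ∧ y ∈ ball T (f a) (f s)}

/-- The clopen sets corresponding to all sub-thorns of `T` isomorphic to `R`. -/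
def Thorn.clopens {X : Type*} (T : SimpleGraph X) {n : ℕ} (R : Thorn n) :
    Set (Set (Boundary T)) :=
  {Ω | ∃ f : R.graph ↪g T, Ω = R.clopen f}

/-- The `Aut(T)`-orbit of a set of boundary points. -/
def autOrbit {X : Type*} (T : SimpleGraph X) (Ω : Set (Boundary T)) : Set (Set (Boundary T)) :=
  {Ω' | ∃ r : T ≃g T, Ω' = autHomeo T r '' Ω}

open Classical in
/-- The piece of the partition to which a clopen set belongs: `some j` for the clopen sets
corresponding to the thorn `R j`, and `none` for the complement of the union of these. -/
def pieceOf {X : Type*} (T : SimpleGraph X) {n : ℕ} (ι : ℕ) {N : ℕ} (R : Fin N → Thorn n)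
    (Ω : ClopRes T n ι) : Option (Fin N) :=
  if h : ∃ j, (Ω : Set (Boundary T)) ∈ (R j).clopens T then some h.choose else none

/-! ## The Young-type permutation group -/

/-- For a set `P` divided into pieces `{α | c α = p}`, the group `𝐆` of all permutations of `P`
which, for every `p`, send all but finitely many elements of the `p`-th piece to this piece. -/
def bigG {P κ : Type*} [Finite κ] (c : P → κ) : Subgroup (Equiv.Perm P) where
  carrier := {σ | ∀ p, {α | c α = p ∧ c (σ α) ≠ p}.Finite}
  one_mem' := fun p => by
    have : {α | c α = p ∧ c ((1 : Equiv.Perm P) α) ≠ p} = ∅ := by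
      ext α; simp
    rw [this]; exact Set.finite_empty
  mul_mem' := by
    intro σ τ hσ hτ p
    refine ((hτ p).union ((hσ p).preimage τ.injective.injOn)).subset ?_
    rintro α ⟨h1, h2⟩
    by_cases h : c (τ α) = p
    · exact Or.inr ⟨h, h2⟩
    · exact Or.inl ⟨h1, h⟩
  inv_mem' := by
    intro σ hσ p
    refine ((Set.finite_iUnion fun q => hσ q).image σ).subset ?_
    rintro α ⟨h1, h2⟩
    refine ⟨σ⁻¹ α, Set.mem_iUnion.2 ⟨c (σ⁻¹ α), rfl, ?_⟩, ?_⟩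
    · rw [show σ (σ⁻¹ α) = α from σ.apply_symm_apply α, h1]; exact fun h => h2 h.symm
    · exact σ.apply_symm_apply α

/-- The subgroup `𝐊` of all permutations preserving each piece. -/
def bigK {P κ : Type*} [Finite κ] (c : P → κ) : Subgroup (bigG c) where
  carrier := {σ | ∀ α, c (σ.1 α) = c α}
  one_mem' := fun _ => rfl
  mul_mem' := fun {σ τ} hσ hτ α => (hσ (τ.1 α)).trans (hτ α)
  inv_mem' := by
    intro σ hσ α
    have h := hσ (σ.1⁻¹ α)
    rw [show σ.1 (σ.1⁻¹ α) = α from σ.1.apply_symm_apply α] at h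
    exact h.symm

/-- The topology of `𝐆`: the subgroup `𝐊` is open, and its subgroups fixing a finite set of points
are a basis of neighbourhoods of the unit. -/
@[reducible] def bigGTopology {P κ : Type*} [Finite κ] (c : P → κ) : TopologicalSpace (bigG c) :=
  TopologicalSpace.generateFrom
    {U | ∃ (σ : bigG c) (F : Finset P),
      U = {τ | ∃ k ∈ bigK c, (∀ α ∈ F, k.1 α = α) ∧ τ = σ * k}}

/-- The function `Φ_S(σ) = ∏ s_{pq} ^ θ_{pq}(σ)`, where `θ_{pq}(σ)` is the number of elements of
the `p`-th piece which `σ` sends to the `q`-th piece. For `σ` in `𝐆` this number is finite if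
`p ≠ q`; the factors with `p = q` are equal to one, since `s_{pp} = 1`. -/
def nessonovFunction {P κ : Type*} [Fintype κ] (c : P → κ) (S : Matrix κ κ ℂ)
    (σ : Equiv.Perm P) : ℂ :=
  ∏ p, ∏ q, S p q ^ Set.ncard {α | c α = p ∧ c (σ α) = q}

/-! ## The infinite tensor product of Hilbert spaces with distinguished unit vectors -/

section Tensor

variable {P V : Type*} [NormedAddCommGroup V] [InnerProductSpace ℂ V]

/-- The index set of the decomposable vectors: families of vectors that coincide with the
distinguished family `ξ` at all but finitely many places. -/
def Decomp (ξ : P → Metric.sphere (0 : V) 1) : Type _ :=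
  {x : P → V // {α | x α ≠ ξ α}.Finite}

/-- The inner product of two decomposable vectors. All but finitely many factors are `1`. -/
def decompKernel (ξ : P → Metric.sphere (0 : V) 1) : Matrix (Decomp ξ) (Decomp ξ) ℂ :=
  Matrix.of fun x y => ∏ᶠ α, inner ℂ (x.1 α) (y.1 α)

theorem inner_sphere (v : Metric.sphere (0 : V) 1) : inner ℂ (v : V) (v : V) = 1 := by
  rw [inner_self_eq_norm_sq_to_K, norm_eq_of_mem_sphere]; simp

theorem decompKernel_eq (ξ : P → Metric.sphere (0 : V) 1) (x y : Decomp ξ) (A : Finset P)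
    (hx : {α | x.1 α ≠ ξ α} ⊆ A) (hy : {α | y.1 α ≠ ξ α} ⊆ A) :
    decompKernel ξ x y = ∏ α ∈ A, inner ℂ (x.1 α) (y.1 α) := by
  refine finprod_eq_prod_of_mulSupport_subset _ ?_
  intro α hα
  by_contra h
  have h1 : x.1 α = ξ α := by by_contra h'; exact h (hx h')
  have h2 : y.1 α = ξ α := by by_contra h'; exact h (hy h')
  refine hα ?_
  change inner ℂ (x.1 α) (y.1 α) = 1
  rw [h1, h2, inner_sphere]

theorem posSemidef_inner {ι : Type*} (v : ι → V) :
    (Matrix.of fun i j => inner ℂ (v i) (v j) : Matrix ι ι ℂ).PosSemidef := by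
  refine ⟨?_, fun f => ?_⟩
  · ext i j
    exact inner_conj_symm _ _
  · have h : (f.sum fun i z => f.sum fun j w => star z * inner ℂ (v i) (v j) * w) =
        inner ℂ (f.sum fun i z => z • v i) (f.sum fun i z => z • v i) := by
      simp only [Finsupp.sum, sum_inner]
      refine Finset.sum_congr rfl fun i _ => ?_
      rw [inner_sum]
      refine Finset.sum_congr rfl fun j _ => ?_
      rw [inner_smul_left, inner_smul_right]
      simp; ring
    refine le_of_le_of_eq ?_ h.symm
    rw [inner_self_eq_norm_sq_to_K]
    simp

theorem posSemidef_prod {ι P : Type*} (A : Finset P) (x : ι → P → V) :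
    (Matrix.of fun i j => ∏ α ∈ A, inner ℂ (x i α) (x j α) : Matrix ι ι ℂ).PosSemidef := by
  classical
  induction A using Finset.induction_on with
  | empty =>
    convert posSemidef_inner (V := ℂ) (fun _ : ι => (1 : ℂ)) using 1
    ext i j
    simp
  | insert a A ha ih =>
    have h := (posSemidef_inner (fun i : ι => x i a)).hadamard ih
    have h' : (Matrix.of fun i j => ∏ α ∈ insert a A, inner ℂ (x i α) (x j α) : Matrix ι ι ℂ) =
        (Matrix.of fun i j => inner ℂ (x i a) (x j a) : Matrix ι ι ℂ).hadamard
          (Matrix.of fun i j => ∏ α ∈ A, inner ℂ (x i α) (x j α)) := by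
      ext i j
      simp [Matrix.hadamard, Finset.prod_insert ha]
    rw [h']
    exact h

theorem posSemidef_decompKernel (ξ : P → Metric.sphere (0 : V) 1) :
    (decompKernel ξ).PosSemidef := by
  classical
  refine ⟨?_, fun f => ?_⟩
  · ext x y
    let A := (x.2.union y.2).toFinset
    have h1 : {α | x.1 α ≠ ξ α} ⊆ A := fun α h => by
      rw [Set.Finite.coe_toFinset]; exact Or.inl h
    have h2 : {α | y.1 α ≠ ξ α} ⊆ A := fun α h => by
      rw [Set.Finite.coe_toFinset]; exact Or.inr h
    rw [Matrix.conjTranspose_apply, decompKernel_eq ξ y x A h2 h1, decompKernel_eq ξ x y A h1 h2,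
      star_prod]
    exact Finset.prod_congr rfl fun α _ => inner_conj_symm _ _
  · let A : Finset P := f.support.biUnion fun x => x.2.toFinset
    have hA : ∀ x ∈ f.support, {α | x.1 α ≠ ξ α} ⊆ A := fun x hx α h => by
      refine Finset.mem_coe.2 (Finset.mem_biUnion.2 ⟨x, hx, ?_⟩)
      rw [Set.Finite.mem_toFinset]; exact h
    have := (posSemidef_prod A (fun x : Decomp ξ => x.1)).2 f
    convert this using 1
    refine Finset.sum_congr rfl fun x hx => Finset.sum_congr rfl fun y hy => ?_
    dsimp only
    rw [decompKernel_eq ξ x y A (hA x hx) (hA y hy)]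
    rfl

/-- Formal linear combinations of decomposable vectors. -/
abbrev PreTensor (ξ : P → Metric.sphere (0 : V) 1) : Type _ := Decomp ξ →₀ ℂ

def preTensorInner (ξ : P → Metric.sphere (0 : V) 1) (f g : PreTensor ξ) : ℂ :=
  f.sum fun x z => g.sum fun y w => star z * decompKernel ξ x y * w

instance preTensorCore (ξ : P → Metric.sphere (0 : V) 1) :
    PreInnerProductSpace.Core ℂ (PreTensor ξ) where
  inner f g := preTensorInner ξ f g
  conj_inner_symm f g := by
    simp only [preTensorInner]
    rw [Finsupp.sum_comm]
    simp only [map_finsuppSum]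
    refine Finsupp.sum_congr fun x _ => Finsupp.sum_congr fun y _ => ?_
    rw [← (posSemidef_decompKernel ξ).isHermitian.apply x y]
    simp; ring
  re_inner_nonneg f := (Complex.nonneg_iff.1 ((posSemidef_decompKernel ξ).2 f)).1
  add_left f g h := by
    simp only [preTensorInner]
    rw [Finsupp.sum_add_index'] <;> simp [← Finsupp.sum_add, add_mul]
  smul_left f g z := by
    simp only [preTensorInner]
    rw [Finsupp.sum_smul_index] <;> simp [Finsupp.mul_sum, mul_assoc]

instance (ξ : P → Metric.sphere (0 : V) 1) : SeminormedAddCommGroup (PreTensor ξ) :=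
  InnerProductSpace.Core.toSeminormedAddCommGroup (𝕜 := ℂ)

instance (ξ : P → Metric.sphere (0 : V) 1) : InnerProductSpace ℂ (PreTensor ξ) := .ofCore _

/-- The tensor product `⨂_α (V, ξ_α)`: the Hilbert space completion (after the null vectors are
factored out) of the span of the decomposable vectors `⨂ x_α` with `x_α = ξ_α` for all but finitely
many `α`, with respect to `⟨⨂ x_α, ⨂ y_α⟩ = ∏ ⟨x_α, y_α⟩`. -/
abbrev InfTensor (ξ : P → Metric.sphere (0 : V) 1) : Type _ :=
  UniformSpace.Completion (PreTensor ξ)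

/-- The decomposable vector `⨂ x_α`. -/
def InfTensor.tprod (ξ : P → Metric.sphere (0 : V) 1) (x : Decomp ξ) : InfTensor ξ :=
  UniformSpace.Completion.coe' (show PreTensor ξ from Finsupp.single x 1)

theorem InfTensor.inner_tprod (ξ : P → Metric.sphere (0 : V) 1) (x y : Decomp ξ) :
    inner ℂ (InfTensor.tprod ξ x) (InfTensor.tprod ξ y) = ∏ᶠ α, inner ℂ (x.1 α) (y.1 α) := by
  refine (UniformSpace.Completion.inner_coe _ _).trans ?_
  change preTensorInner ξ (Finsupp.single x 1) (Finsupp.single y 1) = _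
  simp [preTensorInner, decompKernel]

/-- The distinguished unit vector `⨂ ξ_α`. -/
def InfTensor.vacuum (ξ : P → Metric.sphere (0 : V) 1) : InfTensor ξ :=
  InfTensor.tprod ξ ⟨fun α => ξ α, by simp⟩

variable {κ : Type*} [Finite κ]

/-- The action of `𝐆` on families of vectors by permutations of the factors: the vector at the
place `α` moves to the place `σ α`. -/
def permDecomp (c : P → κ) (e : κ → Metric.sphere (0 : V) 1) (σ : bigG c)
    (x : Decomp fun α => e (c α)) : Decomp fun α => e (c α) :=
  ⟨fun α => x.1 (σ.1⁻¹ α), by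
    refine ((x.2.image σ.1).union
      (Set.finite_iUnion fun p => (σ⁻¹).2 p)).subset ?_
    intro α hα
    by_cases h : x.1 (σ.1⁻¹ α) = e (c (σ.1⁻¹ α))
    · refine Or.inr (Set.mem_iUnion.2 ⟨c α, rfl, fun h' => hα ?_⟩)
      have h'' : c (σ.1⁻¹ α) = c α := h'
      change x.1 (σ.1⁻¹ α) = _
      rw [h, h'']
    · exact Or.inl ⟨σ.1⁻¹ α, h, σ.1.apply_symm_apply α⟩⟩

theorem permDecomp_mul (c : P → κ) (e : κ → Metric.sphere (0 : V) 1) (σ τ : bigG c)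
    (x : Decomp fun α => e (c α)) :
    permDecomp c e (σ * τ) x = permDecomp c e σ (permDecomp c e τ x) := by
  refine Subtype.ext (funext fun α => ?_)
  simp [permDecomp]

theorem permDecomp_one (c : P → κ) (e : κ → Metric.sphere (0 : V) 1)
    (x : Decomp fun α => e (c α)) : permDecomp c e 1 x = x := by
  refine Subtype.ext (funext fun α => ?_)
  simp [permDecomp]

theorem decompKernel_perm (c : P → κ) (e : κ → Metric.sphere (0 : V) 1) (σ : bigG c)
    (x y : Decomp fun α => e (c α)) :
    decompKernel (fun α => e (c α)) (permDecomp c e σ x) (permDecomp c e σ y) =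
      decompKernel (fun α => e (c α)) x y :=
  finprod_eq_of_bijective (σ.1⁻¹ : Equiv.Perm P) (Equiv.bijective _) fun _ => rfl

/-- The action of `𝐆` on formal linear combinations of decomposable vectors. -/
def permPre (c : P → κ) (e : κ → Metric.sphere (0 : V) 1) (σ : bigG c) :
    PreTensor (fun α => e (c α)) →ₗᵢ[ℂ] PreTensor (fun α => e (c α)) where
  toLinearMap := Finsupp.lmapDomain ℂ ℂ (permDecomp c e σ)
  norm_map' f := by
    have key : preTensorInner _ (Finsupp.mapDomain (permDecomp c e σ) f)
        (Finsupp.mapDomain (permDecomp c e σ) f) = preTensorInner _ f f := by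
      simp only [preTensorInner]
      rw [Finsupp.sum_mapDomain_index (by simp)
        (by intro x z w; simp [← Finsupp.sum_add, add_mul])]
      refine Finsupp.sum_congr fun x _ => ?_
      rw [Finsupp.sum_mapDomain_index (by simp) (by intro y z w; ring)]
      refine Finsupp.sum_congr fun y _ => ?_
      rw [decompKernel_perm]
    exact congrArg (fun z : ℂ => √(RCLike.re z)) key

theorem permPre_mul (c : P → κ) (e : κ → Metric.sphere (0 : V) 1) (σ τ : bigG c)
    (f : PreTensor fun α => e (c α)) :
    permPre c e (σ * τ) f = permPre c e σ (permPre c e τ f) := by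
  change Finsupp.mapDomain (permDecomp c e (σ * τ)) f = Finsupp.mapDomain (permDecomp c e σ)
    (Finsupp.mapDomain (permDecomp c e τ) f)
  rw [← Finsupp.mapDomain_comp]
  exact congrArg (fun k => Finsupp.mapDomain k f) (funext fun x => permDecomp_mul c e σ τ x)

theorem permPre_one (c : P → κ) (e : κ → Metric.sphere (0 : V) 1)
    (f : PreTensor fun α => e (c α)) : permPre c e 1 f = f := by
  change Finsupp.mapDomain (permDecomp c e 1) f = f
  rw [show permDecomp c e 1 = id from funext fun x => permDecomp_one c e x, Finsupp.mapDomain_id]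

/-- The operator of permutation of the factors of the tensor product. -/
def permTensor (c : P → κ) (e : κ → Metric.sphere (0 : V) 1) (σ : bigG c) :
    InfTensor (fun α => e (c α)) → InfTensor (fun α => e (c α)) :=
  UniformSpace.Completion.map (permPre c e σ)

theorem permTensor_coe (c : P → κ) (e : κ → Metric.sphere (0 : V) 1) (σ : bigG c)
    (f : PreTensor fun α => e (c α)) :
    permTensor c e σ f = (permPre c e σ f : PreTensor fun α => e (c α)) :=
  UniformSpace.Completion.map_coe (permPre c e σ).isometry.uniformContinuous f

theorem continuous_permTensor (c : P → κ) (e : κ → Metric.sphere (0 : V) 1) (σ : bigG c) :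
    Continuous (permTensor c e σ) := UniformSpace.Completion.continuous_map

theorem permTensor_mul (c : P → κ) (e : κ → Metric.sphere (0 : V) 1) (σ τ : bigG c)
    (v : InfTensor fun α => e (c α)) :
    permTensor c e (σ * τ) v = permTensor c e σ (permTensor c e τ v) := by
  refine UniformSpace.Completion.induction_on v (isClosed_eq (continuous_permTensor c e _)
    ((continuous_permTensor c e _).comp (continuous_permTensor c e _))) fun f => ?_
  rw [permTensor_coe, permTensor_coe, permTensor_coe, permPre_mul]

theorem permTensor_one (c : P → κ) (e : κ → Metric.sphere (0 : V) 1)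
    (v : InfTensor fun α => e (c α)) : permTensor c e 1 v = v := by
  refine UniformSpace.Completion.induction_on v
    (isClosed_eq (continuous_permTensor c e _) continuous_id) fun f => ?_
  rw [permTensor_coe, permPre_one]

/-- The representation of `𝐆` in `⨂_p ⨂_{α ∈ Π_p} (V, e_p)` by permutations of the factors. -/
def tensorRep (c : P → κ) (e : κ → Metric.sphere (0 : V) 1) :
    bigG c →* (InfTensor (fun α => e (c α)) ≃ₗᵢ[ℂ] InfTensor (fun α => e (c α))) where
  toFun σ :=
    { toFun := permTensor c e σ
      invFun := permTensor c e σ⁻¹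
      left_inv := fun v => by rw [← permTensor_mul, inv_mul_cancel, permTensor_one]
      right_inv := fun v => by rw [← permTensor_mul, mul_inv_cancel, permTensor_one]
      map_add' := fun v w => by
        refine UniformSpace.Completion.induction_on₂ v w (isClosed_eq
          ((continuous_permTensor c e σ).comp continuous_add)
          (((continuous_permTensor c e σ).comp continuous_fst).add
            ((continuous_permTensor c e σ).comp continuous_snd))) fun f g => ?_
        rw [← UniformSpace.Completion.coe_add, permTensor_coe, permTensor_coe,
          permTensor_coe, map_add, UniformSpace.Completion.coe_add]
      map_smul' := fun z v => by
        refine UniformSpace.Completion.induction_on v (isClosed_eq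
          ((continuous_permTensor c e σ).comp (continuous_const_smul z))
          ((continuous_permTensor c e σ).const_smul z)) fun f => ?_
        rw [← UniformSpace.Completion.coe_smul, permTensor_coe, permTensor_coe,
          map_smul, UniformSpace.Completion.coe_smul, RingHom.id_apply]
      norm_map' := fun v => by
        change ‖permTensor c e σ v‖ = ‖v‖
        refine UniformSpace.Completion.induction_on v
          (isClosed_eq (continuous_permTensor c e σ).norm continuous_norm) fun f => ?_
        rw [permTensor_coe, UniformSpace.Completion.norm_coe,
          UniformSpace.Completion.norm_coe, (permPre c e σ).norm_map] }
  map_one' := by ext v; exact permTensor_one c e v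
  map_mul' σ τ := by ext v; exact permTensor_mul c e σ τ v

theorem tensorRep_tprod (c : P → κ) (e : κ → Metric.sphere (0 : V) 1) (σ : bigG c)
    (x : Decomp fun α => e (c α)) :
    tensorRep c e σ (InfTensor.tprod _ x) = InfTensor.tprod _ (permDecomp c e σ x) := by
  refine (permTensor_coe c e σ _).trans ?_
  change UniformSpace.Completion.coe' (Finsupp.mapDomain (permDecomp c e σ)
    (Finsupp.single x 1) : PreTensor fun α => e (c α)) = _
  rw [Finsupp.mapDomain_single]
  rfl

end Tensor

/-! ## Spherical representations -/

section Spherical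

variable {G H : Type*} [Group G] [NormedAddCommGroup H] [InnerProductSpace ℂ H]

/-- The cyclic span of a vector: the smallest closed invariant subspace containing it. -/
def cyclicSpan (ρ : G →* (H ≃ₗᵢ[ℂ] H)) (v : H) : Submodule ℂ H :=
  (Submodule.span ℂ (Set.range fun g => ρ g v)).topologicalClosure

theorem mem_cyclicSpan (ρ : G →* (H ≃ₗᵢ[ℂ] H)) (v : H) : v ∈ cyclicSpan ρ v := by
  refine Submodule.le_topologicalClosure _ (Submodule.subset_span ⟨1, ?_⟩)
  simp

theorem map_mem_cyclicSpan (ρ : G →* (H ≃ₗᵢ[ℂ] H)) (v : H) (g : G) {x : H}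
    (hx : x ∈ cyclicSpan ρ v) : ρ g x ∈ cyclicSpan ρ v := by
  refine map_mem_closure (ρ g).continuous hx fun y hy => ?_
  change y ∈ Submodule.span ℂ (Set.range fun g => ρ g v) at hy
  change ρ g y ∈ Submodule.span ℂ (Set.range fun g => ρ g v)
  induction hy using Submodule.span_induction with
  | mem y hy =>
    obtain ⟨h, rfl⟩ := hy
    refine Submodule.subset_span ⟨g * h, ?_⟩
    simp
  | zero => simp
  | add y z _ _ hy hz => rw [map_add]; exact Submodule.add_mem _ hy hz
  | smul a y _ hy => rw [map_smul]; exact Submodule.smul_mem _ a hy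

/-- The restriction of a unitary representation to the cyclic span of a vector. -/
def cyclicRep (ρ : G →* (H ≃ₗᵢ[ℂ] H)) (v : H) :
    G →* (cyclicSpan ρ v ≃ₗᵢ[ℂ] cyclicSpan ρ v) where
  toFun g :=
    { toFun := fun x => ⟨ρ g x, map_mem_cyclicSpan ρ v g x.2⟩
      invFun := fun x => ⟨ρ g⁻¹ x, map_mem_cyclicSpan ρ v g⁻¹ x.2⟩
      left_inv := fun x => Subtype.ext (by simp)
      right_inv := fun x => Subtype.ext (by simp)
      map_add' := fun x y => Subtype.ext (by simp)
      map_smul' := fun z x => Subtype.ext (by simp)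
      norm_map' := fun x => (ρ g).norm_map x }
  map_one' := by ext x; simp
  map_mul' g h := by ext x; simp

/-- `ρ` is an irreducible (strongly continuous) unitary representation of the topological group `G`
whose `K`-fixed vectors are the multiples of the nonzero vector `v`, that is, a `K`-spherical
representation with spherical vector `v`. -/
structure IsSpherical (t : TopologicalSpace G) (K : Subgroup G) [CompleteSpace H]
    (ρ : G →* (H ≃ₗᵢ[ℂ] H)) (v : H) : Prop where
  continuous : ∀ x : H, Continuous[t, _] fun g => ρ g x
  irreducible : ∀ W : Submodule ℂ H, IsClosed (W : Set H) → (∀ g, ∀ x ∈ W, ρ g x ∈ W) →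
    W = ⊥ ∨ W = ⊤
  ne_zero : v ≠ 0
  fixed_iff : ∀ x : H, (∀ k ∈ K, ρ k x = x) ↔ ∃ z : ℂ, x = z • v

end Spherical

instance {G H : Type*} [Group G] [NormedAddCommGroup H] [InnerProductSpace ℂ H] [CompleteSpace H]
    (ρ : G →* (H ≃ₗᵢ[ℂ] H)) (v : H) : CompleteSpace (cyclicSpan ρ v) :=
  (Submodule.isClosed_topologicalClosure _).completeSpace_coe

end Sphero

end

/-!
The proof rests on three facts about the regular tree `T`.

* *Homogeneity.* A locally injective homomorphism of trees is an embedding, and a partial embedding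
  defined on a subtree extends vertex by vertex (`exists_embedding_extending`). Hence thorns embed
  in `T`, and two embeddings of a thorn differ by an automorphism (`exists_iso_comp_eq`), so that
  the clopen sets of a thorn are one orbit of `Aut(T)`.
* *A reduced thorn is determined by its clopen set `Ω`* (`Thorn.isomorphic_of_clopen_eq`). If it
  has at least three cells, its vertices are the vertices `v` of `T` such that all balls
  `ball T u v` with `u` adjacent to `v` meet both `Ω` and its complement (`Thorn.core`). The core
  of a clopen set can be arbitrarily large, so finitely many thorns do not exhaust `ClopRes`.
* *Orbits of `Aut(T)` on proper nonempty clopen sets are infinite*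
  (`IsRegularTree.autOrbit_infinite`). By B. H. Neumann's lemma on coverings by cosets an
  automorphism moves a given finite set of clopen sets off another one
  (`IsRegularTree.exists_aut_not_mem`).

A spheromorphism `g` coincides with automorphisms on small balls. Bar induction on directed edges
(`edge_induction`), which takes the place of the compactness of the boundary, shows that each ball
is a disjoint union of such balls, their number being `1` modulo `n - 1`; therefore `g` preserves
`ClopRes`. It also shows that all but finitely many embeddings of a thorn lie in a branch on whose
ball `g` is an automorphism `r`. Then the clopen set of the thorn or its complement is contained in
this ball, and its images under `g` and `r` are the same (`finite_exceptions`). Hence `g` acts by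
an element of `𝐆`.

In the tensor product, let `v` be fixed by `Aut(T)`. Translates of a decomposable vector `⨂ y_α` by
automorphisms that move its nontrivial places away converge weakly to a multiple of the vacuum, so
`⟨v, ⨂ y_α⟩ = ⟨v, E⟩ ⟨E, ⨂ y_α⟩`, and `v` is a multiple of `E` (`eq_smul_vacuum_of_fixed`). Since
`φ(Aut(T)) ⊆ 𝐊` and `𝐊` fixes `E`, this settles both pairs of groups. Irreducibility of the cyclic
span follows by projecting `E` to an invariant subspace (`isSpherical_cyclicRep`).
-/

namespace Sphero

/-! ### Branches of a tree -/

section Branch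

variable {X : Type*} {T : SimpleGraph X}

theorem Reachable.closed_induction {G : SimpleGraph X} {x y : X} (h : G.Reachable x y)
    {C : X → Prop} (h0 : C x) (hs : ∀ a b, G.Adj a b → C a → C b) : C y := by
  rw [SimpleGraph.reachable_iff_reflTransGen] at h
  induction h with
  | refl => exact h0
  | tail _ hab ih => exact hs _ _ hab ih

theorem mem_branch_self (p q : X) : q ∈ branch T p q := SimpleGraph.Reachable.refl _

theorem branch_induction {p q x : X} (hx : x ∈ branch T p q) {C : X → Prop} (h0 : C q)
    (hs : ∀ a b, a ∈ branch T p q → b ∈ branch T p q → T.Adj a b → C a → C b) : C x := by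
  have h : x ∈ branch T p q ∧ C x := by
    refine Reachable.closed_induction (C := fun x => x ∈ branch T p q ∧ C x) hx
      ⟨mem_branch_self p q, h0⟩ ?_
    rintro a b hab ⟨ha, hc⟩
    have hb : b ∈ branch T p q := SimpleGraph.Reachable.trans ha hab.reachable
    exact ⟨hb, hs a b ha hb (SimpleGraph.deleteEdges_adj.1 hab).1 hc⟩
  exact h.2

theorem disjoint_branch (hT : T.IsTree) {p q x : X} (hpq : T.Adj p q) (h1 : x ∈ branch T p q)
    (h2 : x ∈ branch T q p) : False := by
  have hb := SimpleGraph.isAcyclic_iff_forall_adj_isBridge.1 hT.isAcyclic hpq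
  rw [SimpleGraph.isBridge_iff] at hb
  refine hb ?_
  have h2' : (T.deleteEdges {s(p, q)}).Reachable p x := by
    have := h2
    unfold branch at this
    rwa [Sym2.eq_swap] at this
  exact h2'.trans (SimpleGraph.Reachable.symm h1)

theorem not_mem_branch (hT : T.IsTree) {p q : X} (hpq : T.Adj p q) : p ∉ branch T p q :=
  fun h => disjoint_branch hT hpq h (mem_branch_self q p)

/-- A branch can be left only through the edge that cuts it off. -/
theorem branch_cross (hT : T.IsTree) {p q x y : X} (hpq : T.Adj p q) (hx : x ∈ branch T p q)
    (hxy : T.Adj x y) (hy : y ∉ branch T p q) : x = q ∧ y = p := by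
  by_cases h : s(x, y) = s(p, q)
  · rcases Sym2.eq_iff.1 h with ⟨rfl, rfl⟩ | ⟨rfl, rfl⟩
    · exact absurd hx (not_mem_branch hT hpq)
    · exact ⟨rfl, rfl⟩
  · refine absurd ?_ hy
    have : (T.deleteEdges {s(p, q)}).Adj x y := by
      rw [SimpleGraph.deleteEdges_adj]
      exact ⟨hxy, by simpa using h⟩
    exact SimpleGraph.Reachable.trans hx this.reachable

theorem branch_total (hT : T.IsTree) {p q : X} (hpq : T.Adj p q) (x : X) :
    x ∈ branch T p q ∨ x ∈ branch T q p := by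
  refine Reachable.closed_induction (hT.connected.preconnected q x)
    (C := fun x => x ∈ branch T p q ∨ x ∈ branch T q p) (.inl (mem_branch_self p q)) ?_
  rintro a b hab (h | h)
  · by_cases hb : b ∈ branch T p q
    · exact .inl hb
    · obtain ⟨rfl, rfl⟩ := branch_cross hT hpq h hab hb
      exact .inr (mem_branch_self _ _)
  · by_cases hb : b ∈ branch T q p
    · exact .inr hb
    · obtain ⟨rfl, rfl⟩ := branch_cross hT hpq.symm h hab hb
      exact .inl (mem_branch_self _ _)

theorem not_mem_branch_iff (hT : T.IsTree) {p q : X} (hpq : T.Adj p q) {x : X} :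
    x ∉ branch T p q ↔ x ∈ branch T q p :=
  ⟨fun h => (branch_total hT hpq x).resolve_left h,
    fun h h' => disjoint_branch hT hpq h' h⟩

/-- A branch that starts on the side of `q` of the edge `pq` and does not contain `p` stays on this
side. -/
theorem branch_subset_of_not_mem (hT : T.IsTree) {p q x y : X} (hpq : T.Adj p q)
    (hy : y ∈ branch T p q) (hp : p ∉ branch T x y) : branch T x y ⊆ branch T p q := by
  intro z hz
  refine branch_induction hz hy fun a b _ hb hab hca => ?_
  by_contra h
  obtain ⟨rfl, rfl⟩ := branch_cross hT hpq hca hab h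
  exact hp hb

theorem branch_subset_branch (hT : T.IsTree) {p q w : X} (hpq : T.Adj p q) (hqw : T.Adj q w)
    (hw : w ≠ p) : branch T q w ⊆ branch T p q := by
  have hw' : w ∈ branch T p q := by
    by_contra h
    exact hw (branch_cross hT hpq (mem_branch_self p q) hqw h).2
  refine branch_subset_of_not_mem hT hpq hw' fun h => ?_
  by_cases hq : q ∈ branch T q w
  · exact not_mem_branch hT hqw hq
  · exact hw (branch_cross hT hqw h hpq hq).1.symm

theorem disjoint_branch_of_ne (hT : T.IsTree) {q w w' x : X} (hqw : T.Adj q w)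
    (hqw' : T.Adj q w') (h : w ≠ w') (h1 : x ∈ branch T q w) (h2 : x ∈ branch T q w') : False :=
  disjoint_branch hT hqw' h2 (branch_subset_branch hT hqw'.symm hqw h h1)

/-- The branches at the neighbours of a vertex cover all other vertices. -/
theorem exists_mem_branch (hT : T.IsTree) {q x : X} (hx : x ≠ q) :
    ∃ w, T.Adj q w ∧ x ∈ branch T q w := by
  have h : x = q ∨ ∃ w, T.Adj q w ∧ x ∈ branch T q w := by
    refine Reachable.closed_induction (hT.connected.preconnected q x)
      (C := fun x => x = q ∨ ∃ w, T.Adj q w ∧ x ∈ branch T q w) (.inl rfl) ?_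
    rintro a b hab (rfl | ⟨w, hw, ha⟩)
    · exact .inr ⟨b, hab, mem_branch_self _ _⟩
    · by_cases hb : b ∈ branch T q w
      · exact .inr ⟨w, hw, hb⟩
      · exact .inl (branch_cross hT hw ha hab hb).2
  exact h.resolve_left hx

theorem exists_mem_branch_child (hT : T.IsTree) {p q x : X} (hpq : T.Adj p q)
    (hx : x ∈ branch T p q) (hxq : x ≠ q) : ∃ w, T.Adj q w ∧ w ≠ p ∧ x ∈ branch T q w := by
  obtain ⟨w, hw, hxw⟩ := exists_mem_branch hT hxq
  exact ⟨w, hw, fun h => disjoint_branch hT hpq hx (h ▸ hxw), hxw⟩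

theorem dist_lt_of_mem_branch (hT : T.IsTree) {p q x : X} (hpq : T.Adj p q)
    (hx : x ∈ branch T p q) : T.dist q x < T.dist p x := by
  have key : ∀ {a b x : X}, T.Adj a b → T.dist b x < T.dist a x → x ∈ branch T a b := by
    intro a b x hab hlt
    obtain ⟨w, hw⟩ := hT.connected.exists_walk_length_eq_dist b x
    by_contra hx
    have h : ∀ {c y : X} (w : T.Walk c y), y ∉ branch T a b → c ∈ branch T a b →
        T.dist a y ≤ w.length := by
      intro c y w hy hc
      induction w with
      | nil => exact absurd hc hy
      | @cons u v z h w' ih =>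
        by_cases hv : v ∈ branch T a b
        · exact (ih hy hv).trans (by simp)
        · obtain ⟨rfl, rfl⟩ := branch_cross hT hab hc h hv
          have := SimpleGraph.dist_le w'
          rw [SimpleGraph.Walk.length_cons]
          omega
    have := h w hx (mem_branch_self a b)
    omega
  rcases lt_trichotomy (T.dist q x) (T.dist p x) with h | h | h
  · exact h
  · exact absurd (by rw [T.dist_comm (u := x), T.dist_comm (u := x), h])
      (hT.dist_ne_of_adj x hpq)
  · exact absurd (key hpq.symm h) fun h' => disjoint_branch hT hpq hx h'

theorem dist_eq_of_mem_branch (hT : T.IsTree) {p q x : X} (hpq : T.Adj p q)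
    (hx : x ∈ branch T p q) : T.dist p x = T.dist q x + 1 := by
  have h1 := dist_lt_of_mem_branch hT hpq hx
  have h2 := hT.connected.dist_triangle (u := p) (v := q) (w := x)
  have h3 : T.dist p q = 1 := SimpleGraph.dist_eq_one_iff_adj.2 hpq
  omega

/-- The image of a connected graph that avoids `p` lies in one branch at `p`. -/
theorem mem_branch_of_connected (hT : T.IsTree) {Y : Type*} {A : SimpleGraph Y}
    (hA : A.Preconnected) (f : A →g T) {p q : X} (hpq : T.Adj p q) {b : Y}
    (hb : f b ∈ branch T p q) (hp : ∀ a, f a ≠ p) (a : Y) : f a ∈ branch T p q := by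
  refine Reachable.closed_induction (hA b a) (C := fun a => f a ∈ branch T p q) hb ?_
  intro c d hcd hc
  by_contra h
  exact hp d (branch_cross hT hpq hc (f.map_adj hcd) h).2

theorem finite_setOf_dist_le (hT : T.IsTree) (hfin : ∀ v, (T.neighborSet v).Finite) (v : X)
    (k : ℕ) : {x | T.dist v x ≤ k}.Finite := by
  induction k generalizing v with
  | zero =>
    refine (Set.finite_singleton v).subset fun x hx => ?_
    have : T.dist v x = 0 := by simpa using hx
    exact (hT.connected.dist_eq_zero_iff.1 this).symm
  | succ k ih =>
    refine ((Set.finite_singleton v).union ((hfin v).biUnion fun w _ => ih w)).subset ?_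
    intro x hx
    by_cases h : x = v
    · exact .inl h
    · obtain ⟨w, hw, hxw⟩ := exists_mem_branch hT h
      refine .inr (Set.mem_biUnion hw ?_)
      have := dist_lt_of_mem_branch hT hw hxw
      have hx' : T.dist v x ≤ k + 1 := hx
      change T.dist w x ≤ k
      omega

theorem countable_of_isTree (hT : T.IsTree) (hfin : ∀ v, (T.neighborSet v).Finite) :
    Countable X := by
  obtain ⟨v⟩ := hT.connected.nonempty
  rw [← Set.countable_univ_iff]
  refine (Set.countable_iUnion fun k => (finite_setOf_dist_le hT hfin v k).countable).mono ?_
  exact fun x _ => Set.mem_iUnion.2 ⟨T.dist v x, le_refl (T.dist v x)⟩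

end Branch

/-! ### Extension of embeddings of trees -/

section Extension

variable {X Y : Type*} {A : SimpleGraph Y} {T : SimpleGraph X}

/-- A locally injective homomorphism of trees maps branches to branches. -/
theorem map_mem_branch_of_locInj (hA : A.IsTree) (hT : T.IsTree) (h : A →g T)
    (hinj : ∀ v, Set.InjOn h (A.neighborSet v)) {p q x : Y} (hpq : A.Adj p q)
    (hx : x ∈ branch A p q) : h x ∈ branch T (h p) (h q) := by
  obtain ⟨k, hk⟩ : ∃ k, A.dist q x = k := ⟨_, rfl⟩
  induction k generalizing p q with
  | zero =>
    rw [← hA.connected.dist_eq_zero_iff.1 hk]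
    exact mem_branch_self _ _
  | succ k ih =>
    have hxq : x ≠ q := by
      rintro rfl
      simp at hk
    obtain ⟨w, hqw, hwp, hxw⟩ := exists_mem_branch_child hA hpq hx hxq
    have hd := dist_eq_of_mem_branch hA hqw hxw
    refine branch_subset_branch hT (h.map_adj hpq) (h.map_adj hqw) ?_
      (ih hqw hxw (by omega))
    exact fun he => hwp (hinj q hqw hpq.symm he)

theorem injective_of_locInj (hA : A.IsTree) (hT : T.IsTree) (h : A →g T)
    (hinj : ∀ v, Set.InjOn h (A.neighborSet v)) : Function.Injective h := by
  intro x y hxy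
  by_contra hne
  obtain ⟨w, hw, hyw⟩ := exists_mem_branch hA (Ne.symm hne)
  have := map_mem_branch_of_locInj hA hT h hinj hw hyw
  rw [← hxy] at this
  exact not_mem_branch hT (h.map_adj hw) this

/-- A locally injective homomorphism of trees is an embedding. -/
def embeddingOfLocInj (hA : A.IsTree) (hT : T.IsTree) (h : A →g T)
    (hinj : ∀ v, Set.InjOn h (A.neighborSet v)) : A ↪g T where
  toFun := h
  inj' := injective_of_locInj hA hT h hinj
  map_rel_iff' := by
    intro x y
    refine ⟨fun hxy => ?_, fun hxy => h.map_adj hxy⟩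
    have hne : y ≠ x := by
      rintro rfl
      exact T.loopless.irrefl _ hxy
    obtain ⟨w, hw, hyw⟩ := exists_mem_branch hA hne
    have h1 := map_mem_branch_of_locInj hA hT h hinj hw hyw
    have h2 := (branch_cross hT (h.map_adj hw) h1 hxy.symm
      (not_mem_branch hT (h.map_adj hw))).1
    rw [injective_of_locInj hA hT h hinj h2]
    exact hw

/-- A set `S` of vertices is convex if it lies on one side of each edge that leaves it. For
nonempty `S` this means that `S` spans a subtree. -/
def Convex (A : SimpleGraph Y) (S : Set Y) : Prop :=
  ∀ p q, A.Adj p q → p ∉ S → q ∈ S → S ⊆ branch A p q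

theorem convex_singleton (v : Y) : Convex A {v} := by
  rintro p q _ _ rfl x rfl
  exact mem_branch_self _ _

theorem Convex.eq_of_adj (hA : A.IsTree) {S : Set Y} (hS : Convex A S) {v s s' : Y} (hv : v ∉ S)
    (hs : s ∈ S) (hs' : s' ∈ S) (hvs : A.Adj v s) (hvs' : A.Adj v s') : s' = s :=
  (branch_cross hA hvs (hS v s hvs hv hs hs') hvs'.symm (not_mem_branch hA hvs)).1

theorem Convex.insert (hA : A.IsTree) {S : Set Y} (hS : Convex A S) {v s : Y} (hv : v ∉ S)
    (hs : s ∈ S) (hvs : A.Adj v s) : Convex A (Set.insert v S) := by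
  intro p q hpq hp hq
  have hpS : p ∉ S := fun h => hp (.inr h)
  have hpv : p ≠ v := fun h => hp (.inl h)
  rcases hq with rfl | hq
  · have hps : p ≠ s := fun h => hpS (h ▸ hs)
    rintro x (rfl | hx)
    · exact mem_branch_self _ _
    · exact branch_subset_branch hA hpq hvs (Ne.symm hps) (hS _ _ hvs hv hs hx)
  · rintro x (rfl | hx)
    · by_contra h
      exact hpv (branch_cross hA hpq (hS p q hpq hpS hq hs) hvs.symm h).2.symm
    · exact hS p q hpq hpS hq hx

theorem convex_range (hT : T.IsTree) (hA : A.Preconnected) (f : A ↪g T) :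
    Convex T (Set.range f) := by
  rintro p q hpq hp ⟨b, rfl⟩ _ ⟨a, rfl⟩
  exact mem_branch_of_connected hT hA f.toHom hpq (mem_branch_self p (f b))
    (fun a h => hp ⟨a, h⟩) a

/-- The map `h` restricted to `S` preserves adjacency and is injective on the neighbours of each
vertex. -/
def PartialLocInj (A : SimpleGraph Y) (T : SimpleGraph X) (S : Set Y) (h : Y → X) : Prop :=
  (∀ x ∈ S, ∀ y ∈ S, A.Adj x y → T.Adj (h x) (h y)) ∧
    ∀ v ∈ S, Set.InjOn h (A.neighborSet v ∩ S)

/-- Extension of a locally injective map by one vertex: the image of the only neighbour in `S` of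
the new vertex has valence large enough to leave room for one more image. -/
theorem PartialLocInj.exists_insert (hA : A.IsTree)
    (hfin : ∀ v, (A.neighborSet v).Finite)
    (hval : ∀ (v : Y) (w : X), (A.neighborSet v).ncard ≤ (T.neighborSet w).ncard)
    {S : Set Y} (hS : Convex A S) {h : Y → X} (hh : PartialLocInj A T S h) {v s : Y}
    (hv : v ∉ S) (hs : s ∈ S) (hvs : A.Adj v s) :
    ∃ h', PartialLocInj A T (Set.insert v S) h' ∧ Set.EqOn h h' S := by
  classical
  obtain ⟨w, hw, hw'⟩ : ∃ w ∈ T.neighborSet (h s), w ∉ h '' (A.neighborSet s ∩ S) := by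
    by_contra! hc
    have h1 : (T.neighborSet (h s)).ncard ≤ (A.neighborSet s ∩ S).ncard :=
      (Set.ncard_le_ncard hc (((hfin s).inter_of_left S).image h)).trans
        (Set.ncard_image_le ((hfin s).inter_of_left S))
    have h2 : (A.neighborSet s ∩ S).ncard < (A.neighborSet s).ncard :=
      Set.ncard_lt_ncard ⟨Set.inter_subset_left, fun hsub => hv (hsub hvs.symm).2⟩ (hfin s)
    have := hval s (h s)
    omega
  have hne : ∀ x ∈ S, x ≠ v := fun x hx hxv => hv (hxv ▸ hx)
  have heq : ∀ x ∈ S, Function.update h v w x = h x := fun x hx =>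
    Function.update_of_ne (hne x hx) _ _
  have hself : Function.update h v w v = w := Function.update_self _ _ _
  refine ⟨Function.update h v w, ⟨?_, ?_⟩, fun x hx => (heq x hx).symm⟩
  · rintro x (rfl | hx) y (rfl | hy) hxy
    · exact absurd hxy (A.loopless.irrefl _)
    · obtain rfl := hS.eq_of_adj hA hv hs hy hvs hxy
      rw [hself, heq _ hs]
      exact SimpleGraph.Adj.symm hw
    · obtain rfl := hS.eq_of_adj hA hv hs hx hvs hxy.symm
      rw [hself, heq _ hs]
      exact hw
    · rw [heq x hx, heq y hy]
      exact hh.1 x hx y hy hxy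
  · rintro u (rfl | hu) x ⟨hx1, hx⟩ y ⟨hy1, hy⟩ hxy
    · have hx' : x ∈ S := hx.resolve_left fun h => A.loopless.irrefl _ (h ▸ hx1 : A.Adj u u)
      have hy' : y ∈ S := hy.resolve_left fun h => A.loopless.irrefl _ (h ▸ hy1 : A.Adj u u)
      rw [hS.eq_of_adj hA hv hs hx' hvs hx1, hS.eq_of_adj hA hv hs hy' hvs hy1]
    · rcases hx with rfl | hx <;> rcases hy with rfl | hy
      · rfl
      · obtain rfl := hS.eq_of_adj hA hv hs hu hvs (SimpleGraph.Adj.symm hx1)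
        rw [hself, heq y hy] at hxy
        exact absurd ⟨y, ⟨hy1, hy⟩, hxy.symm⟩ hw'
      · obtain rfl := hS.eq_of_adj hA hv hs hu hvs (SimpleGraph.Adj.symm hy1)
        rw [hself, heq x hx] at hxy
        exact absurd ⟨x, ⟨hx1, hx⟩, hxy⟩ hw'
      · rw [heq x hx, heq y hy] at hxy
        exact hh.2 u hu ⟨hx1, hx⟩ ⟨hy1, hy⟩ hxy

theorem exists_adj_not_mem (hA : A.Preconnected) {S : Set Y} {s v : Y} (hs : s ∈ S)
    (hv : v ∉ S) : ∃ a b, a ∈ S ∧ b ∉ S ∧ A.Adj b a := by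
  by_contra! hc
  refine hv (Reachable.closed_induction (hA s v) (C := fun x => x ∈ S) hs ?_)
  intro a b hab ha
  by_contra hb
  exact hc a b ha hb hab.symm

/-- A partial embedding of a tree, defined on a subtree, in a tree with valences that are not
smaller, extends to an embedding of the whole tree. -/
theorem exists_embedding_extending (hA : A.IsTree) (hT : T.IsTree)
    (hfin : ∀ v, (A.neighborSet v).Finite)
    (hval : ∀ (v : Y) (w : X), (A.neighborSet v).ncard ≤ (T.neighborSet w).ncard)
    {S₀ : Set Y} (hne : S₀.Nonempty) (hS₀ : Convex A S₀) (h₀ : Y → X)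
    (hh₀ : PartialLocInj A T S₀ h₀) : ∃ f : A ↪g T, ∀ x ∈ S₀, f x = h₀ x := by
  classical
  -- Partial maps are encoded by a set and a total map; the values off the set are irrelevant.
  let Good : Set (Set Y × (Y → X)) :=
    {P | Convex A P.1 ∧ PartialLocInj A T P.1 P.2}
  let r : Set Y × (Y → X) → Set Y × (Y → X) → Prop :=
    fun P Q => P.1 ⊆ Q.1 ∧ Set.EqOn P.2 Q.2 P.1
  have htrans : ∀ {P Q R}, r P Q → r Q R → r P R := fun h1 h2 =>
    ⟨h1.1.trans h2.1, fun x hx => (h1.2 hx).trans (h2.2 (h1.1 hx))⟩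
  have hch : ∀ C : Set {P : Set Y × (Y → X) // P ∈ Good ∧ r (S₀, h₀) P},
      IsChain (fun P Q => r P.1 Q.1) C →
      ∃ ub : {P : Set Y × (Y → X) // P ∈ Good ∧ r (S₀, h₀) P}, ∀ P ∈ C, r P.1 ub.1 := by
    intro C hC
    rcases C.eq_empty_or_nonempty with rfl | ⟨P₀, hP₀⟩
    · exact ⟨⟨(S₀, h₀), ⟨hS₀, hh₀⟩, subset_rfl, fun _ _ => rfl⟩, by simp⟩
    have hdir : ∀ P ∈ C, ∀ Q ∈ C, ∃ R ∈ C, r P.1 R.1 ∧ r Q.1 R.1 := by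
      intro P hP Q hQ
      by_cases h : P = Q
      · exact ⟨P, hP, ⟨subset_rfl, fun _ _ => rfl⟩, h ▸ ⟨subset_rfl, fun _ _ => rfl⟩⟩
      · rcases hC hP hQ h with h | h
        · exact ⟨Q, hQ, h, subset_rfl, fun _ _ => rfl⟩
        · exact ⟨P, hP, ⟨subset_rfl, fun _ _ => rfl⟩, h⟩
    let U : Set Y := {x | ∃ P ∈ C, x ∈ P.1.1}
    let H : Y → X := fun x => if hx : ∃ P ∈ C, x ∈ P.1.1 then hx.choose.1.2 x else h₀ x
    have hH : ∀ P ∈ C, Set.EqOn P.1.2 H P.1.1 := by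
      intro P hP x hx
      have hx' : ∃ P ∈ C, x ∈ P.1.1 := ⟨P, hP, hx⟩
      have hHx : H x = hx'.choose.1.2 x := dif_pos hx'
      obtain ⟨R, _, h1, h2⟩ := hdir P hP _ hx'.choose_spec.1
      rw [hHx, h1.2 hx, h2.2 hx'.choose_spec.2]
    have hU : ∀ P ∈ C, r P.1 (U, H) := fun P hP => ⟨fun x hx => ⟨P, hP, hx⟩, hH P hP⟩
    have hdir2 : ∀ {x y}, x ∈ U → y ∈ U → ∃ P ∈ C, x ∈ P.1.1 ∧ y ∈ P.1.1 := by
      rintro x y ⟨P, hP, hx⟩ ⟨Q, hQ, hy⟩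
      obtain ⟨R, hR, h1, h2⟩ := hdir P hP Q hQ
      exact ⟨R, hR, h1.1 hx, h2.1 hy⟩
    refine ⟨⟨(U, H), ⟨?_, ?_, ?_⟩, htrans P₀.2.2 (hU P₀ hP₀)⟩, hU⟩
    · intro p q hpq hp hq x hx
      obtain ⟨P, hP, hqP, hxP⟩ := hdir2 hq hx
      exact P.2.1.1 p q hpq (fun h => hp ⟨P, hP, h⟩) hqP hxP
    · intro x hx y hy hxy
      obtain ⟨P, hP, hxP, hyP⟩ := hdir2 hx hy
      change T.Adj (H x) (H y)
      rw [← hH P hP hxP, ← hH P hP hyP]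
      exact P.2.1.2.1 x hxP y hyP hxy
    · rintro v hv x ⟨hx1, hx⟩ y ⟨hy1, hy⟩ hxy
      obtain ⟨P, hP, hvP, hxP⟩ := hdir2 hv hx
      obtain ⟨Q, hQ, hyQ, _⟩ := hdir2 hy hy
      obtain ⟨R, hR, h1, h2⟩ := hdir P hP Q hQ
      change H x = H y at hxy
      rw [← hH R hR (h1.1 hxP), ← hH R hR (h2.1 hyQ)] at hxy
      exact R.2.1.2.2 v (h1.1 hvP) ⟨hx1, h1.1 hxP⟩ ⟨hy1, h2.1 hyQ⟩ hxy
  obtain ⟨⟨⟨S, h⟩, ⟨hconv, hpl⟩, hext⟩, hmax⟩ :=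
    exists_maximal_of_chains_bounded hch fun h1 h2 => htrans h1 h2
  have hSuniv : ∀ x, x ∈ S := by
    by_contra! hc
    obtain ⟨x, hx⟩ := hc
    obtain ⟨s₀, hs₀⟩ := hne
    obtain ⟨s, v, hs, hv, hvs⟩ := exists_adj_not_mem hA.connected.preconnected (hext.1 hs₀) hx
    obtain ⟨h', hpl', heq⟩ := hpl.exists_insert hA hfin hval hconv hv hs hvs
    have hr : r (S, h) (Set.insert v S, h') := ⟨Set.subset_insert v S, heq⟩
    have := hmax ⟨(Set.insert v S, h'), ⟨hconv.insert hA hv hs hvs, hpl'⟩, htrans hext hr⟩ hr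
    exact hv (this.1 (Set.mem_insert v S))
  let f : A →g T := ⟨h, fun {x y} hxy => hpl.1 x (hSuniv x) y (hSuniv y) hxy⟩
  refine ⟨embeddingOfLocInj hA hT f fun v x hx y hy hxy =>
    hpl.2 v (hSuniv v) ⟨hx, hSuniv x⟩ ⟨hy, hSuniv y⟩ hxy, fun x hx => (hext.2 hx).symm⟩

/-- An embedding of a regular tree in itself is an automorphism. -/
theorem exists_iso_of_embedding (hT : T.IsTree) {d : ℕ} (hd : d ≠ 0)
    (hval : ∀ v, (T.neighborSet v).ncard = d) (f : T ↪g T) : ∃ r : T ≃g T, ∀ x, r x = f x := by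
  have hfin : ∀ v, (T.neighborSet v).Finite := fun v =>
    Set.finite_of_ncard_ne_zero (by rw [hval]; exact hd)
  have hnb : ∀ x y, T.Adj (f x) y → ∃ z, f z = y := by
    intro x y hxy
    have h1 : f '' T.neighborSet x ⊆ T.neighborSet (f x) := by
      rintro _ ⟨z, hz, rfl⟩
      exact f.map_adj_iff.2 hz
    have h2 : f '' T.neighborSet x = T.neighborSet (f x) := by
      refine Set.eq_of_subset_of_ncard_le h1 ?_ (hfin _)
      rw [Set.ncard_image_of_injective _ f.injective, hval, hval]
    obtain ⟨z, _, hz⟩ : y ∈ f '' T.neighborSet x := h2 ▸ hxy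
    exact ⟨z, hz⟩
  have hsurj : Function.Surjective f := by
    intro y
    obtain ⟨o⟩ := hT.connected.nonempty
    refine Reachable.closed_induction (hT.connected.preconnected (f o) y)
      (C := fun y => ∃ z, f z = y) ⟨o, rfl⟩ ?_
    rintro _ b hab ⟨z, rfl⟩
    exact hnb z b hab
  exact ⟨RelIso.ofSurjective f hsurj, fun _ => rfl⟩

/-- Homogeneity of the regular tree: two embeddings of a connected graph differ by an
automorphism. -/
theorem exists_iso_comp_eq (hT : T.IsTree) {d : ℕ} (hd : d ≠ 0)
    (hval : ∀ v, (T.neighborSet v).ncard = d) (hA : A.Connected) (f f' : A ↪g T) :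
    ∃ r : T ≃g T, ∀ a, r (f a) = f' a := by
  classical
  have : Nonempty Y := hA.nonempty
  have hfin : ∀ v, (T.neighborSet v).Finite := fun v =>
    Set.finite_of_ncard_ne_zero (by rw [hval]; exact hd)
  have hinv : ∀ a, Function.invFun f (f a) = a := Function.leftInverse_invFun f.injective
  obtain ⟨g, hg⟩ := exists_embedding_extending hT hT hfin (fun v w => by rw [hval, hval])
    (Set.range_nonempty f) (convex_range hT hA.preconnected f)
    (fun x => f' (Function.invFun f x)) (by
      refine ⟨?_, ?_⟩
      · rintro _ ⟨a, rfl⟩ _ ⟨b, rfl⟩ hab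
        dsimp only
        rw [hinv, hinv]
        exact f'.map_adj_iff.2 (f.map_adj_iff.1 hab)
      · rintro _ _ _ ⟨_, ⟨a, rfl⟩⟩ _ ⟨_, ⟨b, rfl⟩⟩ hab
        dsimp only at hab
        rw [hinv, hinv] at hab
        rw [f'.injective hab])
  obtain ⟨r, hr⟩ := exists_iso_of_embedding hT hd hval g
  refine ⟨r, fun a => ?_⟩
  rw [hr, hg _ ⟨a, rfl⟩, hinv]

/-- A regular tree is homogeneous with respect to directed edges. -/
theorem exists_iso_edge (hT : T.IsTree) {d : ℕ} (hd : d ≠ 0)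
    (hval : ∀ v, (T.neighborSet v).ncard = d) {p q p' q' : X} (hpq : T.Adj p q)
    (hpq' : T.Adj p' q') : ∃ r : T ≃g T, r p = p' ∧ r q = q' := by
  have emb : ∀ {a b : X}, T.Adj a b →
      ∃ f : (⊤ : SimpleGraph Bool) ↪g T, f false = a ∧ f true = b := by
    intro a b hab
    refine ⟨⟨⟨fun x => bif x then b else a, ?_⟩, ?_⟩, rfl, rfl⟩
    · intro x y hxy
      cases x <;> cases y <;> simp_all [hab.ne, hab.ne']
    · intro x y
      change T.Adj (bif x then b else a) (bif y then b else a) ↔ _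
      cases x <;> cases y <;> simp [hab, hab.symm]
  obtain ⟨f, rfl, rfl⟩ := emb hpq
  obtain ⟨f', rfl, rfl⟩ := emb hpq'
  obtain ⟨r, hr⟩ := exists_iso_comp_eq hT hd hval SimpleGraph.connected_top f f'
  exact ⟨r, hr _, hr _⟩

end Extension

/-! ### Ways and balls -/

section Ways

variable {X : Type*} {T : SimpleGraph X}

/-- A directed edge with a property that passes from each directed edge to some next one is the
beginning of a way all of whose edges have this property. -/
theorem exists_way {D : X → X → Prop} (hadj : ∀ p q, D p q → T.Adj p q)
    (hstep : ∀ p q, D p q → ∃ w, w ≠ p ∧ D q w) {p q : X} (h : D p q) :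
    ∃ a : Way T, a.1 0 = p ∧ a.1 1 = q ∧ ∀ i, D (a.1 i) (a.1 (i + 1)) := by
  choose! next hne hD using hstep
  let e : ℕ → X × X := fun i => Nat.rec (p, q) (fun _ x => (x.2, next x.1 x.2)) i
  have he : ∀ i, D (e i).1 (e i).2 := by
    intro i
    induction i with
    | zero => exact h
    | succ i ih => exact hD _ _ ih
  exact ⟨⟨fun i => (e i).1, fun i => hadj _ _ (he i), fun i => hne _ _ (he i)⟩, rfl, rfl, he⟩

/-- Bar induction: a property of directed edges that is inherited from all next edges and that
holds somewhere on each way holds for all directed edges. -/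
theorem edge_induction {Q : X → X → Prop} (hway : ∀ a : Way T, ∃ i, Q (a.1 i) (a.1 (i + 1)))
    (hstep : ∀ p q, T.Adj p q → (∀ w, T.Adj q w → w ≠ p → Q q w) → Q p q) {p q : X}
    (hpq : T.Adj p q) : Q p q := by
  by_contra hQ
  obtain ⟨a, -, -, ha⟩ := exists_way (T := T) (D := fun p q => T.Adj p q ∧ ¬ Q p q)
    (fun _ _ h => h.1) (fun p q h => by
      by_contra! hc
      exact h.2 (hstep p q h.1 fun w hw hwp => hc w hwp hw)) ⟨hpq, hQ⟩
  obtain ⟨i, hi⟩ := hway a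
  exact (ha i).2 hi

/-- The way without its first `k` vertices. -/
def Way.tail (a : Way T) (k : ℕ) : Way T :=
  ⟨fun i => a.1 (k + i), fun i => a.2.1 (k + i), fun i => a.2.2 (k + i)⟩

theorem Way.limit_tail (a : Way T) (k : ℕ) : (a.tail k).limit = a.limit :=
  Quotient.sound ⟨0, k, fun m => by simp [Way.tail]⟩

theorem limit_eq_iff {a b : Way T} :
    a.limit = b.limit ↔ ∃ i j : ℕ, ∀ m, a.1 (i + m) = b.1 (j + m) :=
  ⟨fun h => Quotient.exact h, fun h => Quotient.sound h⟩

theorem Way.branch_antitone (hT : T.IsTree) (a : Way T) {i j : ℕ} (hij : i ≤ j) :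
    branch T (a.1 j) (a.1 (j + 1)) ⊆ branch T (a.1 i) (a.1 (i + 1)) := by
  induction j, hij using Nat.le_induction with
  | base => exact subset_rfl
  | succ j _ ih =>
    exact (branch_subset_branch hT (a.2.1 j) (a.2.1 (j + 1)) (a.2.2 j)).trans ih

theorem Way.branch_monotone (hT : T.IsTree) (a : Way T) {i j : ℕ} (hij : i ≤ j) :
    branch T (a.1 (i + 1)) (a.1 i) ⊆ branch T (a.1 (j + 1)) (a.1 j) := by
  intro x hx
  rw [← not_mem_branch_iff hT (a.2.1 _)] at hx ⊢
  exact fun h => hx (a.branch_antitone hT hij h)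

theorem Way.mem_branch (hT : T.IsTree) (a : Way T) {i j : ℕ} (hij : i < j) :
    a.1 j ∈ branch T (a.1 i) (a.1 (i + 1)) := by
  obtain ⟨j, rfl⟩ : ∃ k, j = k + 1 := ⟨j - 1, by omega⟩
  exact a.branch_antitone hT (Nat.lt_succ_iff.1 hij) (mem_branch_self _ _)

theorem Way.mem_branch_back (hT : T.IsTree) (a : Way T) {i j : ℕ} (hij : i ≤ j) :
    a.1 i ∈ branch T (a.1 (j + 1)) (a.1 j) :=
  a.branch_monotone hT hij (mem_branch_self _ _)

theorem Way.eventually_mem_branch (hT : T.IsTree) {p q : X} (hpq : T.Adj p q) (a : Way T) :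
    (∃ N, ∀ i ≥ N, a.1 i ∈ branch T p q) ∨ ∃ N, ∀ i ≥ N, a.1 i ∈ branch T q p := by
  have cross : ∀ {p q : X}, T.Adj p q → ∀ N, a.1 N ∈ branch T p q → ∀ i ≥ N,
      a.1 i ∉ branch T p q → ∃ N, ∀ i ≥ N, a.1 i ∈ branch T q p := by
    intro p q hpq N hN i hi hni
    obtain ⟨j, _, _, hj, hj'⟩ : ∃ j, N ≤ j ∧ j < i ∧ a.1 j ∈ branch T p q ∧
        a.1 (j + 1) ∉ branch T p q := by
      by_contra! hc
      refine hni ?_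
      have : ∀ j, N ≤ j → j ≤ i → a.1 j ∈ branch T p q := by
        intro j hj
        induction j, hj using Nat.le_induction with
        | base => exact fun _ => hN
        | succ j hj ih => exact fun h => hc j hj (by omega) (ih (by omega))
      exact this i hi le_rfl
    obtain ⟨h1, h2⟩ := branch_cross hT hpq hj (a.2.1 j) hj'
    exact ⟨j + 1, fun k hk => h1 ▸ h2 ▸ a.mem_branch hT hk⟩
  by_cases h : ∀ i ≥ 0, a.1 i ∈ branch T p q
  · exact .inl ⟨0, h⟩
  push Not at h
  obtain ⟨i, _, hi⟩ := h
  rw [not_mem_branch_iff hT hpq] at hi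
  by_cases h' : ∀ j ≥ i, a.1 j ∈ branch T q p
  · exact .inr ⟨i, h'⟩
  push Not at h'
  obtain ⟨j, hj, hj'⟩ := h'
  exact .inl (cross hpq.symm i hi j hj hj')

theorem limit_mem_ball_iff {p q : X} {a : Way T} :
    a.limit ∈ ball T p q ↔ ∃ N, ∀ i ≥ N, a.1 i ∈ branch T p q := by
  constructor
  · rintro ⟨b, hb, hba⟩
    obtain ⟨i, j, h⟩ := limit_eq_iff.1 hba
    refine ⟨j, fun k hk => ?_⟩
    obtain ⟨m, rfl⟩ := Nat.exists_eq_add_of_le hk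
    rw [← h]
    exact hb _
  · rintro ⟨N, hN⟩
    exact ⟨a.tail N, fun i => hN _ (by simp), a.limit_tail N⟩

theorem Boundary.exists_limit (y : Boundary T) : ∃ a : Way T, a.limit = y :=
  Quotient.exists_rep y

theorem Boundary.exists_limit_from (hT : T.IsTree) (v : X) (y : Boundary T) :
    ∃ a : Way T, a.1 0 = v ∧ a.limit = y := by
  obtain ⟨b, rfl⟩ := y.exists_limit
  refine Reachable.closed_induction (hT.connected.preconnected (b.1 0) v)
    (C := fun v => ∃ a : Way T, a.1 0 = v ∧ a.limit = b.limit) ⟨b, rfl, rfl⟩ ?_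
  rintro u w huw ⟨a, rfl, ha⟩
  by_cases h : a.1 1 = w
  · exact ⟨a.tail 1, h, (a.limit_tail 1).trans ha⟩
  · refine ⟨⟨fun i => Nat.casesOn i w a.1, ?_, ?_⟩, rfl, ?_⟩
    · rintro (_ | i)
      · exact huw.symm
      · exact a.2.1 i
    · rintro (_ | i)
      · exact h
      · exact a.2.2 i
    · exact (limit_eq_iff.2 ⟨1, 0, fun m => by simp [Nat.add_comm 1 m]⟩).trans ha

theorem ball_mono {p q p' q' : X} (h : branch T p q ⊆ branch T p' q') :
    ball T p q ⊆ ball T p' q' := by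
  rintro _ ⟨a, ha, rfl⟩
  exact ⟨a, fun i => h (ha i), rfl⟩

theorem disjoint_ball_of_disjoint_branch {p q p' q' : X}
    (h : ∀ x ∈ branch T p q, x ∉ branch T p' q') : Disjoint (ball T p q) (ball T p' q') := by
  rw [Set.disjoint_left]
  intro y h1 h2
  obtain ⟨a, rfl⟩ := y.exists_limit
  obtain ⟨N, hN⟩ := limit_mem_ball_iff.1 h1
  obtain ⟨M, hM⟩ := limit_mem_ball_iff.1 h2
  exact h _ (hN (max N M) (le_max_left _ _)) (hM _ (le_max_right _ _))

theorem compl_ball (hT : T.IsTree) {p q : X} (hpq : T.Adj p q) :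
    (ball T p q)ᶜ = ball T q p := by
  ext y
  constructor
  · intro h
    obtain ⟨a, rfl⟩ := y.exists_limit
    exact limit_mem_ball_iff.2 ((a.eventually_mem_branch hT hpq).resolve_left
      fun h' => h (limit_mem_ball_iff.2 h'))
  · intro h h'
    exact Set.disjoint_left.1 (disjoint_ball_of_disjoint_branch
      fun x hx hx' => disjoint_branch hT hpq hx hx') h' h

theorem disjoint_ball_of_ne (hT : T.IsTree) {q w w' : X} (hqw : T.Adj q w) (hqw' : T.Adj q w')
    (h : w ≠ w') : Disjoint (ball T q w) (ball T q w') :=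
  disjoint_ball_of_disjoint_branch fun _ h1 h2 => disjoint_branch_of_ne hT hqw hqw' h h1 h2

theorem isOpen_ball {p q : X} (hpq : T.Adj p q) : IsOpen (ball T p q) :=
  TopologicalSpace.isOpen_generateFrom_of_mem ⟨p, q, hpq, rfl⟩

theorem isClopen_ball (hT : T.IsTree) {p q : X} (hpq : T.Adj p q) : IsClopen (ball T p q) :=
  ⟨⟨by rw [compl_ball hT hpq]; exact isOpen_ball hpq.symm⟩, isOpen_ball hpq⟩

theorem Way.limit_mem_ball (hT : T.IsTree) (a : Way T) (i : ℕ) :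
    a.limit ∈ ball T (a.1 i) (a.1 (i + 1)) :=
  limit_mem_ball_iff.2 ⟨i + 1, fun _ hj => a.mem_branch hT hj⟩

/-- The balls cut off by the edges of a way are a basis of neighbourhoods of its limit. -/
theorem Way.exists_ball_subset (hT : T.IsTree) (a : Way T) {U : Set (Boundary T)}
    (hU : IsOpen U) (ha : a.limit ∈ U) : ∃ i, ball T (a.1 i) (a.1 (i + 1)) ⊆ U := by
  have anti : ∀ {i j}, i ≤ j → ball T (a.1 j) (a.1 (j + 1)) ⊆ ball T (a.1 i) (a.1 (i + 1)) :=
    fun h => ball_mono (a.branch_antitone hT h)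
  induction hU with
  | basic U hU =>
    obtain ⟨p, q, hpq, rfl⟩ := hU
    obtain ⟨b, hb, hba⟩ := a.limit.exists_limit_from hT p
    obtain ⟨i, j, h⟩ := limit_eq_iff.1 hba
    obtain ⟨N, hN⟩ := limit_mem_ball_iff.1 ha
    refine ⟨j + N, ball_mono (branch_subset_of_not_mem hT hpq (hN _ (by omega)) ?_)⟩
    have h1 := h N
    have h2 := h (N + 1)
    rw [← add_assoc, ← add_assoc] at h2
    rw [← h1, ← h2, ← hb, not_mem_branch_iff hT (b.2.1 _)]
    exact b.mem_branch_back hT (Nat.zero_le _)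
  | univ => exact ⟨0, Set.subset_univ _⟩
  | inter U V _ _ ihU ihV =>
    obtain ⟨i, hi⟩ := ihU ha.1
    obtain ⟨j, hj⟩ := ihV ha.2
    exact ⟨max i j, Set.subset_inter ((anti (le_max_left _ _)).trans hi)
      ((anti (le_max_right _ _)).trans hj)⟩
  | sUnion C _ ih =>
    obtain ⟨U, hU, haU⟩ := ha
    obtain ⟨i, hi⟩ := ih U hU haU
    exact ⟨i, hi.trans (Set.subset_sUnion_of_mem hU)⟩

theorem exists_ball_child (hT : T.IsTree) {p q : X} (hpq : T.Adj p q) {y : Boundary T}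
    (hy : y ∈ ball T p q) : ∃ w, T.Adj q w ∧ w ≠ p ∧ y ∈ ball T q w := by
  obtain ⟨a, rfl, rfl⟩ := y.exists_limit_from hT q
  have h := a.limit_mem_ball hT 0
  refine ⟨a.1 1, a.2.1 0, ?_, h⟩
  rintro rfl
  rw [← compl_ball hT hpq] at h
  exact h hy

theorem ball_child_subset (hT : T.IsTree) {p q w : X} (hpq : T.Adj p q) (hqw : T.Adj q w)
    (hw : w ≠ p) : ball T q w ⊆ ball T p q :=
  ball_mono (branch_subset_branch hT hpq hqw hw)

theorem Way.exists_not_mem_ball (hT : T.IsTree) (a : Way T) {y : Boundary T}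
    (hy : y ≠ a.limit) : ∃ i, y ∉ ball T (a.1 i) (a.1 (i + 1)) := by
  by_contra! hc
  obtain ⟨b, hb, rfl⟩ := y.exists_limit_from hT (a.1 0)
  refine hy (congrArg Way.limit (Subtype.ext (funext fun i => ?_)))
  induction i with
  | zero => exact hb
  | succ i ih =>
    by_contra hne
    have h1 := b.limit_mem_ball hT i
    have hadj := b.2.1 i
    rw [ih] at h1 hadj
    exact Set.disjoint_left.1 (disjoint_ball_of_ne hT hadj (a.2.1 i) hne) h1 (hc i)

theorem exists_ball_separating (hT : T.IsTree) {x y : Boundary T} (h : x ≠ y) :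
    ∃ p q, T.Adj p q ∧ x ∈ ball T p q ∧ y ∉ ball T p q := by
  obtain ⟨a, rfl⟩ := x.exists_limit
  obtain ⟨i, hi⟩ := a.exists_not_mem_ball hT h.symm
  exact ⟨_, _, a.2.1 i, a.limit_mem_ball hT i, hi⟩

theorem autHomeo_image_ball (r : T ≃g T) (p q : X) :
    autHomeo T r '' ball T p q = ball T (r p) (r q) := by
  ext y
  constructor
  · rintro ⟨x, hx, rfl⟩
    exact autMap_mem_ball r hx
  · intro hy
    refine ⟨autMap r⁻¹ y, ?_, ?_⟩
    · have := autMap_mem_ball r⁻¹ hy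
      have h2 : ∀ x, (r⁻¹ : T ≃g T) (r x) = x := fun x => r.symm_apply_apply x
      rwa [h2, h2] at this
    · change autMap r (autMap r⁻¹ y) = y
      rw [← autMap_mul, mul_inv_cancel, autMap_one]

end Ways

/-! ### The boundary of a regular tree -/

/-- `T` is a tree in which every vertex has valence `n + 1`, where `n ≥ 2`. -/
structure IsRegularTree {X : Type*} (T : SimpleGraph X) (n : ℕ) : Prop where
  isTree : T.IsTree
  two_le : 2 ≤ n
  valence : ∀ v, (T.neighborSet v).ncard = n + 1

namespace IsRegularTree

variable {X : Type*} {T : SimpleGraph X} {n : ℕ}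

theorem finite_neighborSet (hR : IsRegularTree T n) (v : X) : (T.neighborSet v).Finite :=
  Set.finite_of_ncard_ne_zero (by rw [hR.valence]; omega)

theorem children_finite (hR : IsRegularTree T n) (p q : X) :
    {w | T.Adj q w ∧ w ≠ p}.Finite :=
  (hR.finite_neighborSet q).subset fun _ h => h.1

theorem children_ncard (hR : IsRegularTree T n) {p q : X} (hpq : T.Adj p q) :
    {w | T.Adj q w ∧ w ≠ p}.ncard = n := by
  have : {w | T.Adj q w ∧ w ≠ p} = T.neighborSet q \ {p} := by
    ext w
    simp
  rw [this, Set.ncard_sdiff_singleton_of_mem (show p ∈ T.neighborSet q from hpq.symm), hR.valence]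
  rfl

theorem exists_child (hR : IsRegularTree T n) {p q : X} (hpq : T.Adj p q) :
    ∃ w, T.Adj q w ∧ w ≠ p := by
  have h : {w | T.Adj q w ∧ w ≠ p}.Nonempty := by
    apply Set.nonempty_of_ncard_ne_zero
    have := hR.two_le
    rw [hR.children_ncard hpq]
    omega
  exact h

theorem exists_two_children (hR : IsRegularTree T n) {p q : X} (hpq : T.Adj p q) :
    ∃ w w', T.Adj q w ∧ w ≠ p ∧ T.Adj q w' ∧ w' ≠ p ∧ w ≠ w' := by
  have h : 1 < {w | T.Adj q w ∧ w ≠ p}.ncard := by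
    have := hR.two_le
    rw [hR.children_ncard hpq]
    omega
  obtain ⟨w, hw, w', hw', hne⟩ := (Set.one_lt_ncard (hR.children_finite p q)).1 h
  exact ⟨w, w', hw.1, hw.2, hw'.1, hw'.2, hne⟩

theorem exists_way_from (hR : IsRegularTree T n) {p q : X} (hpq : T.Adj p q) :
    ∃ a : Way T, a.1 0 = p ∧ a.1 1 = q := by
  obtain ⟨a, h0, h1, -⟩ := exists_way (T := T) (D := T.Adj) (fun _ _ h => h) (fun p q h => by
    obtain ⟨w, hw, hwp⟩ := hR.exists_child h
    exact ⟨w, hwp, hw⟩) hpq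
  exact ⟨a, h0, h1⟩

theorem ball_nonempty (hR : IsRegularTree T n) {p q : X} (hpq : T.Adj p q) :
    (ball T p q).Nonempty := by
  obtain ⟨a, rfl, rfl⟩ := hR.exists_way_from hpq
  exact ⟨a.limit, a.limit_mem_ball hR.isTree 0⟩

theorem ball_ne_univ (hR : IsRegularTree T n) {p q : X} (hpq : T.Adj p q) :
    ball T p q ≠ Set.univ := by
  intro h
  have := compl_ball hR.isTree hpq
  rw [h, Set.compl_univ] at this
  exact (hR.ball_nonempty hpq.symm).ne_empty this.symm

theorem exists_adj (hR : IsRegularTree T n) (v : X) : ∃ w, T.Adj v w := by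
  have h : (T.neighborSet v).Nonempty := by
    apply Set.nonempty_of_ncard_ne_zero
    rw [hR.valence]
    omega
  exact h

theorem exists_edge_iso (hR : IsRegularTree T n) {p q p' q' : X} (hpq : T.Adj p q)
    (hpq' : T.Adj p' q') : ∃ r : T ≃g T, r p = p' ∧ r q = q' :=
  exists_iso_edge hR.isTree (Nat.succ_ne_zero n) hR.valence hpq hpq'

end IsRegularTree

/-! ### Disjoint unions of balls -/

section Decomposes

variable {X : Type*} {T : SimpleGraph X} {n : ℕ} {P : Set (Boundary T) → Prop}

/-- `Ω` is a disjoint union of balls with a property `P`, and their number is congruent to `ι`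
modulo `n - 1`. -/
def Decomposes (T : SimpleGraph X) (n : ℕ) (P : Set (Boundary T) → Prop) (ι : ℕ)
    (Ω : Set (Boundary T)) : Prop :=
  ∃ (m : ℕ) (B : Fin m → Set (Boundary T)), m ≡ ι [MOD n - 1] ∧
    (∀ i, IsBall T (B i) ∧ P (B i)) ∧ Pairwise (fun i j => Disjoint (B i) (B j)) ∧ Ω = ⋃ i, B i

theorem decomposes_of_finite {ι : ℕ} {I : Type*} [Finite I] {B : I → Set (Boundary T)}
    (hB : ∀ i, IsBall T (B i) ∧ P (B i)) (hd : Pairwise (fun i j => Disjoint (B i) (B j)))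
    (hc : Nat.card I ≡ ι [MOD n - 1]) : Decomposes T n P ι (⋃ i, B i) := by
  refine ⟨Nat.card I, fun i => B ((Finite.equivFin I).symm i), hc, fun i => hB _, ?_, ?_⟩
  · exact fun i j hij => hd fun h => hij ((Finite.equivFin I).symm.injective h)
  · exact ((Finite.equivFin I).symm.surjective.iUnion_comp B).symm

theorem decomposes_iUnion {ι : ℕ} {I : Type*} [Fintype I] {m : I → ℕ}
    {C : I → Set (Boundary T)} (hC : ∀ i, Decomposes T n P (m i) (C i))
    (hd : Pairwise (fun i j => Disjoint (C i) (C j))) (hm : ∑ i, m i ≡ ι [MOD n - 1]) :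
    Decomposes T n P ι (⋃ i, C i) := by
  choose k B hk hB hBd hCB using hC
  have h := decomposes_of_finite (P := P) (n := n) (ι := ι)
    (B := fun x : Σ i, Fin (k i) => B x.1 x.2) (fun x => hB _ _) (by
      rintro ⟨i, k⟩ ⟨j, l⟩ hne
      by_cases hij : i = j
      · subst hij
        exact hBd i fun h => hne (congrArg (Sigma.mk i) h)
      · refine (hd hij).mono ?_ ?_
        · rw [hCB i]
          exact Set.subset_iUnion (B i) k
        · rw [hCB j]
          exact Set.subset_iUnion (B j) l) (by
      rw [Nat.card_sigma]
      simp only [Nat.card_eq_fintype_card, Fintype.card_fin]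
      exact (Nat.ModEq.sum fun i _ => hk i).trans hm)
  rw [Set.iUnion_sigma] at h
  simpa only [← hCB] using h

theorem decomposes_ball {p q : X} (hpq : T.Adj p q) (h : P (ball T p q)) :
    Decomposes T n P 1 (ball T p q) := by
  have := decomposes_of_finite (T := T) (n := n) (P := P) (ι := 1) (I := Unit)
    (B := fun _ => ball T p q) (fun _ => ⟨⟨p, q, hpq, rfl⟩, h⟩)
    (fun i j hij => absurd rfl hij) (by simp [Nat.ModEq])
  rwa [Set.iUnion_const] at this

theorem Decomposes.union {m m' ι : ℕ} {C C' : Set (Boundary T)} (h : Decomposes T n P m C)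
    (h' : Decomposes T n P m' C') (hd : Disjoint C C') (hm : m + m' ≡ ι [MOD n - 1]) :
    Decomposes T n P ι (C ∪ C') := by
  rw [Set.union_eq_iUnion]
  refine decomposes_iUnion (m := fun b => bif b then m else m') ?_ ?_ (by simpa using hm)
  · rintro (_ | _) <;> assumption
  · rintro (_ | _) (_ | _) hne
    · exact absurd rfl hne
    · exact hd.symm
    · exact hd
    · exact absurd rfl hne

theorem Decomposes.mem_clopRes (hT : T.IsTree) {ι : ℕ} {Ω : Set (Boundary T)}
    (h : Decomposes T n P ι Ω) (hne : Ω.Nonempty) (huniv : Ω ≠ Set.univ) :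
    Ω ∈ ClopRes T n ι := by
  obtain ⟨m, B, hm, hB, hd, rfl⟩ := h
  refine ⟨isClopen_iUnion_of_finite fun i => ?_, hne, huniv, m, B, hm, fun i => (hB i).1, hd, rfl⟩
  obtain ⟨⟨p, q, hpq, h⟩, -⟩ := hB i
  rw [h]
  exact isClopen_ball hT hpq

/-- Each residue class modulo `n - 1` contains a number `m` with `1 ≤ m ≤ n - 1`, and `m` of the
`n` balls into which a ball splits form a proper part of it. -/
theorem IsRegularTree.exists_decomposes_subset_ball (hR : IsRegularTree T n) {p q : X}
    (hpq : T.Adj p q) {y : Boundary T} (hy : y ∈ ball T p q) (κ : ℕ) :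
    ∃ Ω, y ∈ Ω ∧ Ω ⊆ ball T p q ∧ (ball T p q \ Ω).Nonempty ∧
      Decomposes T n (fun _ => True) κ Ω := by
  classical
  have hn := hR.two_le
  obtain ⟨m, hm1, hmn, hm⟩ : ∃ m, 1 ≤ m ∧ m ≤ n - 1 ∧ m ≡ κ [MOD n - 1] := by
    have hlt := Nat.mod_lt κ (show n - 1 > 0 by omega)
    by_cases h : κ % (n - 1) = 0
    · exact ⟨n - 1, by omega, le_rfl, by simp [Nat.ModEq, h]⟩
    · exact ⟨κ % (n - 1), by omega, by omega, Nat.mod_modEq _ _⟩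
  obtain ⟨w, hw, hwp, hyw⟩ := exists_ball_child hR.isTree hpq hy
  let K := (hR.children_finite p q).toFinset
  have hKcard : K.card = n := by
    rw [← Set.ncard_eq_toFinset_card _ (hR.children_finite p q), hR.children_ncard hpq]
  have hK : ∀ w, w ∈ K ↔ T.Adj q w ∧ w ≠ p := by simp [K]
  obtain ⟨S, hwS, hSK, hS⟩ := Finset.exists_subsuperset_card_eq (s := {w}) (t := K) (n := m)
    (by simpa using (hK w).2 ⟨hw, hwp⟩) (by simpa using hm1) (by omega)
  obtain ⟨w', hw'K, hw'S⟩ : ∃ w' ∈ K, w' ∉ S := by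
    by_contra! hc
    have := Finset.card_le_card (show K ⊆ S from hc)
    omega
  obtain ⟨z, hz⟩ := hR.ball_nonempty ((hK w').1 hw'K).1
  refine ⟨⋃ w : S, ball T q w, ?_, ?_, ⟨z, ?_, ?_⟩, ?_⟩
  · exact Set.mem_iUnion.2 ⟨⟨w, by simpa using hwS⟩, hyw⟩
  · refine Set.iUnion_subset fun w => ?_
    obtain ⟨h1, h2⟩ := (hK w).1 (hSK w.2)
    exact ball_child_subset hR.isTree hpq h1 h2
  · exact ball_child_subset hR.isTree hpq ((hK w').1 hw'K).1 ((hK w').1 hw'K).2 hz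
  · intro h
    obtain ⟨w, hzw⟩ := Set.mem_iUnion.1 h
    exact Set.disjoint_left.1 (disjoint_ball_of_ne hR.isTree ((hK w).1 (hSK w.2)).1
      ((hK w').1 hw'K).1 fun h => hw'S (h ▸ w.2)) hzw hz
  · refine decomposes_of_finite (fun w => ⟨⟨q, w, ((hK w).1 (hSK w.2)).1, rfl⟩, trivial⟩) ?_ ?_
    · intro w w' hne
      exact disjoint_ball_of_ne hR.isTree ((hK w).1 (hSK w.2)).1 ((hK w').1 (hSK w'.2)).1
        fun h => hne (Subtype.ext h)
    · rw [Nat.card_eq_fintype_card, Fintype.card_coe, hS]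
      exact hm

/-- If small balls have the property `P`, then each ball decomposes into balls with this property.
Splitting a ball increases the number of balls by `n - 1`. -/
theorem IsRegularTree.decomposes_ball_of_way (hR : IsRegularTree T n)
    (hP : ∀ a : Way T, ∃ i, P (ball T (a.1 i) (a.1 (i + 1)))) {p q : X} (hpq : T.Adj p q) :
    Decomposes T n P 1 (ball T p q) := by
  refine edge_induction (T := T) (Q := fun p q => Decomposes T n P 1 (ball T p q)) ?_ ?_ hpq
  · intro a
    obtain ⟨i, hi⟩ := hP a
    exact ⟨i, decomposes_ball (a.2.1 i) hi⟩
  · intro p q hpq ih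
    have : Fintype {w | T.Adj q w ∧ w ≠ p} := (hR.children_finite p q).fintype
    have h := decomposes_iUnion (T := T) (n := n) (P := P) (ι := 1)
      (I := {w | T.Adj q w ∧ w ≠ p}) (m := fun _ => 1) (C := fun w => ball T q w)
      (fun w => ih w w.2.1 w.2.2)
      (fun w w' hne => disjoint_ball_of_ne hR.isTree w.2.1 w'.2.1 fun h => hne (Subtype.ext h))
      (by
        have hn := hR.two_le
        rw [Finset.sum_const, Finset.card_univ, ← Nat.card_eq_fintype_card,
          Nat.card_coe_set_eq, hR.children_ncard hpq, smul_eq_mul, mul_one]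
        obtain ⟨k, rfl⟩ : ∃ k, n = k + 1 := ⟨n - 1, by omega⟩
        simp [Nat.ModEq])
    convert h using 1
    refine Set.Subset.antisymm (fun y hy => ?_) (Set.iUnion_subset fun w =>
      ball_child_subset hR.isTree hpq w.2.1 w.2.2)
    obtain ⟨w, h1, h2, h3⟩ := exists_ball_child hR.isTree hpq hy
    exact Set.mem_iUnion.2 ⟨⟨w, h1, h2⟩, h3⟩

theorem IsRegularTree.countable (hR : IsRegularTree T n) (ι : ℕ) : (ClopRes T n ι).Countable := by
  have := countable_of_isTree hR.isTree hR.finite_neighborSet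
  have hb : {B | IsBall T B}.Countable :=
    (Set.countable_range fun x : X × X => ball T x.1 x.2).mono (by
      rintro B ⟨p, q, -, rfl⟩
      exact ⟨(p, q), rfl⟩)
  have : Countable {B | IsBall T B} := hb.to_subtype
  refine (Set.countable_range
    fun x : Σ m, Fin m → {B | IsBall T B} => ⋃ i, (x.2 i : Set (Boundary T))).mono ?_
  rintro Ω ⟨-, -, -, m, B, -, hB, -, rfl⟩
  exact ⟨⟨m, fun i => ⟨B i, hB i⟩⟩, rfl⟩

end Decomposes

/-! ### The action of spheromorphisms on clopen sets -/

section Action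

variable {X : Type*} {T : SimpleGraph X} {n : ℕ}

/-- A spheromorphism coincides with an automorphism of the tree on small balls. -/
theorem exists_ball_eqOn (hT : T.IsTree) (g : Hier T) (a : Way T) :
    ∃ i, ∃ r : T ≃g T, Set.EqOn g.1 (autHomeo T r) (ball T (a.1 i) (a.1 (i + 1))) := by
  obtain ⟨N, hN, r, hr⟩ := g.2 a.limit
  obtain ⟨U, hUN, hU, ha⟩ := mem_nhds_iff.1 hN
  obtain ⟨i, hi⟩ := a.exists_ball_subset hT hU ha
  exact ⟨i, r, fun z hz => hr z (hUN (hi hz))⟩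

theorem IsRegularTree.image_mem_clopRes (hR : IsRegularTree T n) {ι : ℕ} (g : Hier T)
    {Ω : Set (Boundary T)} (hΩ : Ω ∈ ClopRes T n ι) : g.1 '' Ω ∈ ClopRes T n ι := by
  obtain ⟨-, hne, huniv, m, B, hm, hB, hd, hΩB⟩ := hΩ
  have h : Decomposes T n (fun B => ∃ r : T ≃g T, Set.EqOn g.1 (autHomeo T r) B) ι Ω := by
    rw [hΩB]
    refine decomposes_iUnion (m := fun _ => 1) (fun i => ?_) hd (by simpa using hm)
    obtain ⟨p, q, hpq, h⟩ := hB i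
    rw [h]
    exact hR.decomposes_ball_of_way (exists_ball_eqOn hR.isTree g) hpq
  obtain ⟨k, C, hk, hC, hCd, hΩC⟩ := h
  have h : Decomposes T n (fun _ => True) ι (g.1 '' Ω) := by
    refine ⟨k, fun i => g.1 '' C i, hk, fun i => ⟨?_, trivial⟩, ?_, ?_⟩
    · obtain ⟨⟨p, q, hpq, h⟩, r, hr⟩ := hC i
      refine ⟨r p, r q, r.map_adj_iff.2 hpq, ?_⟩
      change g.1 '' C i = _
      rw [hr.image_eq, h, autHomeo_image_ball]
    · exact fun i j hij => (Set.disjoint_image_iff g.1.injective).2 (hCd hij)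
    · rw [hΩC, Set.image_iUnion]
  refine h.mem_clopRes hR.isTree (hne.image _) fun hu => huniv ?_
  rw [← Set.image_univ_of_surjective g.1.surjective] at hu
  exact g.1.injective.image_injective hu

/-- The action of a spheromorphism on clopen sets. -/
def IsRegularTree.clopPerm (hR : IsRegularTree T n) (ι : ℕ) :
    Hier T →* Equiv.Perm (ClopRes T n ι) where
  toFun g :=
    { toFun := fun Ω => ⟨g.1 '' Ω, hR.image_mem_clopRes g Ω.2⟩
      invFun := fun Ω => ⟨(g⁻¹ : Hier T).1 '' Ω, hR.image_mem_clopRes g⁻¹ Ω.2⟩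
      left_inv := fun _ => Subtype.ext <|
        (Set.image_image _ _ _).trans <|
          (Set.image_congr fun z _ => g.1.symm_apply_apply z).trans (Set.image_id _)
      right_inv := fun _ => Subtype.ext <|
        (Set.image_image _ _ _).trans <|
          (Set.image_congr fun z _ => g.1.apply_symm_apply z).trans (Set.image_id _) }
  map_one' := Equiv.ext fun _ => Subtype.ext (Set.image_id _)
  map_mul' g h := Equiv.ext fun _ => Subtype.ext (Set.image_comp g.1 h.1 _)

theorem IsRegularTree.clopPerm_apply (hR : IsRegularTree T n) {ι : ℕ} (g : Hier T)
    (Ω : ClopRes T n ι) : (hR.clopPerm ι g Ω : Set (Boundary T)) = g.1 '' Ω := rfl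

theorem IsRegularTree.clopPerm_injective (hR : IsRegularTree T n) (ι : ℕ) :
    Function.Injective (hR.clopPerm ι) := by
  refine (injective_iff_map_eq_one _).2 fun g hg => Subtype.ext (Homeomorph.ext fun x => ?_)
  by_contra hne
  change g.1 x ≠ x at hne
  obtain ⟨p, q, hpq, hx, hgx⟩ := exists_ball_separating hR.isTree hne.symm
  obtain ⟨Ω, hxΩ, hΩ, ⟨z, -, hz⟩, hdec⟩ := hR.exists_decomposes_subset_ball hpq hx ι
  have hmem := hdec.mem_clopRes hR.isTree ⟨x, hxΩ⟩ fun h => hz (h ▸ Set.mem_univ z)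
  have h1 := hR.clopPerm_apply g ⟨Ω, hmem⟩
  rw [hg] at h1
  change Ω = g.1 '' Ω at h1
  exact hgx (hΩ (h1 ▸ Set.mem_image_of_mem _ hxΩ))

/-- The orbits of the automorphism group of the tree on proper nonempty clopen sets are infinite.
If the orbit were finite, one of its elements would contain infinitely many of the increasing balls
that exhaust the complement of a boundary point, and this point would be isolated. -/
theorem IsRegularTree.autOrbit_infinite (hR : IsRegularTree T n) {Ω : Set (Boundary T)}
    (hΩ : IsOpen Ω) (hΩ' : IsClosed Ω) (hne : Ω.Nonempty) (huniv : Ω ≠ Set.univ) :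
    (autOrbit T Ω).Infinite := by
  intro hfin
  have hT := hR.isTree
  obtain ⟨x, hx⟩ := hne
  obtain ⟨a, rfl⟩ := x.exists_limit
  obtain ⟨k, hk⟩ := a.exists_ball_subset hT hΩ hx
  have hr : ∀ i, ∃ Ω' ∈ autOrbit T Ω, ball T (a.1 (i + 1)) (a.1 i) ⊆ Ω' := by
    intro i
    obtain ⟨r, h1, h2⟩ := hR.exists_edge_iso (a.2.1 k) (a.2.1 i).symm
    refine ⟨autHomeo T r '' Ω, ⟨r, rfl⟩, ?_⟩
    rw [← h1, ← h2, ← autHomeo_image_ball]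
    exact Set.image_mono hk
  choose C hC hCb using hr
  obtain ⟨Ω', hΩ'mem, hinf⟩ : ∃ Ω' ∈ autOrbit T Ω, {i | C i = Ω'}.Infinite := by
    by_contra! hc
    refine Set.infinite_univ (α := ℕ) ((hfin.biUnion (t := fun Ω' => {i | C i = Ω'})
      fun Ω' h => hc Ω' h).subset fun i _ => ?_)
    exact Set.mem_biUnion (hC i) rfl
  obtain ⟨r, rfl⟩ := hΩ'mem
  -- The balls on the other side of the edges of the way `a` exhaust the complement of its limit.
  have hall : ∀ y, y ≠ a.limit → y ∈ autHomeo T r '' Ω := by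
    intro y hy
    obtain ⟨i, hi⟩ := a.exists_not_mem_ball hT hy
    obtain ⟨j, hj, hij⟩ := hinf.exists_gt i
    rw [← Set.mem_compl_iff, compl_ball hT (a.2.1 i)] at hi
    rw [← show C j = _ from hj]
    exact hCb j (ball_mono (a.branch_monotone hT hij.le) hi)
  have hnot : a.limit ∉ autHomeo T r '' Ω := by
    intro h
    refine huniv ((autHomeo T r).injective.image_injective ?_)
    rw [Set.image_univ_of_surjective (autHomeo T r).surjective, Set.eq_univ_iff_forall]
    intro y
    by_cases hy : y = a.limit
    · rwa [hy]
    · exact hall y hy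
  have hopen : IsOpen (autHomeo T r '' Ω)ᶜ :=
    ((autHomeo T r).isClosed_image.2 hΩ').isOpen_compl
  obtain ⟨i, hi⟩ := a.exists_ball_subset hT hopen hnot
  have hpt : ∀ y ∈ ball T (a.1 i) (a.1 (i + 1)), y = a.limit := fun y hy => by
    by_contra h
    exact hi hy (hall y h)
  obtain ⟨w, w', hw, hwp, hw', hwp', hne⟩ := hR.exists_two_children (a.2.1 i)
  obtain ⟨y, hy⟩ := hR.ball_nonempty hw
  obtain ⟨y', hy'⟩ := hR.ball_nonempty hw'
  have e1 := hpt y (ball_child_subset hT (a.2.1 i) hw hwp hy)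
  have e2 := hpt y' (ball_child_subset hT (a.2.1 i) hw' hwp' hy')
  exact Set.disjoint_left.1 (disjoint_ball_of_ne hT hw hw' hne) hy (e1.trans e2.symm ▸ hy')

end Action

/-! ### Thorns and their clopen sets -/

namespace Thorn

variable {X : Type*} {T : SimpleGraph X} {n : ℕ} (R : Thorn n)

theorem two_le_card : 2 ≤ Nat.card R.Cell := by
  rcases R.spike_spec with ⟨h, -⟩ | ⟨h, -⟩ <;> omega

theorem exists_adj (x : R.Cell) : ∃ y, R.graph.Adj x y := by
  have := R.finite
  have : Nontrivial R.Cell := by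
    rw [← Finite.one_lt_card_iff_nontrivial]
    have := R.two_le_card
    omega
  obtain ⟨y, hy⟩ := exists_ne x
  obtain ⟨w, hw, -⟩ := exists_mem_branch R.isTree hy
  exact ⟨w, hw⟩

variable {R}

theorem eq_of_adj_spike {s a b : R.Cell} (hs : s ∈ R.spike) (ha : R.graph.Adj s a)
    (hb : R.graph.Adj s b) : a = b := by
  have := R.finite
  rcases R.spike_spec with ⟨-, h⟩ | ⟨h, -⟩
  · obtain ⟨c, hc⟩ := Set.ncard_eq_one.1 ((h s).1 hs)
    have ha' : a ∈ R.graph.neighborSet s := ha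
    have hb' : b ∈ R.graph.neighborSet s := hb
    rw [hc] at ha' hb'
    exact ha'.trans hb'.symm
  · by_contra hab
    have h3 : ({s, a, b} : Set R.Cell).ncard = 3 := Set.ncard_eq_three.2
      ⟨s, a, b, ha.ne, hb.ne, hab, rfl⟩
    have := Set.ncard_le_card ({s, a, b} : Set R.Cell)
    omega

theorem not_spike_of_adj {s a : R.Cell} (hs : s ∈ R.spike) (ha : R.graph.Adj s a) :
    a ∉ R.spike := by
  intro has
  have := R.finite
  have hne := ha.ne
  rcases R.spike_spec with ⟨h, -⟩ | ⟨-, h⟩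
  · have hall : ∀ x, x ∈ ({s, a} : Set R.Cell) := fun x => by
      refine Reachable.closed_induction (R.isTree.connected.preconnected s x)
        (C := fun x => x ∈ ({s, a} : Set R.Cell)) (by simp) ?_
      rintro b c hbc (rfl | rfl)
      · exact .inr (eq_of_adj_spike hs hbc ha)
      · exact .inl (eq_of_adj_spike has hbc ha.symm)
    have h2 := Set.ncard_pair hne
    rw [Set.eq_univ_of_forall hall, Set.ncard_univ] at h2
    omega
  · obtain ⟨c, hc⟩ := Set.ncard_eq_one.1 h
    rw [hc] at hs has
    exact hne (hs.trans has.symm)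

variable (R) in
theorem exists_not_spike : ∃ a, a ∉ R.spike := by
  obtain ⟨x⟩ := R.isTree.connected.nonempty
  obtain ⟨y, hxy⟩ := R.exists_adj x
  by_cases h : x ∈ R.spike
  · exact ⟨y, not_spike_of_adj h hxy⟩
  · exact ⟨x, h⟩

theorem exists_adj_ne (hbig : 3 ≤ Nat.card R.Cell) {a : R.Cell} (ha : a ∉ R.spike)
    (x : R.Cell) : ∃ y, R.graph.Adj a y ∧ y ≠ x := by
  have := R.finite
  rcases R.spike_spec with ⟨-, h⟩ | ⟨h, -⟩
  · obtain ⟨y, hy⟩ := R.exists_adj a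
    by_contra! hc
    refine ha ((h a).2 (Set.ncard_eq_one.2 ⟨x, ?_⟩))
    ext z
    refine ⟨hc z, ?_⟩
    rintro rfl
    exact hc y hy ▸ hy
  · omega

/-- A spike is a leaf: all other cells lie on the other side of its edge. -/
theorem mem_branch_of_ne (hT : T.IsTree) (f : R.graph ↪g T) {s a x : R.Cell} (hs : s ∈ R.spike)
    (ha : R.graph.Adj s a) (hx : x ≠ s) : f x ∈ branch T (f s) (f a) := by
  have h : f x ∈ branch T (f s) (f a) ∨ x = s := by
    refine Reachable.closed_induction (R.isTree.connected.preconnected a x)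
      (C := fun x => f x ∈ branch T (f s) (f a) ∨ x = s) (.inl (mem_branch_self _ _)) ?_
    rintro b c hbc (hb | rfl)
    · by_contra! hc
      exact hc.2 (f.injective
        (branch_cross hT (f.map_adj_iff.2 ha) hb (f.map_adj_iff.2 hbc) hc.1).2)
    · rw [eq_of_adj_spike hs hbc ha]
      exact .inl (mem_branch_self _ _)
  exact h.resolve_right hx

theorem ball_subset_clopen (f : R.graph ↪g T) {s a : R.Cell} (hs : s ∈ R.spike)
    (ha : R.graph.Adj a s) : ball T (f a) (f s) ⊆ R.clopen f := fun _ hy =>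
  ⟨a, s, not_spike_of_adj hs ha.symm, hs, ha, hy⟩

theorem disjoint_ball_of_ne (hT : T.IsTree) (f : R.graph ↪g T) {s s' a a' : R.Cell}
    (hs : s ∈ R.spike) (hs' : s' ∈ R.spike) (ha : R.graph.Adj a s) (ha' : R.graph.Adj a' s')
    (hne : s ≠ s') : Disjoint (ball T (f a) (f s)) (ball T (f a') (f s')) := by
  have hfa : T.Adj (f a) (f s) := f.map_adj_iff.2 ha
  have hfa' : T.Adj (f a') (f s') := f.map_adj_iff.2 ha'
  have h := branch_subset_of_not_mem hT hfa.symm (mem_branch_of_ne hT f hs ha.symm hne.symm)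
    ((not_mem_branch_iff hT hfa').2 (mem_branch_of_ne hT f hs' ha'.symm hne))
  exact disjoint_ball_of_disjoint_branch fun x hx hx' => disjoint_branch hT hfa hx (h hx')

/-- The ball behind an edge that leaves the embedded thorn at a vertex is disjoint from the clopen
set of the thorn. -/
theorem disjoint_ball_clopen (hT : T.IsTree) (f : R.graph ↪g T) {b : R.Cell} (hb : b ∉ R.spike)
    {w : X} (hw : T.Adj (f b) w) (hwf : w ∉ Set.range f) :
    Disjoint (ball T (f b) w) (R.clopen f) := by
  rw [Set.disjoint_right]
  rintro y ⟨a, s, -, hs, has, hy⟩ hy'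
  have hfs : T.Adj (f a) (f s) := f.map_adj_iff.2 has
  have h1 : f b ∈ branch T (f s) (f a) :=
    mem_branch_of_ne hT f hs has.symm fun h => hb (h ▸ hs)
  have h2 : w ∈ branch T (f s) (f a) := by
    by_contra h
    exact hwf ⟨s, (branch_cross hT hfs.symm h1 hw h).2.symm⟩
  have h3 : f s ∉ branch T (f b) w := (not_mem_branch_iff hT hw).2
    (convex_range hT R.isTree.connected.preconnected f w (f b) hw.symm hwf ⟨b, rfl⟩ ⟨s, rfl⟩)
  have h4 := ball_mono (branch_subset_of_not_mem hT hfs.symm h2 h3) hy'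
  rw [← compl_ball hT hfs] at h4
  exact h4 hy

theorem decomposes_clopen (hT : T.IsTree) {ι : ℕ} (hι : R.spike.ncard ≡ ι [MOD n - 1])
    (f : R.graph ↪g T) : Decomposes T n (fun _ => True) ι (R.clopen f) := by
  have := R.finite
  choose a ha using R.exists_adj
  have h : R.clopen f = ⋃ s : R.spike, ball T (f (a s)) (f s) := by
    refine Set.Subset.antisymm ?_ (Set.iUnion_subset fun s =>
      ball_subset_clopen f s.2 (ha s).symm)
    rintro y ⟨b, s, -, hs, hbs, hy⟩
    refine Set.mem_iUnion.2 ⟨⟨s, hs⟩, ?_⟩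
    rwa [eq_of_adj_spike hs (ha s) hbs.symm]
  rw [h]
  refine decomposes_of_finite (fun s => ⟨⟨_, _, f.map_adj_iff.2 (ha s).symm, rfl⟩, trivial⟩)
    (fun s s' hne => disjoint_ball_of_ne hT f s.2 s'.2 (ha s).symm (ha s').symm
      fun h => hne (Subtype.ext h)) ?_
  rwa [Nat.card_coe_set_eq]

/-- Going away from `u` one comes to a last vertex of an embedded thorn: all neighbours of this
vertex in the thorn, with the exception of the one on the way back, are spikes. -/
theorem exists_last_vertex (hT : T.IsTree) (f : R.graph ↪g T) {x : R.Cell} (hx : x ∉ R.spike)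
    {u : X} (hu : T.Adj u (f x)) : ∃ b v, b ∉ R.spike ∧ T.Adj v (f b) ∧
      branch T v (f b) ⊆ branch T u (f x) ∧ ∀ c, R.graph.Adj b c → f c ≠ v → c ∈ R.spike := by
  have := R.finite
  obtain ⟨b, ⟨hb, hbu⟩, hmax⟩ := Set.exists_max_image
    {b : R.Cell | b ∉ R.spike ∧ f b ∈ branch T u (f x)} (fun b => T.dist (f b) u)
    (Set.toFinite _) ⟨x, hx, mem_branch_self _ _⟩
  have hne : u ≠ f b := fun h => not_mem_branch hT hu (h.symm ▸ hbu)
  obtain ⟨v, hv, huv⟩ := exists_mem_branch hT hne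
  have hsub : branch T v (f b) ⊆ branch T u (f x) :=
    branch_subset_of_not_mem hT hu hbu ((not_mem_branch_iff hT hv.symm).2 huv)
  refine ⟨b, v, hb, hv.symm, hsub, fun c hbc hcv => ?_⟩
  by_contra hc
  have hfbc : T.Adj (f b) (f c) := f.map_adj_iff.2 hbc
  have h1 : f c ∈ branch T v (f b) := by
    by_contra h
    exact hcv (branch_cross hT hv.symm (mem_branch_self _ _) hfbc h).2
  have h2 : u ∈ branch T (f c) (f b) := branch_subset_branch hT hfbc.symm hv hcv.symm huv
  have h3 := hmax c ⟨hc, hsub h1⟩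
  have h4 := dist_eq_of_mem_branch hT hfbc.symm h2
  omega

/-- If all vertices of an embedded thorn are on one side of an edge, then the ball on the other
side is contained in the clopen set of the thorn or disjoint from it. -/
theorem ball_subset_or_disjoint (hT : T.IsTree) (f : R.graph ↪g T) {p q : X} (hpq : T.Adj p q)
    (h : ∀ a, a ∉ R.spike → f a ∈ branch T p q) :
    ball T q p ⊆ R.clopen f ∨ Disjoint (ball T q p) (R.clopen f) := by
  have hp := not_mem_branch hT hpq
  by_cases hpf : p ∈ Set.range f
  · obtain ⟨s, rfl⟩ := hpf
    have hs : s ∈ R.spike := by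
      by_contra hs
      exact hp (h s hs)
    obtain ⟨a, ha⟩ := R.exists_adj s
    have := branch_cross hT hpq (h a (not_spike_of_adj hs ha)) (f.map_adj_iff.2 ha.symm) hp
    rw [← this.1]
    exact .inl (ball_subset_clopen f hs ha.symm)
  · obtain ⟨a₀, ha₀⟩ := R.exists_not_spike
    have hall := mem_branch_of_connected hT R.isTree.connected.preconnected f.toHom hpq
      (h a₀ ha₀) fun a ha => hpf ⟨a, ha⟩
    by_cases hd : Disjoint (ball T q p) (R.clopen f)
    · exact .inr hd
    obtain ⟨y, hy, a, s, ha, hs, has, hy'⟩ := Set.not_disjoint_iff.1 hd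
    have hfs : T.Adj (f a) (f s) := f.map_adj_iff.2 has
    refine .inl ((ball_mono ?_).trans (ball_subset_clopen f hs has))
    refine branch_subset_of_not_mem hT hfs ?_ ((not_mem_branch_iff hT hpq.symm).2 (hall a))
    by_contra hps
    rw [not_mem_branch_iff hT hfs] at hps
    have := ball_mono (branch_subset_of_not_mem hT hfs.symm hps
      ((not_mem_branch_iff hT hpq.symm).2 (hall s))) hy
    rw [← compl_ball hT hfs] at this
    exact this hy'

/-- The vertices `v` such that, for each edge `uv`, the ball of the branch that contains `v` meets
both `Ω` and its complement. For the clopen set of a reduced thorn with at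
least three cells these are the vertices of the thorn. -/
def core (T : SimpleGraph X) (Ω : Set (Boundary T)) : Set X :=
  {v | ∀ u, T.Adj u v → (ball T u v ∩ Ω).Nonempty ∧ (ball T u v \ Ω).Nonempty}

theorem core_clopen_subset (hT : T.IsTree) (f : R.graph ↪g T) :
    core T (R.clopen f) ⊆ f '' R.spikeᶜ := by
  intro v hv
  by_contra hvf
  obtain ⟨u, hvu, hu⟩ : ∃ u, T.Adj v u ∧ ∀ a, a ∉ R.spike → f a ∈ branch T v u := by
    by_cases hr : v ∈ Set.range f
    · obtain ⟨s, rfl⟩ := hr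
      have hs : s ∈ R.spike := by
        by_contra hs
        exact hvf ⟨s, hs, rfl⟩
      obtain ⟨a, ha⟩ := R.exists_adj s
      exact ⟨f a, f.map_adj_iff.2 ha, fun b hb =>
        mem_branch_of_ne hT f hs ha fun h => hb (h ▸ hs)⟩
    · obtain ⟨a₀, ha₀⟩ := R.exists_not_spike
      obtain ⟨u, hu, hau⟩ := exists_mem_branch hT
        (show f a₀ ≠ v from fun h => hr ⟨a₀, h⟩)
      exact ⟨u, hu, fun a _ => mem_branch_of_connected hT R.isTree.connected.preconnected
        f.toHom hu hau (fun a ha => hr ⟨a, ha⟩) a⟩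
  obtain ⟨⟨y, hy, hy'⟩, ⟨z, hz, hz'⟩⟩ := hv u hvu.symm
  rcases ball_subset_or_disjoint hT f hvu hu with h | h
  · exact hz' (h hz)
  · exact Set.disjoint_left.1 h hy hy'

theorem core_clopen_eq (hR : IsRegularTree T n) (hred : R.IsReduced)
    (hbig : 3 ≤ Nat.card R.Cell) (f : R.graph ↪g T) :
    core T (R.clopen f) = f '' R.spikeᶜ := by
  have := R.finite
  have hT := hR.isTree
  refine Set.Subset.antisymm (core_clopen_subset hT f) ?_
  -- At the last vertex `b` in the direction of the ball there is a spike, whose ball is in the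
  -- clopen set, and, since there are less than `n` spikes, an edge outside the thorn.
  rintro _ ⟨x, hx, rfl⟩ u hu
  obtain ⟨b, v, hb, hv, hsub, hc⟩ := exists_last_vertex hT f hx hu
  constructor
  · obtain ⟨c, hbc, hcv⟩ : ∃ c, R.graph.Adj b c ∧ f c ≠ v := by
      by_cases hr : ∃ d, f d = v
      · obtain ⟨d, rfl⟩ := hr
        obtain ⟨c, hbc, hcd⟩ := exists_adj_ne hbig hb d
        exact ⟨c, hbc, fun h => hcd (f.injective h)⟩
      · obtain ⟨c, hbc⟩ := R.exists_adj b
        exact ⟨c, hbc, fun h => hr ⟨c, h⟩⟩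
    have hfbc : T.Adj (f b) (f c) := f.map_adj_iff.2 hbc
    obtain ⟨y, hy⟩ := hR.ball_nonempty hfbc
    exact ⟨y, ball_mono hsub (ball_child_subset hT hv hfbc hcv hy),
      ball_subset_clopen f (hc c hbc hcv) hbc hy⟩
  · obtain ⟨w, ⟨hw, hwv⟩, hwf⟩ : ∃ w ∈ {w | T.Adj (f b) w ∧ w ≠ v},
        w ∉ f '' {s | s ∈ R.spike ∧ R.graph.Adj b s} := by
      by_contra! hcon
      have h1 := Set.ncard_le_ncard (s := {w | T.Adj (f b) w ∧ w ≠ v}) hcon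
      rw [hR.children_ncard hv] at h1
      have h2 := Set.ncard_image_le (f := f) (s := {s | s ∈ R.spike ∧ R.graph.Adj b s})
      have h3 := hred b hb
      omega
    obtain ⟨y, hy⟩ := hR.ball_nonempty hw
    refine ⟨y, ball_mono hsub (ball_child_subset hT hv hw hwv hy), ?_⟩
    refine Set.disjoint_left.1 (disjoint_ball_clopen hT f hb hw ?_) hy
    rintro ⟨c, rfl⟩
    have hbc := f.map_adj_iff.1 hw
    exact hwf ⟨c, ⟨hc c hbc hwv, hbc⟩, rfl⟩

theorem core_clopen_nonempty (hR : IsRegularTree T n) (hred : R.IsReduced)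
    (hbig : 3 ≤ Nat.card R.Cell) (f : R.graph ↪g T) : (core T (R.clopen f)).Nonempty := by
  obtain ⟨a, ha⟩ := R.exists_not_spike
  rw [core_clopen_eq hR hred hbig f]
  exact ⟨f a, a, ha, rfl⟩

variable (R) in
/-- A thorn with less than three cells has exactly one vertex and exactly one spike. -/
theorem exists_cells_of_not_three_le (hsmall : ¬ 3 ≤ Nat.card R.Cell) :
    ∃ a s, a ∉ R.spike ∧ s ∈ R.spike ∧ R.graph.Adj a s ∧ ∀ c, c = a ∨ c = s := by
  have := R.finite
  obtain ⟨h2, h1⟩ := R.spike_spec.resolve_left fun h => hsmall h.1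
  obtain ⟨s, hs⟩ := Set.ncard_eq_one.1 h1
  have hss : s ∈ R.spike := by simp [hs]
  obtain ⟨a, ha⟩ := R.exists_adj s
  refine ⟨a, s, not_spike_of_adj hss ha, hss, ha.symm, fun c => ?_⟩
  have h : ({a, s} : Set R.Cell) = Set.univ := (Set.eq_univ_iff_ncard _).2 (by
    rw [Set.ncard_pair ha.ne', h2])
  have hc : c ∈ ({a, s} : Set R.Cell) := h ▸ Set.mem_univ c
  exact hc

theorem clopen_eq_ball (f : R.graph ↪g T) {a s : R.Cell} (hs : s ∈ R.spike)
    (has : R.graph.Adj a s) (hc : ∀ c, c = a ∨ c = s) :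
    R.clopen f = ball T (f a) (f s) := by
  refine Set.Subset.antisymm ?_ (ball_subset_clopen f hs has)
  rintro y ⟨b, t, hb, ht, hbt, hy⟩
  have ha := not_spike_of_adj hs has.symm
  have ht' : t = s := (hc t).resolve_left fun h => ha (h ▸ ht)
  have hb' : b = a := (hc b).resolve_right fun h => hb (h ▸ hs)
  rwa [ht', hb'] at hy

theorem core_clopen_eq_empty (hT : T.IsTree) (hsmall : ¬ 3 ≤ Nat.card R.Cell)
    (f : R.graph ↪g T) : core T (R.clopen f) = ∅ := by
  obtain ⟨a, s, ha, hs, has, hc⟩ := R.exists_cells_of_not_three_le hsmall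
  rw [Set.eq_empty_iff_forall_notMem]
  intro v hv
  obtain ⟨b, hb, rfl⟩ := core_clopen_subset hT f hv
  obtain rfl : b = a := (hc b).resolve_right fun h => hb (h ▸ hs)
  have hfs : T.Adj (f b) (f s) := f.map_adj_iff.2 has
  obtain ⟨⟨y, hy, hy'⟩, -⟩ := hv (f s) hfs.symm
  rw [← compl_ball hT hfs] at hy
  rw [clopen_eq_ball f hs has hc] at hy'
  exact hy hy'

/-- Embedded thorns with the same cells and the same spikes are isomorphic. -/
theorem isomorphic_of_range {R R' : Thorn n} (f : R.graph ↪g T) (f' : R'.graph ↪g T)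
    (h : ∀ c, ∃ c', f' c' = f c ∧ (c' ∈ R'.spike ↔ c ∈ R.spike))
    (h' : ∀ c', ∃ c, f c = f' c') : R.Isomorphic R' := by
  choose g hg hs using h
  have hbij : Function.Bijective g := by
    constructor
    · intro x y hxy
      exact f.injective (by rw [← hg, ← hg, hxy])
    · intro c'
      obtain ⟨c, hc⟩ := h' c'
      exact ⟨c, f'.injective (by rw [hg, hc])⟩
  refine ⟨⟨Equiv.ofBijective g hbij, ?_⟩, hs⟩
  intro x y
  change R'.graph.Adj (g x) (g y) ↔ _
  rw [← f'.map_adj_iff, hg, hg, f.map_adj_iff]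

/-- The clopen set of a reduced thorn determines this thorn. -/
theorem isomorphic_of_clopen_eq (hR : IsRegularTree T n) {R R' : Thorn n} (hred : R.IsReduced)
    (hred' : R'.IsReduced) (f : R.graph ↪g T) (f' : R'.graph ↪g T)
    (h : R.clopen f = R'.clopen f') : R.Isomorphic R' := by
  have hT := hR.isTree
  by_cases hbig : 3 ≤ Nat.card R.Cell <;> by_cases hbig' : 3 ≤ Nat.card R'.Cell
  · -- The vertices are the core, and the spikes are the ends of the edges that start in the core
    -- and cut off balls contained in the clopen set.
    have key : ∀ {R R' : Thorn n}, R.IsReduced → R'.IsReduced → 3 ≤ Nat.card R.Cell →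
        3 ≤ Nat.card R'.Cell → ∀ (f : R.graph ↪g T) (f' : R'.graph ↪g T),
        R.clopen f = R'.clopen f' → ∀ c, ∃ c', f' c' = f c ∧ (c' ∈ R'.spike ↔ c ∈ R.spike) := by
      intro R R' hred hred' hbig hbig' f f' h
      have hv : f '' R.spikeᶜ = f' '' R'.spikeᶜ := by
        rw [← core_clopen_eq hR hred hbig f, ← core_clopen_eq hR hred' hbig' f', h]
      have hvert : ∀ c, c ∉ R.spike → ∃ c', f' c' = f c ∧ c' ∉ R'.spike := by
        intro c hc
        have : f c ∈ f' '' R'.spikeᶜ := hv ▸ ⟨c, hc, rfl⟩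
        obtain ⟨c', h1, h2⟩ := this
        exact ⟨c', h2, h1⟩
      intro c
      by_cases hc : c ∈ R.spike
      · obtain ⟨a, ha⟩ := R.exists_adj c
        obtain ⟨a', ha', has'⟩ := hvert a (not_spike_of_adj hc ha)
        have hadj : T.Adj (f a) (f c) := f.map_adj_iff.2 ha.symm
        have hr : f c ∈ Set.range f' := by
          by_contra hr
          obtain ⟨y, hy⟩ := hR.ball_nonempty hadj
          have h1 := ball_subset_clopen f hc ha.symm hy
          rw [h] at h1
          rw [← ha'] at hadj hy
          exact Set.disjoint_left.1 (disjoint_ball_clopen hT f' has' hadj hr) hy h1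
        obtain ⟨c', hc'⟩ := hr
        refine ⟨c', hc', fun _ => hc, fun _ => ?_⟩
        by_contra hcs
        have : f c ∈ f '' R.spikeᶜ := hv ▸ ⟨c', hcs, hc'⟩
        obtain ⟨d, hd, hdc⟩ := this
        exact hd (f.injective hdc ▸ hc)
      · obtain ⟨c', h1, h2⟩ := hvert c hc
        exact ⟨c', h1, fun h => absurd h h2, fun h => absurd h hc⟩
    refine isomorphic_of_range f f' (key hred hred' hbig hbig' f f' h) fun c' => ?_
    obtain ⟨c, hc, -⟩ := key hred' hred hbig' hbig f' f h.symm c'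
    exact ⟨c, hc⟩
  · have := core_clopen_nonempty hR hred hbig f
    rw [h, core_clopen_eq_empty hT hbig' f'] at this
    exact absurd this Set.not_nonempty_empty
  · have := core_clopen_nonempty hR hred' hbig' f'
    rw [← h, core_clopen_eq_empty hT hbig f] at this
    exact absurd this Set.not_nonempty_empty
  · -- Both thorns are edges; an automorphism moves one to the other.
    obtain ⟨a, s, ha, hs, has, hc⟩ := R.exists_cells_of_not_three_le hbig
    obtain ⟨a', s', ha', hs', has', hc'⟩ := R'.exists_cells_of_not_three_le hbig'
    obtain ⟨r, h1, h2⟩ := hR.exists_edge_iso (f.map_adj_iff.2 has) (f'.map_adj_iff.2 has')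
    refine isomorphic_of_range (f.trans r.toEmbedding) f' ?_ ?_
    · intro c
      rcases hc c with rfl | rfl
      · exact ⟨a', h1.symm, fun h => absurd h ha', fun h => absurd h ha⟩
      · exact ⟨s', h2.symm, fun _ => hs, fun _ => hs'⟩
    · intro c'
      rcases hc' c' with rfl | rfl
      · exact ⟨a, h1⟩
      · exact ⟨s, h2⟩

variable (R) in
theorem exists_embedding (hR : IsRegularTree T n) : Nonempty (R.graph ↪g T) := by
  have := R.finite
  obtain ⟨c⟩ := R.isTree.connected.nonempty
  obtain ⟨o⟩ := hR.isTree.connected.nonempty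
  obtain ⟨f, -⟩ := exists_embedding_extending R.isTree hR.isTree (fun v => Set.toFinite _)
    (fun v w => by rw [hR.valence]; exact R.valence_le v) (Set.singleton_nonempty c)
    (convex_singleton c) (fun _ => o) (by
      refine ⟨?_, ?_⟩
      · rintro x rfl y rfl h
        exact absurd h (R.graph.loopless.irrefl _)
      · rintro v _ x ⟨-, rfl⟩ y ⟨-, rfl⟩ _
        rfl)
  exact ⟨f⟩

theorem clopen_trans (f : R.graph ↪g T) (r : T ≃g T) :
    R.clopen (f.trans r.toEmbedding) = autHomeo T r '' R.clopen f := by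
  ext y
  constructor
  · rintro ⟨a, s, ha, hs, has, hy⟩
    have hy' : y ∈ ball T (r (f a)) (r (f s)) := hy
    rw [← autHomeo_image_ball] at hy'
    exact Set.image_mono (ball_subset_clopen f hs has) hy'
  · rintro ⟨x, ⟨a, s, ha, hs, has, hx⟩, rfl⟩
    exact ⟨a, s, ha, hs, has, autMap_mem_ball r hx⟩

theorem clopens_eq_autOrbit (hR : IsRegularTree T n) (f : R.graph ↪g T) :
    R.clopens T = autOrbit T (R.clopen f) := by
  ext Ω
  constructor
  · rintro ⟨f', rfl⟩
    obtain ⟨r, hr⟩ := exists_iso_comp_eq hR.isTree (Nat.succ_ne_zero n) hR.valence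
      R.isTree.connected f f'
    refine ⟨r, ?_⟩
    rw [← clopen_trans, show f.trans r.toEmbedding = f' from RelEmbedding.ext hr]
  · rintro ⟨r, rfl⟩
    exact ⟨_, (clopen_trans f r).symm⟩

theorem autHomeo_image_mem_clopens (r : T ≃g T) {Ω : Set (Boundary T)} (h : Ω ∈ R.clopens T) :
    autHomeo T r '' Ω ∈ R.clopens T := by
  obtain ⟨f, rfl⟩ := h
  exact ⟨_, (clopen_trans f r).symm⟩

theorem clopen_mem_clopRes (hR : IsRegularTree T n) (hred : R.IsReduced) {ι : ℕ}
    (hι : R.spike.ncard ≡ ι [MOD n - 1]) (f : R.graph ↪g T) :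
    R.clopen f ∈ ClopRes T n ι := by
  by_cases hbig : 3 ≤ Nat.card R.Cell
  · obtain ⟨v, hv⟩ := core_clopen_nonempty hR hred hbig f
    obtain ⟨u, hu⟩ := hR.exists_adj v
    obtain ⟨⟨y, -, hy⟩, ⟨z, -, hz⟩⟩ := hv u hu.symm
    exact (decomposes_clopen hR.isTree hι f).mem_clopRes hR.isTree ⟨y, hy⟩
      fun h => hz (h ▸ Set.mem_univ z)
  · obtain ⟨a, s, ha, hs, has, hc⟩ := R.exists_cells_of_not_three_le hbig
    have hfs : T.Adj (f a) (f s) := f.map_adj_iff.2 has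
    refine (decomposes_clopen hR.isTree hι f).mem_clopRes hR.isTree ?_ ?_
    · rw [clopen_eq_ball f hs has hc]
      exact hR.ball_nonempty hfs
    · rw [clopen_eq_ball f hs has hc]
      exact hR.ball_ne_univ hfs

end Thorn

/-! ### The partition of the set of clopen sets -/

section Partition

variable {X : Type*} {T : SimpleGraph X} {n : ℕ}

theorem Way.apply_ne (hT : T.IsTree) (a : Way T) {i j : ℕ} (h : i < j) : a.1 i ≠ a.1 j :=
  fun he => not_mem_branch hT (a.2.1 i) (he.symm ▸ a.mem_branch hT h)

/-- A union of two parts of balls cut off at the ends of a long path has a large core: it contains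
all inner vertices of the path. -/
theorem IsRegularTree.exists_large_core (hR : IsRegularTree T n) (ι K : ℕ) :
    ∃ Ω ∈ ClopRes T n ι, ∃ S : Set X, S.ncard = K ∧ S ⊆ Thorn.core T Ω := by
  have hT := hR.isTree
  obtain ⟨o⟩ := hT.connected.nonempty
  obtain ⟨o', ho⟩ := hR.exists_adj o
  obtain ⟨a, -, -⟩ := hR.exists_way_from ho
  obtain ⟨y, hy⟩ := hR.ball_nonempty (a.2.1 0).symm
  obtain ⟨z, hz⟩ := hR.ball_nonempty (a.2.1 (K + 1))
  obtain ⟨Ω₁, hyΩ, hΩ₁, ⟨y', hy', hyΩ'⟩, hd₁⟩ :=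
    hR.exists_decomposes_subset_ball (a.2.1 0).symm hy ι
  obtain ⟨Ω₂, hzΩ, hΩ₂, ⟨z', hz', hzΩ'⟩, hd₂⟩ :=
    hR.exists_decomposes_subset_ball (a.2.1 (K + 1)) hz 0
  have hdis : ∀ x, x ∈ ball T (a.1 (0 + 1)) (a.1 0) →
      x ∉ ball T (a.1 (K + 1)) (a.1 (K + 1 + 1)) := by
    intro x hx hx'
    have := ball_mono (a.branch_antitone hT (Nat.zero_le (K + 1))) hx'
    rw [← compl_ball hT (a.2.1 0)] at hx
    exact hx this
  have hyn : y' ∉ Ω₁ ∪ Ω₂ := fun h => h.elim hyΩ' fun h => hdis y' hy' (hΩ₂ h)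
  have hzn : z' ∉ Ω₁ ∪ Ω₂ := fun h => h.elim (fun h => hdis z' (hΩ₁ h) hz') hzΩ'
  refine ⟨Ω₁ ∪ Ω₂, (hd₁.union hd₂ ?_ (by simp [Nat.ModEq])).mem_clopRes hT ⟨y, .inl hyΩ⟩
    (fun h => hyn (h ▸ Set.mem_univ y')), a.1 '' (Set.Ioo 0 (K + 1)), ?_, ?_⟩
  · exact Set.disjoint_left.2 fun x h1 h2 => hdis x (hΩ₁ h1) (hΩ₂ h2)
  · rw [Set.InjOn.ncard_image, Set.ncard_eq_toFinset_card']
    · simp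
    · intro i _ j _ hij
      rcases lt_trichotomy i j with h | h | h
      · exact absurd hij (a.apply_ne hT h)
      · exact h
      · exact absurd hij.symm (a.apply_ne hT h)
  · rintro _ ⟨i, ⟨hi, hiK⟩, rfl⟩ u hu
    by_cases h : u = a.1 (i + 1)
    · subst h
      have hsub := ball_mono (a.branch_monotone hT (Nat.zero_le i))
      exact ⟨⟨y, hsub hy, .inl hyΩ⟩, ⟨y', hsub hy', hyn⟩⟩
    · have hsub := (ball_mono (a.branch_antitone hT hiK.le)).trans
        (ball_child_subset hT hu (a.2.1 i) (Ne.symm h))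
      exact ⟨⟨z, hsub hz, .inr hzΩ⟩, ⟨z', hsub hz', hzn⟩⟩

/-- Some clopen set of the residue class does not come from any of finitely many given thorns. -/
theorem IsRegularTree.exists_not_mem_clopens (hR : IsRegularTree T n) (ι : ℕ) {N : ℕ}
    (R : Fin N → Thorn n) : ∃ Ω ∈ ClopRes T n ι, ∀ j, Ω ∉ (R j).clopens T := by
  obtain ⟨Ω, hΩ, S, hS, hSΩ⟩ := hR.exists_large_core ι (∑ j, Nat.card (R j).Cell + 1)
  refine ⟨Ω, hΩ, fun j => ?_⟩
  rintro ⟨f, rfl⟩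
  have := (R j).finite
  have h1 := Set.ncard_le_ncard (hSΩ.trans (Thorn.core_clopen_subset hR.isTree f))
  have h2 := Set.ncard_image_le (f := f) (s := (R j).spikeᶜ)
  have h3 := Set.ncard_le_card ((R j).spikeᶜ)
  have h4 := Finset.single_le_sum (f := fun j => Nat.card (R j).Cell) (s := Finset.univ)
    (fun _ _ => Nat.zero_le _) (Finset.mem_univ j)
  omega

theorem disjoint_clopens (hR : IsRegularTree T n) {R R' : Thorn n} (hred : R.IsReduced)
    (hred' : R'.IsReduced) (h : ¬ R.Isomorphic R') :
    Disjoint (R.clopens T) (R'.clopens T) := by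
  rw [Set.disjoint_left]
  rintro Ω ⟨f, rfl⟩ ⟨f', h'⟩
  exact h (Thorn.isomorphic_of_clopen_eq hR hred hred' f f' h')

theorem pieceOf_eq_some_iff {ι N : ℕ} {R : Fin N → Thorn n}
    (hd : ∀ i j, i ≠ j → Disjoint ((R i).clopens T) ((R j).clopens T))
    (Ω : ClopRes T n ι) (j : Fin N) :
    pieceOf T ι R Ω = some j ↔ (Ω : Set (Boundary T)) ∈ (R j).clopens T := by
  classical
  unfold pieceOf
  constructor
  · intro h
    split_ifs at h with h'
    rw [← Option.some.inj h]
    exact h'.choose_spec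
  · intro h
    have h' : ∃ j, (Ω : Set (Boundary T)) ∈ (R j).clopens T := ⟨j, h⟩
    rw [dif_pos h']
    congr 1
    by_contra hne
    exact Set.disjoint_left.1 (hd _ _ hne) h'.choose_spec h

theorem pieceOf_eq_of_iff {ι N : ℕ} {R : Fin N → Thorn n}
    (hd : ∀ i j, i ≠ j → Disjoint ((R i).clopens T) ((R j).clopens T)) {Ω Ω' : ClopRes T n ι}
    (h : ∀ j, (Ω : Set (Boundary T)) ∈ (R j).clopens T ↔
      (Ω' : Set (Boundary T)) ∈ (R j).clopens T) : pieceOf T ι R Ω = pieceOf T ι R Ω' := by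
  refine Option.ext fun j => ?_
  have h1 := pieceOf_eq_some_iff hd Ω j
  have h2 := pieceOf_eq_some_iff hd Ω' j
  exact h1.trans ((h j).trans h2.symm)

theorem mem_clopens_image_iff {R : Thorn n} (r : T ≃g T) (Ω : Set (Boundary T)) :
    autHomeo T r '' Ω ∈ R.clopens T ↔ Ω ∈ R.clopens T := by
  refine ⟨fun h => ?_, Thorn.autHomeo_image_mem_clopens r⟩
  have h1 := Thorn.autHomeo_image_mem_clopens r⁻¹ h
  rw [map_inv, ← Set.image_comp] at h1
  have h2 : ((autHomeo T r)⁻¹ : Boundary T ≃ₜ Boundary T) ∘ autHomeo T r = id :=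
    funext fun z => (autHomeo T r).symm_apply_apply z
  rwa [h2, Set.image_id] at h1

theorem pieceOf_autToHier (hR : IsRegularTree T n) {ι N : ℕ} {R : Fin N → Thorn n}
    (hd : ∀ i j, i ≠ j → Disjoint ((R i).clopens T) ((R j).clopens T)) (r : T ≃g T)
    (Ω : ClopRes T n ι) :
    pieceOf T ι R (hR.clopPerm ι (autToHier T r) Ω) = pieceOf T ι R Ω :=
  pieceOf_eq_of_iff hd fun _ => mem_clopens_image_iff r _

theorem IsRegularTree.infinite_range_clopPerm (hR : IsRegularTree T n) {ι : ℕ}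
    (Ω : ClopRes T n ι) :
    (Set.range fun r : T ≃g T => hR.clopPerm ι (autToHier T r) Ω).Infinite := by
  intro hfin
  refine hR.autOrbit_infinite Ω.2.1.2 Ω.2.1.1 Ω.2.2.1 Ω.2.2.2.1
    ((hfin.image Subtype.val).subset ?_)
  rintro _ ⟨r, rfl⟩
  exact ⟨_, ⟨r, rfl⟩, rfl⟩

theorem pieceOf_infinite (hR : IsRegularTree T n) {ι N : ℕ} {R : Fin N → Thorn n}
    (hred : ∀ j, (R j).IsReduced) (hres : ∀ j, (R j).spike.ncard ≡ ι [MOD n - 1])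
    (hd : ∀ i j, i ≠ j → Disjoint ((R i).clopens T) ((R j).clopens T)) (p : Option (Fin N)) :
    {Ω : ClopRes T n ι | pieceOf T ι R Ω = p}.Infinite := by
  obtain ⟨Ω, rfl⟩ : ∃ Ω, pieceOf T ι R Ω = p := by
    cases p with
    | none =>
      obtain ⟨Ω, hΩ, h⟩ := hR.exists_not_mem_clopens ι R
      refine ⟨⟨Ω, hΩ⟩, Option.eq_none_iff_forall_ne_some.2 fun j hj => h j ?_⟩
      exact (pieceOf_eq_some_iff hd _ j).1 hj
    | some j =>
      obtain ⟨f⟩ := (R j).exists_embedding hR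
      exact ⟨⟨_, Thorn.clopen_mem_clopRes hR (hred j) (hres j) f⟩,
        (pieceOf_eq_some_iff hd _ j).2 ⟨f, rfl⟩⟩
  refine (hR.infinite_range_clopPerm Ω).mono ?_
  rintro _ ⟨r, rfl⟩
  exact pieceOf_autToHier hR hd r Ω

end Partition

/-! ### Spheromorphisms preserve almost all clopen sets of a thorn -/

section FiniteExceptions

variable {X : Type*} {T : SimpleGraph X} {n : ℕ}

/-- Two homeomorphisms that coincide on `B` act in the same way on a set that lies in `B` or
contains the complement of `B`. -/
theorem image_eq_of_eqOn {g h : Boundary T ≃ₜ Boundary T} {B Ω : Set (Boundary T)}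
    (he : Set.EqOn g h B) (hB : Bᶜ ⊆ Ω ∨ Disjoint Bᶜ Ω) : g '' Ω = h '' Ω := by
  rcases hB with hB | hB
  · have hΩ : Ωᶜ ⊆ B := Set.compl_subset_comm.1 hB
    have h1 := (he.mono hΩ).image_eq
    rwa [Set.image_compl_eq g.bijective, Set.image_compl_eq h.bijective, compl_inj_iff] at h1
  · exact (he.mono (Set.disjoint_compl_left_iff_subset.1 hB)).image_eq

/-- Embeddings of a finite connected graph that meet a given finite set of vertices are finite in
number. -/
theorem finite_embeddings (hR : IsRegularTree T n) (R : Thorn n) {F : Set X} (hF : F.Finite) :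
    {f : R.graph ↪g T | ∃ c, f c ∈ F}.Finite := by
  have := R.finite
  obtain ⟨D, hD⟩ := (Set.finite_range fun x : R.Cell × R.Cell => R.graph.dist x.1 x.2).bddAbove
  let S : Set X := ⋃ v ∈ F, {x | T.dist v x ≤ D}
  have hS : S.Finite := hF.biUnion fun v _ =>
    finite_setOf_dist_le hR.isTree hR.finite_neighborSet v D
  refine Set.Finite.of_finite_image (f := fun f : R.graph ↪g T => (f : R.Cell → X)) ?_
    (DFunLike.coe_injective.injOn)
  refine (Set.Finite.pi' fun _ : R.Cell => hS).subset ?_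
  rintro _ ⟨f, ⟨c, hc⟩, rfl⟩ d
  refine Set.mem_biUnion hc ?_
  obtain ⟨w, hw⟩ := R.isTree.connected.exists_walk_length_eq_dist c d
  have h1 := SimpleGraph.dist_le (w.map f.toHom)
  rw [SimpleGraph.Walk.length_map, hw] at h1
  exact h1.trans (hD ⟨(c, d), rfl⟩)

/-- An embedded thorn avoiding a suitable finite set of vertices lies in a branch on whose ball the
spheromorphism coincides with an automorphism. -/
theorem exists_finite_avoiding (hR : IsRegularTree T n) (R : Thorn n) (g : Hier T) :
    ∃ F : Set X, F.Finite ∧ ∀ f : R.graph ↪g T, (∀ c, f c ∉ F) → ∃ p q, T.Adj p q ∧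
      (∀ c, f c ∈ branch T p q) ∧ ∃ r : T ≃g T, Set.EqOn g.1 (autHomeo T r) (ball T p q) := by
  have hT := hR.isTree
  obtain ⟨c₀⟩ := R.isTree.connected.nonempty
  let Good : (R.graph ↪g T) → Prop := fun f => ∃ p q, T.Adj p q ∧
      (∀ c, f c ∈ branch T p q) ∧ ∃ r : T ≃g T, Set.EqOn g.1 (autHomeo T r) (ball T p q)
  -- The assertion for the embeddings in one branch is proved by bar induction on the branch.
  let Q : X → X → Prop := fun p q => ∃ F : Set X, F.Finite ∧ ∀ f : R.graph ↪g T,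
    (∀ c, f c ∈ branch T p q) → (∀ c, f c ∉ F) → Good f
  have hbr : ∀ (f : R.graph ↪g T) {q w}, T.Adj q w → f c₀ ∈ branch T q w → (∀ c, f c ≠ q) →
      ∀ c, f c ∈ branch T q w := fun f _ _ hqw h0 hq =>
    mem_branch_of_connected hT R.isTree.connected.preconnected f.toHom hqw h0 hq
  have hQ : ∀ {p q}, T.Adj p q → Q p q := by
    intro p q hpq
    refine edge_induction (T := T) ?_ ?_ hpq
    · intro a
      obtain ⟨i, r, hr⟩ := exists_ball_eqOn hT g a
      exact ⟨i, ∅, Set.finite_empty, fun f hf _ => ⟨_, _, a.2.1 i, hf, r, hr⟩⟩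
    · intro p q hpq ih
      choose! F hF hFQ using ih
      refine ⟨{q} ∪ ⋃ w ∈ {w | T.Adj q w ∧ w ≠ p}, F w, (Set.finite_singleton q).union
        ((hR.children_finite p q).biUnion fun w hw => hF w hw.1 hw.2), fun f hf hav => ?_⟩
      have hq : ∀ c, f c ≠ q := fun c h => hav c (.inl h)
      obtain ⟨w, hw, hwp, hcw⟩ := exists_mem_branch_child hT hpq (hf c₀) (hq c₀)
      exact hFQ w hw hwp f (hbr f hw hcw hq) fun c h =>
        hav c (.inr (Set.mem_biUnion (show w ∈ {w | T.Adj q w ∧ w ≠ p} from ⟨hw, hwp⟩) h))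
  obtain ⟨o⟩ := hT.connected.nonempty
  choose! F hF hFQ using fun w (hw : T.Adj o w) => hQ hw
  refine ⟨{o} ∪ ⋃ w ∈ T.neighborSet o, F w, (Set.finite_singleton o).union
    ((hR.finite_neighborSet o).biUnion fun w hw => hF w hw), fun f hav => ?_⟩
  have ho : ∀ c, f c ≠ o := fun c h => hav c (.inl h)
  obtain ⟨w, hw, hcw⟩ := exists_mem_branch hT (ho c₀)
  exact hFQ w hw f (hbr f hw hcw ho) fun c h => hav c (.inr (Set.mem_biUnion hw h))

/-- A spheromorphism leaves all but finitely many clopen sets of a thorn in the orbit of this thorn,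
namely those of the embeddings far away from a certain finite set of vertices. -/
theorem finite_exceptions (hR : IsRegularTree T n) (R : Thorn n) (g : Hier T) :
    {Ω | Ω ∈ R.clopens T ∧ g.1 '' Ω ∉ R.clopens T}.Finite := by
  obtain ⟨F, hF, hav⟩ := exists_finite_avoiding hR R g
  refine ((finite_embeddings hR R hF).image fun f => R.clopen f).subset ?_
  rintro _ ⟨⟨f, rfl⟩, hg⟩
  refine ⟨f, ?_, rfl⟩
  by_contra hc
  obtain ⟨p, q, hpq, hf, r, hr⟩ := hav f fun c h => hc ⟨c, h⟩
  refine hg ?_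
  have h := Thorn.ball_subset_or_disjoint hR.isTree f hpq fun a _ => hf a
  rw [← compl_ball hR.isTree hpq] at h
  rw [image_eq_of_eqOn hr h]
  exact Thorn.autHomeo_image_mem_clopens r ⟨f, rfl⟩

theorem clopPerm_mem_bigG (hR : IsRegularTree T n) {ι N : ℕ} {R : Fin N → Thorn n}
    (hd : ∀ i j, i ≠ j → Disjoint ((R i).clopens T) ((R j).clopens T)) (g : Hier T) :
    hR.clopPerm ι g ∈ bigG (pieceOf T ι R) := by
  have hsome : ∀ (g : Hier T) (j : Fin N), {Ω : ClopRes T n ι | pieceOf T ι R Ω = some j ∧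
      pieceOf T ι R (hR.clopPerm ι g Ω) ≠ some j}.Finite := by
    intro g j
    refine Set.Finite.of_finite_image (f := Subtype.val)
      ((finite_exceptions hR (R j) g).subset ?_) Subtype.val_injective.injOn
    rintro _ ⟨Ω, ⟨h1, h2⟩, rfl⟩
    exact ⟨(pieceOf_eq_some_iff hd Ω j).1 h1, fun h => h2 ((pieceOf_eq_some_iff hd _ j).2 h)⟩
  intro p
  cases p with
  | some j => exact hsome g j
  | none =>
    -- Sets that leave the residual piece arrive in the piece of a thorn, which they leave under
    -- the inverse map.
    refine ((Set.finite_iUnion fun j => hsome g⁻¹ j).image (hR.clopPerm ι g⁻¹)).subset ?_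
    rintro Ω ⟨h1, h2⟩
    obtain ⟨j, hj⟩ := Option.ne_none_iff_exists'.1 h2
    have hinv : hR.clopPerm ι g⁻¹ (hR.clopPerm ι g Ω) = Ω := by
      rw [← Equiv.Perm.mul_apply, ← map_mul, inv_mul_cancel, map_one]
      rfl
    exact ⟨hR.clopPerm ι g Ω, Set.mem_iUnion.2 ⟨j, hj, by rw [hinv, h1]; simp⟩, hinv⟩

/-- The homomorphism from the group of spheromorphisms to the Young-type permutation group. -/
noncomputable def hierToBigG (hR : IsRegularTree T n) (ι : ℕ) {N : ℕ} (R : Fin N → Thorn n)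
    (hd : ∀ i j, i ≠ j → Disjoint ((R i).clopens T) ((R j).clopens T)) :
    Hier T →* bigG (pieceOf T ι R) :=
  (hR.clopPerm ι).codRestrict _ (clopPerm_mem_bigG hR hd)

end FiniteExceptions

/-! ### Fixed vectors in the infinite tensor product -/

section PermDecomp

variable {P V κ : Type*} [NormedAddCommGroup V] [Finite κ] (c : P → κ)
  (e : κ → Metric.sphere (0 : V) 1)

theorem permDecomp_apply (σ : bigG c) (x : Decomp fun α => e (c α)) (α : P) :
    (permDecomp c e σ x).1 (σ.1 α) = x.1 α := by
  change x.1 (σ.1⁻¹ (σ.1 α)) = x.1 α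
  exact congrArg x.1 (σ.1.symm_apply_apply α)

variable {c}

theorem permDecomp_eq_self {k : bigG c} (hk : k ∈ bigK c) (x : Decomp fun α => e (c α))
    (h : ∀ α, x.1 α ≠ e (c α) → k.1 α = α) : permDecomp c e k x = x := by
  refine Subtype.ext (funext fun β => ?_)
  obtain ⟨α, rfl⟩ := k.1.surjective β
  rw [permDecomp_apply]
  by_cases hα : x.1 α = e (c α)
  · by_cases hβ : x.1 (k.1 α) = e (c (k.1 α))
    · rw [hα, hβ, hk α]
    · rw [k.1.injective (h _ hβ)]
  · rw [h α hα]

end PermDecomp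

section TensorLemmas

variable {P V : Type*} [NormedAddCommGroup V] [InnerProductSpace ℂ V]

/-- Decomposable vectors that are different from the distinguished vector at disjoint sets of places
have independent components along the vacuum. -/
theorem inner_tprod_of_disjoint (ξ : P → Metric.sphere (0 : V) 1) (x y : Decomp ξ)
    (h : ∀ α, x.1 α = ξ α ∨ y.1 α = ξ α) :
    inner ℂ (InfTensor.tprod ξ x) (InfTensor.tprod ξ y) =
      inner ℂ (InfTensor.tprod ξ x) (InfTensor.vacuum ξ) *
        inner ℂ (InfTensor.vacuum ξ) (InfTensor.tprod ξ y) := by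
  classical
  let A : Finset P := (x.2.union y.2).toFinset
  have hx : {α | x.1 α ≠ ξ α} ⊆ A := fun α h => by
    rw [Set.Finite.coe_toFinset]; exact Or.inl h
  have hy : {α | y.1 α ≠ ξ α} ⊆ A := fun α h => by
    rw [Set.Finite.coe_toFinset]; exact Or.inr h
  let z : Decomp ξ := ⟨fun α => ξ α, by simp⟩
  have hz : {α | z.1 α ≠ ξ α} ⊆ A := fun α h => absurd rfl h
  have e1 := (InfTensor.inner_tprod ξ x y).trans (decompKernel_eq ξ x y A hx hy)
  have e2 := (InfTensor.inner_tprod ξ x z).trans (decompKernel_eq ξ x z A hx hz)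
  have e3 := (InfTensor.inner_tprod ξ z y).trans (decompKernel_eq ξ z y A hz hy)
  unfold InfTensor.vacuum
  rw [e1, e2, e3, ← Finset.prod_mul_distrib]
  refine Finset.prod_congr rfl fun α _ => ?_
  change _ = inner ℂ (x.1 α) (ξ α : V) * inner ℂ (ξ α : V) (y.1 α)
  rcases h α with h | h
  · rw [h, inner_sphere, one_mul]
  · rw [h, inner_sphere, mul_one]

theorem norm_vacuum (ξ : P → Metric.sphere (0 : V) 1) : ‖InfTensor.vacuum ξ‖ = 1 := by
  have h : inner ℂ (InfTensor.vacuum ξ) (InfTensor.vacuum ξ) = (1 : ℂ) :=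
    (InfTensor.inner_tprod ξ _ _).trans (finprod_eq_one_of_forall_eq_one fun α =>
      inner_sphere (ξ α))
  rw [inner_self_eq_norm_sq_to_K] at h
  have h' : (‖InfTensor.vacuum ξ‖ : ℂ) ^ 2 = 1 := h
  have h2 : ‖InfTensor.vacuum ξ‖ ^ 2 = 1 := by exact_mod_cast h'
  nlinarith [norm_nonneg (InfTensor.vacuum ξ)]

theorem closure_span_tprod (ξ : P → Metric.sphere (0 : V) 1) :
    (Submodule.span ℂ (Set.range (InfTensor.tprod ξ))).topologicalClosure = ⊤ := by
  rw [Submodule.eq_top_iff']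
  intro v
  refine UniformSpace.Completion.induction_on v (Submodule.isClosed_topologicalClosure _) ?_
  intro f
  refine Submodule.le_topologicalClosure _ ?_
  induction f using Finsupp.induction_linear with
  | zero => exact Submodule.zero_mem _
  | add f g hf hg =>
    have := UniformSpace.Completion.coe_add f g
    rw [this]
    exact Submodule.add_mem _ hf hg
  | single x z =>
    have h : (Finsupp.single x z : PreTensor ξ) = z • (show PreTensor ξ from Finsupp.single x 1) :=
      (by simp : (Finsupp.single x z : Decomp ξ →₀ ℂ) = z • Finsupp.single x 1)
    have h' : UniformSpace.Completion.coe' (Finsupp.single x z : PreTensor ξ) =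
        z • InfTensor.tprod ξ x := by
      rw [h]
      exact UniformSpace.Completion.coe_smul z _
    rw [h']
    exact Submodule.smul_mem _ _ (Submodule.subset_span ⟨x, rfl⟩)

/-- A vector can be approximated by a vector that depends only on finitely many places. -/
theorem exists_near_finite (ξ : P → Metric.sphere (0 : V) 1) (v : InfTensor ξ) {ε : ℝ}
    (hε : 0 < ε) : ∃ w ∈ Submodule.span ℂ (Set.range (InfTensor.tprod ξ)), ‖v - w‖ < ε := by
  have hv : v ∈ (Submodule.span ℂ (Set.range (InfTensor.tprod ξ))).topologicalClosure := by
    rw [closure_span_tprod]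
    trivial
  have hv' : v ∈ closure (Submodule.span ℂ (Set.range (InfTensor.tprod ξ)) : Set (InfTensor ξ)) :=
    hv
  obtain ⟨w, hw, h⟩ := Metric.mem_closure_iff.1 hv' ε hε
  exact ⟨w, hw, by rwa [← dist_eq_norm]⟩

/-- A vector that depends on finitely many places satisfies the independence relation with the
decomposable vectors that are trivial at these places. -/
theorem inner_eq_of_mem_span (ξ : P → Metric.sphere (0 : V) 1) {w : InfTensor ξ}
    (hw : w ∈ Submodule.span ℂ (Set.range (InfTensor.tprod ξ))) :
    ∃ B : Set P, B.Finite ∧ ∀ y : Decomp ξ, (∀ α ∈ B, y.1 α = ξ α) →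
      inner ℂ w (InfTensor.tprod ξ y) =
        inner ℂ w (InfTensor.vacuum ξ) * inner ℂ (InfTensor.vacuum ξ) (InfTensor.tprod ξ y) := by
  induction hw using Submodule.span_induction with
  | mem w hw =>
    obtain ⟨x, rfl⟩ := hw
    refine ⟨_, x.2, fun y hy => inner_tprod_of_disjoint ξ x y fun α => ?_⟩
    by_cases h : x.1 α = ξ α
    · exact .inl h
    · exact .inr (hy α h)
  | zero => exact ⟨∅, Set.finite_empty, fun y _ => by simp⟩
  | add w w' _ _ ih ih' =>
    obtain ⟨B, hB, h⟩ := ih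
    obtain ⟨B', hB', h'⟩ := ih'
    refine ⟨B ∪ B', hB.union hB', fun y hy => ?_⟩
    rw [inner_add_left, inner_add_left, h y fun α hα => hy α (.inl hα),
      h' y fun α hα => hy α (.inr hα), add_mul]
  | smul z w _ ih =>
    obtain ⟨B, hB, h⟩ := ih
    refine ⟨B, hB, fun y hy => ?_⟩
    rw [inner_smul_left, inner_smul_left, h y hy, mul_assoc]

variable {κ : Type*} [Finite κ] {c : P → κ} (e : κ → Metric.sphere (0 : V) 1)

theorem tensorRep_vacuum {k : bigG c} (hk : k ∈ bigK c) :
    tensorRep c e k (InfTensor.vacuum fun α => e (c α)) = InfTensor.vacuum fun α => e (c α) := by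
  refine (tensorRep_tprod c e k _).trans (congrArg _ (permDecomp_eq_self e hk _ ?_))
  exact fun α h => absurd rfl h

/-- If piece-preserving permutations move each finite set of places off each other finite set, then
their fixed vectors are the multiples of the vacuum. A fixed vector `v` has the same inner product
with `⨂ y_α` and with its translates; when the finitely many nontrivial places of `y` move away,
these translates converge weakly to a multiple of the vacuum. -/
theorem eq_smul_vacuum_of_fixed {L : Set (bigG c)} (hL : ∀ k ∈ L, k ∈ bigK c)
    (hmove : ∀ A B : Set P, A.Finite → B.Finite → ∃ k ∈ L, ∀ α ∈ A, k.1 α ∉ B)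
    {v : InfTensor fun α => e (c α)} (hv : ∀ k ∈ L, tensorRep c e k v = v) :
    ∃ z : ℂ, v = z • InfTensor.vacuum fun α => e (c α) := by
  set E := InfTensor.vacuum (fun α => e (c α)) with hE
  have hE1 : ‖E‖ = 1 := norm_vacuum _
  have key : ∀ y : Decomp (fun α => e (c α)), inner ℂ v (InfTensor.tprod (fun α => e (c α)) y) =
      inner ℂ v E * inner ℂ E (InfTensor.tprod (fun α => e (c α)) y) := by
    intro y
    set t := InfTensor.tprod (fun α => e (c α)) y with ht
    rw [← sub_eq_zero, ← norm_le_zero_iff]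
    refine le_of_forall_pos_le_add fun δ hδ => ?_
    obtain ⟨ε, hε, hεδ⟩ : ∃ ε > 0, ε * (2 * ‖t‖) ≤ δ := by
      refine ⟨δ / (2 * ‖t‖ + 1), by positivity, ?_⟩
      rw [div_mul_eq_mul_div, div_le_iff₀ (by positivity)]
      nlinarith [norm_nonneg t]
    obtain ⟨w, hw, hvw⟩ := exists_near_finite _ v hε
    obtain ⟨B, hB, hwB⟩ := inner_eq_of_mem_span _ hw
    obtain ⟨k, hk, hkB⟩ := hmove _ B y.2 hB
    have h1 : inner ℂ v t =
        inner ℂ v (InfTensor.tprod (fun α => e (c α)) (permDecomp c e k y)) := by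
      rw [← tensorRep_tprod, ← (tensorRep c e k).inner_map_map v t, hv k hk]
    have h2 : inner ℂ E t =
        inner ℂ E (InfTensor.tprod (fun α => e (c α)) (permDecomp c e k y)) := by
      rw [← tensorRep_tprod, ← (tensorRep c e k).inner_map_map E t, hE,
        tensorRep_vacuum e (hL k hk)]
    have h3 := hwB (permDecomp c e k y) (by
      intro β hβ
      obtain ⟨α, rfl⟩ := k.1.surjective β
      rw [permDecomp_apply]
      by_contra hne
      refine hkB α (fun h => hne ?_) hβ
      exact h.trans (congrArg (fun p => (e p : V)) (hL k hk α).symm))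
    set t' := InfTensor.tprod (fun α => e (c α)) (permDecomp c e k y) with ht'
    have hnorm : ‖t'‖ = ‖t‖ := by
      rw [ht', ← tensorRep_tprod, LinearIsometryEquiv.norm_map]
    -- For `w` in place of `v` the difference vanishes, since `k` moves `y` off the places of `w`.
    have h4 : inner ℂ v t - inner ℂ v E * inner ℂ E t =
        inner ℂ (v - w) t' - inner ℂ (v - w) E * inner ℂ E t' := by
      rw [h1, h2, inner_sub_left, inner_sub_left, h3]
      ring
    rw [h4, zero_add]
    have h5 : ‖inner ℂ (v - w) t'‖ ≤ ε * ‖t‖ := by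
      refine (norm_inner_le_norm _ _).trans ?_
      rw [hnorm]
      exact mul_le_mul_of_nonneg_right hvw.le (norm_nonneg _)
    have h6 : ‖inner ℂ (v - w) E * inner ℂ E t'‖ ≤ ε * ‖t‖ := by
      rw [norm_mul]
      refine mul_le_mul ?_ ?_ (norm_nonneg _) hε.le
      · refine (norm_inner_le_norm _ _).trans ?_
        rw [hE1, mul_one]
        exact hvw.le
      · refine (norm_inner_le_norm _ _).trans ?_
        rw [hE1, one_mul, hnorm]
    calc _ ≤ _ := norm_sub_le _ _
      _ ≤ ε * ‖t‖ + ε * ‖t‖ := add_le_add h5 h6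
      _ ≤ δ := by linarith
  refine ⟨inner ℂ E v, ?_⟩
  have h0 : ∀ u : InfTensor (fun α => e (c α)), inner ℂ (v - inner ℂ E v • E) u = 0 := by
    intro u
    have hu : u ∈ (Submodule.span ℂ
        (Set.range (InfTensor.tprod (fun α => e (c α))))).topologicalClosure := by
      rw [closure_span_tprod]
      trivial
    have hclosed :
        IsClosed {u : InfTensor (fun α => e (c α)) | inner ℂ (v - inner ℂ E v • E) u = 0} :=
      isClosed_eq (continuous_const.inner continuous_id) continuous_const
    refine closure_minimal (fun u hu => ?_) hclosed hu
    change u ∈ Submodule.span ℂ (Set.range (InfTensor.tprod (fun α => e (c α)))) at hu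
    change inner ℂ (v - inner ℂ E v • E) u = 0
    induction hu using Submodule.span_induction with
    | mem u hu =>
      obtain ⟨y, rfl⟩ := hu
      rw [inner_sub_left, key, inner_smul_left, inner_conj_symm, sub_self]
    | zero => exact inner_zero_right _
    | add u u' _ _ h h' => rw [inner_add_right, h, h', add_zero]
    | smul z u _ h => rw [inner_smul_right, h, mul_zero]
  exact sub_eq_zero.1 (inner_self_eq_zero.1 (h0 _))

/-- Strong continuity: close to `g`, the group acts in the same way as `g` on a vector that depends
on finitely many places, and such vectors are dense. -/
theorem continuous_tensorRep {G : Type*} [Group G] (t : TopologicalSpace G) (φ : G →* bigG c)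
    (h : ∀ (A : Set P), A.Finite → ∀ g, ∃ U, IsOpen[t] U ∧ g ∈ U ∧ ∀ g' ∈ U, ∃ k ∈ bigK c,
      (∀ α ∈ A, k.1 α = α) ∧ φ g' = φ g * k) (v : InfTensor fun α => e (c α)) :
    Continuous[t, _] fun g => tensorRep c e (φ g) v := by
  have hfix : ∀ w ∈ Submodule.span ℂ (Set.range (InfTensor.tprod (fun α => e (c α)))),
      ∃ A : Set P, A.Finite ∧
      ∀ k ∈ bigK c, (∀ α ∈ A, k.1 α = α) → tensorRep c e k w = w := by
    intro w hw
    induction hw using Submodule.span_induction with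
    | mem w hw =>
      obtain ⟨x, rfl⟩ := hw
      refine ⟨_, x.2, fun k hk hA => ?_⟩
      exact (tensorRep_tprod c e k x).trans (congrArg _ (permDecomp_eq_self e hk x hA))
    | zero => exact ⟨∅, Set.finite_empty, fun k _ _ => map_zero _⟩
    | add w w' _ _ ih ih' =>
      obtain ⟨A, hA, h1⟩ := ih
      obtain ⟨A', hA', h2⟩ := ih'
      refine ⟨A ∪ A', hA.union hA', fun k hk hf => ?_⟩
      rw [map_add, h1 k hk fun α hα => hf α (.inl hα), h2 k hk fun α hα => hf α (.inr hα)]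
    | smul z w _ ih =>
      obtain ⟨A, hA, h1⟩ := ih
      exact ⟨A, hA, fun k hk hf => by rw [map_smul, h1 k hk hf]⟩
  let := t
  rw [continuous_iff_continuousAt]
  intro g
  rw [Metric.continuousAt_iff']
  intro ε hε
  obtain ⟨w, hw, hvw⟩ := exists_near_finite _ v (half_pos hε)
  obtain ⟨A, hA, hAw⟩ := hfix w hw
  obtain ⟨U, hU, hgU, hUk⟩ := h A hA g
  filter_upwards [hU.mem_nhds hgU] with g' hg'
  obtain ⟨k, hk, hkA, hgk⟩ := hUk g' hg'
  rw [hgk, map_mul, dist_eq_norm]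
  change ‖tensorRep c e (φ g) (tensorRep c e k v) - tensorRep c e (φ g) v‖ < ε
  rw [← map_sub, LinearIsometryEquiv.norm_map]
  have h1 : tensorRep c e k v - v = tensorRep c e k (v - w) - (v - w) := by
    rw [map_sub, hAw k hk hkA]
    abel
  rw [h1]
  calc _ ≤ ‖tensorRep c e k (v - w)‖ + ‖v - w‖ := norm_sub_le _ _
    _ = ‖v - w‖ + ‖v - w‖ := by rw [LinearIsometryEquiv.norm_map]
    _ < ε := by linarith

end TensorLemmas

/-! ### Spherical functions -/

/-- The spherical function. Only the finitely many `α` that change the piece contribute to the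
product; the factors with `p = q` are powers of `1`, whatever the value of `ncard`. -/
theorem inner_tensorRep_vacuum {P V κ : Type*} [NormedAddCommGroup V] [InnerProductSpace ℂ V]
    [Fintype κ] (c : P → κ) (e : κ → Metric.sphere (0 : V) 1) (S : Matrix κ κ ℂ)
    (hS : ∀ p, S p p = 1) (he : ∀ p q, inner ℂ (e p : V) (e q : V) = S p q) (σ : bigG c) :
    inner ℂ (tensorRep c e σ (InfTensor.vacuum fun α => e (c α)))
      (InfTensor.vacuum fun α => e (c α)) = nessonovFunction c S σ.1 := by
  classical
  have hfin : {α | c (σ.1 α) ≠ c α}.Finite :=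
    (Set.finite_iUnion fun p => σ.2 p).subset fun α h => Set.mem_iUnion.2 ⟨c α, rfl, h⟩
  have h1 : inner ℂ (tensorRep c e σ (InfTensor.vacuum fun α => e (c α)))
      (InfTensor.vacuum fun α => e (c α)) = ∏ᶠ α, S (c α) (c (σ.1 α)) := by
    refine (congrArg (inner ℂ · _) (tensorRep_tprod c e σ _)).trans
      ((InfTensor.inner_tprod _ _ _).trans ?_)
    refine (finprod_eq_of_bijective σ.1 σ.1.bijective fun α => ?_).symm
    exact (he _ _).symm.trans (congrArg (inner ℂ · (e (c (σ.1 α)) : V))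
      (permDecomp_apply c e σ ⟨fun α => e (c α), by simp⟩ α).symm)
  rw [h1, finprod_eq_prod_of_mulSupport_subset (s := hfin.toFinset) _ (by
    intro α hα
    rw [Set.Finite.coe_toFinset]
    intro h
    refine hα ?_
    change S (c α) (c (σ.1 α)) = 1
    rw [h, hS])]
  unfold nessonovFunction
  rw [← Finset.prod_product', Finset.univ_product_univ,
    ← Finset.prod_fiberwise hfin.toFinset (fun α => (c α, c (σ.1 α)))]
  refine Finset.prod_congr rfl fun x _ => ?_
  obtain ⟨p, q⟩ := x
  have h2 : ∀ α ∈ hfin.toFinset.filter (fun α => (c α, c (σ.1 α)) = (p, q)),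
      S (c α) (c (σ.1 α)) = S p q := by
    intro α hα
    have := (Finset.mem_filter.1 hα).2
    rw [Prod.mk.injEq] at this
    rw [this.1, this.2]
  rw [Finset.prod_congr rfl h2, Finset.prod_const]
  by_cases hpq : p = q
  · rw [hpq, hS, one_pow, one_pow]
  · congr 1
    rw [← Set.ncard_coe_finset]
    congr 1
    ext α
    simp only [Finset.coe_filter, Set.Finite.mem_toFinset, Set.mem_ofPred_eq, Prod.mk.injEq]
    refine ⟨fun h => h.2, fun h => ⟨fun h' => hpq ?_, h⟩⟩
    rw [← h.1, ← h.2, h']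

open scoped MatrixOrder in
/-- The columns of `B` are Gram vectors of `S = Bᴴ B`. -/
theorem exists_gram_vectors {κ : Type*} [Fintype κ] {S : Matrix κ κ ℂ} (hS : S.PosSemidef)
    (h1 : ∀ p, S p p = 1) : ∃ e : κ → Metric.sphere (0 : EuclideanSpace ℂ κ) 1,
      ∀ p q, inner ℂ (e p : EuclideanSpace ℂ κ) (e q) = S p q := by
  classical
  obtain ⟨B, hB⟩ := CStarAlgebra.nonneg_iff_eq_star_mul_self.1 hS.nonneg
  let v : κ → EuclideanSpace ℂ κ := fun p => WithLp.toLp 2 fun r => B r p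
  have hv : ∀ p q, inner ℂ (v p) (v q) = S p q := by
    intro p q
    rw [hB, Matrix.star_eq_conjTranspose, Matrix.mul_apply, PiLp.inner_apply]
    refine Finset.sum_congr rfl fun r _ => ?_
    simp [v, mul_comm]
  refine ⟨fun p => ⟨v p, ?_⟩, hv⟩
  rw [mem_sphere_zero_iff_norm]
  have h := hv p p
  rw [h1, inner_self_eq_norm_sq_to_K] at h
  have h' : (‖v p‖ : ℂ) ^ 2 = 1 := h
  have h2 : ‖v p‖ ^ 2 = 1 := by exact_mod_cast h'
  nlinarith [norm_nonneg (v p)]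

/-! ### Cyclic spans of spherical vectors -/

/-- If the `K`-fixed vectors are the multiples of `v`, then the representation in the cyclic span of
`v` is spherical. It is irreducible since the projection to a closed invariant subspace maps `v` to
a `K`-fixed vector, which is a multiple of `v`: the subspace contains `v` or is orthogonal to it. -/
theorem isSpherical_cyclicRep {G H : Type*} [Group G] [NormedAddCommGroup H]
    [InnerProductSpace ℂ H] [CompleteSpace H] (t : TopologicalSpace G) (K : Subgroup G)
    (ρ : G →* (H ≃ₗᵢ[ℂ] H)) (v : H) (hv : v ≠ 0)
    (hcont : ∀ x, Continuous[t, _] fun g => ρ g x)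
    (hfix : ∀ x, (∀ k ∈ K, ρ k x = x) ↔ ∃ z : ℂ, x = z • v) :
    IsSpherical t K (cyclicRep ρ v) ⟨v, mem_cyclicSpan ρ v⟩ := by
  have hfix' : ∀ x : cyclicSpan ρ v, (∀ k ∈ K, cyclicRep ρ v k x = x) ↔
      ∃ z : ℂ, x = z • (⟨v, mem_cyclicSpan ρ v⟩ : cyclicSpan ρ v) := by
    intro x
    have := hfix x
    simp only [Subtype.ext_iff, Submodule.coe_smul]
    exact this
  refine ⟨fun x => ?_, fun W hW hinv => ?_, fun h => hv (congrArg Subtype.val h), hfix'⟩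
  · let := t
    exact (hcont x).subtype_mk _
  · set v' : cyclicSpan ρ v := ⟨v, mem_cyclicSpan ρ v⟩ with hv'
    have hWc : CompleteSpace W := hW.completeSpace_coe
    have hperp : ∀ g, ∀ x ∈ Wᗮ, cyclicRep ρ v g x ∈ Wᗮ := by
      intro g x hx w hw
      have h1 := hx _ (hinv g⁻¹ w hw)
      rw [← (cyclicRep ρ v g).inner_map_map] at h1
      have h2 : cyclicRep ρ v g (cyclicRep ρ v g⁻¹ w) = w := by
        change (cyclicRep ρ v g * cyclicRep ρ v g⁻¹) w = w
        rw [← map_mul, mul_inv_cancel, map_one]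
        rfl
      rwa [h2] at h1
    obtain ⟨w, hw, u, hu, hwu⟩ : ∃ w ∈ W, ∃ u ∈ Wᗮ, v' = w + u :=
      W.exists_add_mem_mem_orthogonal v'
    have hgen : ∀ Y : Submodule ℂ (cyclicSpan ρ v), IsClosed (Y : Set (cyclicSpan ρ v)) →
        (∀ g, ∀ x ∈ Y, cyclicRep ρ v g x ∈ Y) → v' ∈ Y → Y = ⊤ := by
      intro Y hY hYinv hvY
      have hmap : cyclicSpan ρ v ≤ Y.map (cyclicSpan ρ v).subtype := by
        refine Submodule.topologicalClosure_minimal _ ?_ ?_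
        · rw [Submodule.span_le]
          rintro _ ⟨g, rfl⟩
          exact ⟨cyclicRep ρ v g v', hYinv g v' hvY, rfl⟩
        · exact (Submodule.isClosed_topologicalClosure _).isClosedEmbedding_subtypeVal.isClosedMap
            _ hY
      rw [Submodule.eq_top_iff']
      intro x
      obtain ⟨y, hy, hyx⟩ := hmap x.2
      rwa [← Subtype.ext (show (y : H) = x from hyx)]
    have hwfix : ∀ k ∈ K, cyclicRep ρ v k w = w := by
      intro k hk
      have h1 : cyclicRep ρ v k v' = v' := (hfix' v').2 ⟨1, by simp⟩ k hk
      rw [hwu, map_add] at h1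
      have h2 : cyclicRep ρ v k w - w = u - cyclicRep ρ v k u := by
        rw [sub_eq_sub_iff_add_eq_add, h1, add_comm]
      have h3 : cyclicRep ρ v k w - w ∈ W := W.sub_mem (hinv k w hw) hw
      have h4 : cyclicRep ρ v k w - w ∈ Wᗮ := h2 ▸ Wᗮ.sub_mem hu (hperp k u hu)
      exact sub_eq_zero.1 (inner_self_eq_zero.1 (h4 _ h3))
    obtain ⟨z, hz⟩ := (hfix' w).1 hwfix
    by_cases hz0 : z = 0
    · left
      rw [hz0, zero_smul] at hz
      have hvperp : v' ∈ Wᗮ := by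
        rw [hwu, hz, zero_add]
        exact hu
      have := hgen Wᗮ (Submodule.isClosed_orthogonal W) hperp hvperp
      rwa [Submodule.orthogonal_eq_top_iff] at this
    · right
      refine hgen W hW hinv ?_
      rw [show v' = z⁻¹ • w by rw [hz, smul_smul, inv_mul_cancel₀ hz0, one_smul]]
      exact W.smul_mem _ hw

/-! ### Spherical representations of the group of spheromorphisms -/

open scoped Pointwise in
/-- If all orbits of a group are infinite, then each finite set can be moved off each other finite
set. Otherwise the group would be covered by finitely many cosets of stabilizers, and one of these
would have finite index by the lemma of B. H. Neumann. -/
theorem exists_smul_not_mem {G P : Type*} [Group G] [MulAction G P]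
    (h : ∀ a : P, (MulAction.orbit G a).Infinite) {A B : Set P} (hA : A.Finite) (hB : B.Finite) :
    ∃ g : G, ∀ a ∈ A, g • a ∉ B := by
  classical
  by_contra! hc
  let s : Finset (P × P) := hA.toFinset ×ˢ hB.toFinset
  let g : P × P → G := fun x => if hx : ∃ g : G, g • x.1 = x.2 then hx.choose else 1
  have hg : ∀ x : P × P, (∃ g : G, g • x.1 = x.2) → g x • x.1 = x.2 := fun x hx => by
    have : g x = hx.choose := dif_pos hx
    rw [this]
    exact hx.choose_spec
  have hcov : ⋃ x ∈ s, g x • (MulAction.stabilizer G x.1 : Set G) = Set.univ := by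
    refine Set.eq_univ_of_forall fun k => ?_
    obtain ⟨a, ha, hk⟩ := hc k
    refine Set.mem_biUnion (x := (a, k • a)) (by simp [s, ha, hk]) ?_
    rw [Set.mem_smul_set_iff_inv_smul_mem, SetLike.mem_coe, MulAction.mem_stabilizer_iff,
      smul_eq_mul, mul_smul, inv_smul_eq_iff]
    exact (hg (a, k • a) ⟨k, rfl⟩).symm
  obtain ⟨x, -, hx⟩ := Subgroup.exists_finiteIndex_of_leftCoset_cover hcov
  have : Finite (G ⧸ MulAction.stabilizer G x.1) := Subgroup.finite_quotient_of_finiteIndex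
  have : Finite (MulAction.orbit G x.1) :=
    Finite.of_equiv _ (MulAction.orbitEquivQuotientStabilizer G x.1).symm
  exact h x.1 (Set.toFinite _)

section Hier

variable {X : Type*} {T : SimpleGraph X} {n : ℕ}

theorem IsRegularTree.exists_aut_not_mem (hR : IsRegularTree T n) {ι : ℕ}
    {A B : Set (ClopRes T n ι)} (hA : A.Finite) (hB : B.Finite) :
    ∃ r : T ≃g T, ∀ Ω ∈ A, hR.clopPerm ι (autToHier T r) Ω ∉ B := by
  let act : MulAction (T ≃g T) (ClopRes T n ι) :=
    MulAction.compHom _ ((hR.clopPerm ι).comp (autToHier T))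
  refine exists_smul_not_mem (G := T ≃g T) (fun Ω => ?_) hA hB
  change (Set.range fun r : T ≃g T => hR.clopPerm ι (autToHier T r) Ω).Infinite
  exact hR.infinite_range_clopPerm Ω

/-- A clopen set is preserved by the automorphisms that fix the ends of the edges of finitely many
balls. -/
theorem exists_finset_image_eq {ι : ℕ} (Ω : ClopRes T n ι) : ∃ F : Finset X, ∀ r : T ≃g T,
    (∀ v ∈ F, r v = v) → autHomeo T r '' (Ω : Set (Boundary T)) = Ω := by
  classical
  obtain ⟨m, B, -, hB, -, hΩ⟩ := Ω.2.2.2.2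
  choose p q hpq hBpq using hB
  refine ⟨Finset.univ.image p ∪ Finset.univ.image q, fun r hr => ?_⟩
  rw [hΩ, Set.image_iUnion]
  refine Set.iUnion_congr fun i => ?_
  rw [hBpq, autHomeo_image_ball, hr (p i) (by simp), hr (q i) (by simp)]

theorem exists_isOpen_hierTopology (hR : IsRegularTree T n) {ι N : ℕ} {R : Fin N → Thorn n}
    (hd : ∀ i j, i ≠ j → Disjoint ((R i).clopens T) ((R j).clopens T))
    {A : Set (ClopRes T n ι)} (hA : A.Finite) (g : Hier T) :
    ∃ U, IsOpen[hierTopology T] U ∧ g ∈ U ∧ ∀ g' ∈ U, ∃ k ∈ bigK (pieceOf T ι R),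
      (∀ Ω ∈ A, k.1 Ω = Ω) ∧ hierToBigG hR ι R hd g' = hierToBigG hR ι R hd g * k := by
  classical
  choose F hF using fun Ω : ClopRes T n ι => exists_finset_image_eq Ω
  let F' : Finset X := hA.toFinset.biUnion F
  refine ⟨{h | ∃ r : T ≃g T, (∀ v ∈ F', r v = v) ∧ h = g * autToHier T r},
    TopologicalSpace.isOpen_generateFrom_of_mem ⟨g, F', rfl⟩,
    ⟨1, fun _ _ => rfl, by rw [map_one, mul_one]⟩, ?_⟩
  rintro _ ⟨r, hr, rfl⟩
  refine ⟨hierToBigG hR ι R hd (autToHier T r), pieceOf_autToHier hR hd r, fun Ω hΩ => ?_,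
    map_mul _ _ _⟩
  exact Subtype.ext (hF Ω r fun v hv =>
    hr v (Finset.mem_biUnion.2 ⟨Ω, hA.mem_toFinset.2 hΩ, hv⟩))

theorem exists_isOpen_bigGTopology {P κ : Type*} [Finite κ] (c : P → κ) {A : Set P}
    (hA : A.Finite) (g : bigG c) : ∃ U, IsOpen[bigGTopology c] U ∧ g ∈ U ∧ ∀ g' ∈ U,
      ∃ k ∈ bigK c, (∀ α ∈ A, k.1 α = α) ∧ MonoidHom.id (bigG c) g' = MonoidHom.id _ g * k :=
  ⟨{τ | ∃ k ∈ bigK c, (∀ α ∈ hA.toFinset, k.1 α = α) ∧ τ = g * k},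
    TopologicalSpace.isOpen_generateFrom_of_mem ⟨g, hA.toFinset, rfl⟩,
    ⟨1, one_mem _, fun _ _ => rfl, (mul_one g).symm⟩,
    fun _ ⟨k, hk, hkA, h⟩ => ⟨k, hk, fun α hα => hkA α (hA.mem_toFinset.2 hα), h⟩⟩

end Hier

end Sphero

theorem mainTheorem5 {X : Type*} (T : SimpleGraph X) (n : ℕ) (hn : 2 ≤ n) (hT : T.IsTree)
    (hval : ∀ v, (T.neighborSet v).ncard = n + 1)
    (ι : ℕ) (hι : ι < n - 1) (N : ℕ) (R : Fin N → Sphero.Thorn n)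
    (hred : ∀ j, (R j).IsReduced)
    (hres : ∀ j, (R j).spike.ncard ≡ ι [MOD n - 1])
    (hiso : ∀ i j, i ≠ j → ¬ (R i).Isomorphic (R j)) :
    -- the thorns correspond to disjoint orbits in the countable set of clopen sets
    (Sphero.ClopRes T n ι).Countable ∧
    (∀ j, ∃ Ω ∈ Sphero.ClopRes T n ι, (R j).clopens T = Sphero.autOrbit T Ω) ∧
    (∀ j, (R j).clopens T ⊆ Sphero.ClopRes T n ι) ∧
    (∀ i j, i ≠ j → Disjoint ((R i).clopens T) ((R j).clopens T)) ∧
    (∀ (Ω : Sphero.ClopRes T n ι) (j : Fin N), Sphero.pieceOf T ι R Ω = some j ↔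
      (Ω : Set (Sphero.Boundary T)) ∈ (R j).clopens T) ∧
    (∀ p, {Ω : Sphero.ClopRes T n ι | Sphero.pieceOf T ι R Ω = p}.Infinite) ∧
    -- the action on clopen sets embeds the groups
    ∃ φ : Sphero.Hier T →* Sphero.bigG (Sphero.pieceOf T ι R),
      (∀ (g : Sphero.Hier T) (Ω : Sphero.ClopRes T n ι),
        (((φ g).1 Ω : Sphero.ClopRes T n ι) : Set (Sphero.Boundary T)) = g.1 '' Ω) ∧
      Function.Injective φ ∧
      (∀ g ∈ Sphero.autSubgroup T, φ g ∈ Sphero.bigK (Sphero.pieceOf T ι R)) ∧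
      -- the spherical representations
      ∀ S : Matrix (Option (Fin N)) (Option (Fin N)) ℂ, S.PosSemidef → (∀ p, S p p = 1) →
        (∃ e : Option (Fin N) →
            Metric.sphere (0 : EuclideanSpace ℂ (Option (Fin N))) 1,
          ∀ p q, inner ℂ (e p : EuclideanSpace ℂ (Option (Fin N))) (e q) = S p q) ∧
        ∀ (V : Type*) [NormedAddCommGroup V] [InnerProductSpace ℂ V] [FiniteDimensional ℂ V]
          (e : Option (Fin N) → Metric.sphere (0 : V) 1),
          (∀ p q, inner ℂ (e p : V) (e q : V) = S p q) →
          let c := Sphero.pieceOf T ι R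
          let ρ := Sphero.tensorRep c e
          let E := Sphero.InfTensor.vacuum fun Ω => e (c Ω)
          ‖E‖ = 1 ∧
          -- the representation of the pair (𝐆, 𝐊)
          Sphero.IsSpherical (Sphero.bigGTopology c) (Sphero.bigK c)
            (Sphero.cyclicRep ρ E) ⟨E, Sphero.mem_cyclicSpan ρ E⟩ ∧
          (∀ σ, inner ℂ (ρ σ E) E = Sphero.nessonovFunction c S σ.1) ∧
          -- its restriction to Hier(T)
          (∀ x, (∀ g ∈ Sphero.autSubgroup T, ρ (φ g) x = x) ↔ ∃ z : ℂ, x = z • E) ∧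
          Sphero.IsSpherical (Sphero.hierTopology T) (Sphero.autSubgroup T)
            (Sphero.cyclicRep (ρ.comp φ) E) ⟨E, Sphero.mem_cyclicSpan (ρ.comp φ) E⟩ ∧
          (∀ g, inner ℂ ((ρ.comp φ) g E) E = Sphero.nessonovFunction c S (φ g).1) := by
  have hR : Sphero.IsRegularTree T n := ⟨hT, hn, hval⟩
  have hd : ∀ i j, i ≠ j → Disjoint ((R i).clopens T) ((R j).clopens T) := fun i j hij =>
    Sphero.disjoint_clopens hR (hred i) (hred j) (hiso i j hij)
  refine ⟨hR.countable ι, fun j => ?_, fun j => ?_, hd, Sphero.pieceOf_eq_some_iff hd,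
    Sphero.pieceOf_infinite hR hred hres hd, Sphero.hierToBigG hR ι R hd, fun g Ω => rfl,
    fun g g' h => hR.clopPerm_injective ι (congrArg Subtype.val h), ?_, ?_⟩
  · obtain ⟨f⟩ := (R j).exists_embedding hR
    exact ⟨_, Sphero.Thorn.clopen_mem_clopRes hR (hred j) (hres j) f,
      Sphero.Thorn.clopens_eq_autOrbit hR f⟩
  · rintro _ ⟨f, rfl⟩
    exact Sphero.Thorn.clopen_mem_clopRes hR (hred j) (hres j) f
  · rintro _ ⟨r, rfl⟩
    exact Sphero.pieceOf_autToHier hR hd r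
  intro S hS hS1
  refine ⟨Sphero.exists_gram_vectors hS hS1, ?_⟩
  intro V _ _ _ e he c ρ E
  have hK : ∀ g ∈ Sphero.autSubgroup T,
      Sphero.hierToBigG hR ι R hd g ∈ Sphero.bigK (Sphero.pieceOf T ι R) := by
    rintro _ ⟨r, rfl⟩
    exact Sphero.pieceOf_autToHier hR hd r
  have hE : ‖E‖ = 1 := Sphero.norm_vacuum _
  have hE0 : E ≠ 0 := fun h => by simp [h] at hE
  have hfixK : ∀ k ∈ Sphero.bigK c, ∀ z : ℂ, ρ k (z • E) = z • E := fun k hk z => by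
    rw [map_smul]
    exact congrArg (z • ·) (Sphero.tensorRep_vacuum e hk)
  have hfix : ∀ x, (∀ g ∈ Sphero.autSubgroup T, ρ (Sphero.hierToBigG hR ι R hd g) x = x) →
      ∃ z : ℂ, x = z • E := by
    intro x hx
    refine Sphero.eq_smul_vacuum_of_fixed e
      (L := Sphero.hierToBigG hR ι R hd '' Sphero.autSubgroup T) ?_ ?_ ?_
    · rintro _ ⟨g, hg, rfl⟩
      exact hK g hg
    · intro A B hA hB
      obtain ⟨r, hr⟩ := hR.exists_aut_not_mem hA hB
      exact ⟨_, ⟨_, ⟨r, rfl⟩, rfl⟩, hr⟩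
    · rintro _ ⟨g, hg, rfl⟩
      exact hx g hg
  have hfix' : ∀ x, (∀ g ∈ Sphero.autSubgroup T, ρ (Sphero.hierToBigG hR ι R hd g) x = x) ↔
      ∃ z : ℂ, x = z • E := by
    refine fun x => ⟨hfix x, ?_⟩
    rintro ⟨z, rfl⟩ g hg
    exact hfixK _ (hK g hg) z
  refine ⟨hE, ?_, Sphero.inner_tensorRep_vacuum c e S hS1 he, hfix', ?_, fun g =>
    Sphero.inner_tensorRep_vacuum c e S hS1 he _⟩
  · refine Sphero.isSpherical_cyclicRep _ _ ρ E hE0 ?_ fun x => ⟨fun h => ?_, ?_⟩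
    · exact Sphero.continuous_tensorRep e _ (MonoidHom.id _)
        fun A hA g => Sphero.exists_isOpen_bigGTopology c hA g
    · exact hfix x fun g hg => h _ (hK g hg)
    · rintro ⟨z, rfl⟩ k hk
      exact hfixK k hk z
  · refine Sphero.isSpherical_cyclicRep _ _ (ρ.comp _) E hE0 ?_ hfix'
    exact Sphero.continuous_tensorRep e _ (Sphero.hierToBigG hR ι R hd)
      fun A hA g => Sphero.exists_isOpen_hierTopology hR hd hA g
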